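/- **Model.** There are $d$ tasks and $n_1+n_2<d$ workers, split into two disjoint groups $\mathcal N_1,\mathcal N_2$ of sizes $n_1\ge 3$ and $n_2$. Task $j$ has a type $k_j\in\{1,2\}$, each type having exactly $d/2$ tasks. The truth values $y_j\in\{-1,1\}$ are independent and uniform, and worker $i$ gives the response $Y_{ij}\in\{-1,1\}$ with $\mathbb P(Y_{ij}=y_j)=(1+r_{k_ji})/2$; the correctness indicators are independent over all $(i,j)$ and of $y$. There are $\rho_1,\rho_2\in(0,1/2)$ with $\rho_k\le (1+r_{ki})/2\le 1-\rho_k$ for all workers $i$ and $k=1,2$. **Parameters of $\mathcal N_1$.** With $r_1,r_2$ restricted to $\mathcal N_1$, assume $\|r_1\|>\|r_2\|$ and $r_1^Tr_2\ne0$, and put $\omega=\left|\frac{\|r_1\|^2-\|r_2\|^2}{2r_1^Tr_2}\right|$, $\gamma=\omega+\sqrt{\omega^2+1}$ and $\Delta=\frac{2}{dn_1}(\lambda_1-\lambda_2)$, where $\lambda_1\ge\lambda_2$ are the two largest eigenvalues of the $d\times d$ matrix $R=(r_{k_j}^Tr_{k_l})_{j,l}$. **Parameters of $\mathcal N_2$.**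 With all workers taken in $\mathcal N_2$, let $V_k=\min_i\max_{a\ne b\ne i\neq a}\sqrt{|r_{ka}r_{kb}|}$, $\bar r_k=\frac1{n_2}\sum_ir_{ki}$, $\Phi_k=-\frac1{2n_2}\sum_i\log(1-r_{ki}^2)$, and for $w\in\mathbb R^{n_2}$ let $$\varphi(w,r_k)=-\inf_{t>0}\frac1{n_2}\sum_i\log\Big(\tfrac12e^{tw_i}(1-r_{ki})+\tfrac12e^{-tw_i}(1+r_{ki})\Big).$$ For a task of type $k$ and $k'\neq k$ the other type, $\varphi(r_1,r_2)$ denotes $\varphi(w,r_k)$ with $w_i=\log\frac{1+r_{k'i}}{1-r_{k'i}}$. Assume $V_k>0$ and $\bar r_k\ge 3/n_2$ for $k=1,2$. **Algorithm.** (1) Let $T_{jl}=\frac1{n_1}\sum_{i\in\mathcal N_1}Y_{ij}Y_{il}$, let $\hat v$ be a unit principal eigenvector of $T$, and $\hat\mu=\frac1d\sum_j|\hat v_j|$. Put $\hat k_j=1$ if $|\hat v_j|>\hat\mu$, $\hat k_j=2$ if $|\hat v_j|<\hat\mu$, and let $\hat k_j$ be an independent fair choice in case of equality. Let $\mathcal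 J_k=\{j:\hat k_j=k\}$. (2) For each $k$ run Triangular Estimation (TE) on the responses of $\mathcal N_2$ to $\mathcal J_k$: with $\hat C_{ab}=\frac1{|\mathcal J_k|}\sum_{j\in\mathcal J_k}Y_{aj}Y_{bj}$, choose for each $i$ a pair $a_i\neq b_i$ of workers other than $i$ that maximizes $|\hat C_{a_ib_i}|$, put $|\hat r_{ki}|=\sqrt{|\hat C_{a_ii}\hat C_{b_ii}/\hat C_{a_ib_i}|}$ (or $0$ if $\hat C_{a_ib_i}=0$), choose $i^*$ maximizing $\big||\hat r_{ki}|^2+\sum_{a\ne i}\hat C_{ai}\big|$, give $\hat r_{ki^*}$ the sign of $|\hat r_{ki^*}|^2+\sum_{a\ne i^*}\hat C_{ai^*}$, and give $\hat r_{ki}$, $i\ne i^*$, the sign of $\hat r_{ki^*}\hat C_{ii^*}$, where a sign equal to $0$ gives the estimate $0$. Maximizers and eigenvectors may be selected in any way from the data. (3) For $j\in\mathcal J_k$ put $\hat y_j=\operatorname{sign}\big(\sum_{i\in\mathcal N_2}Y_{ij}\log\frac{1+\hat r_{ki}}{1-\hat r_{ki}}\big)$. (A tie counts as an error; $\log x$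 is read as $\log|x|$, a quotient by $0$ as $0$, and $\log 0$ as $0$ for estimates outside $(-1,1)$.) **Theorem.** Suppose that for $k=1,2$ $$n_1\ \ge\ \frac{\gamma^2+1}{(\gamma-1)^2}\,\frac{\log d}{\Delta}\,\max\Big\{\frac{48\log n_1}{V_k^2\Phi_k\rho_k},\,3\bar r_k\Big\}$$ and that the number of tasks satisfies $$d\ \ge\ \frac{30\cdot2^8\,\log^2(n_2)\,\log(8n_2^2d)}{V_k^2}\max\Big\{\frac{36}{\Phi_k^2\rho_k^2V_k^2},\frac1{n_2\bar r_k^2}\Big\}.$$ Then, as $n_2\to\infty$ (hence also $d\to\infty$), with high probability $$\mathbb P(\hat y_j\ne y_j\mid\hat k_j=k_j)\le\exp(-(1+o(1))\,n_2\Phi_{k_j}),\qquad \mathbb P(\hat y_j\ne y_j\mid\hat k_j\ne k_j)\le\exp(-(1+o(1))\,n_2\,\varphi(r_1,r_2)).$$ Precisely: for every $\varepsilon>0$ there is $N$ such that for every instance as above with $n_2\ge N$ there is an event $E$, determined by the outcome $(\hat k,\hat r)$ of clustering and reliability estimation, with $\mathbb P(E)\ge1-\varepsilon$, such that for every task $j$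 $$\mathbb P(\hat y_j\ne y_j\mid E,\ \hat k_j=k_j)\le e^{-(1-\varepsilon)n_2\Phi_{k_j}},\qquad \mathbb P(\hat y_j\ne y_j\mid E,\ \hat k_j\ne k_j)\le e^{-(1-\varepsilon)n_2\varphi(r_1,r_2)}$$ (a conditional probability given an event of probability $0$ is read as $0$). -/

import Mathlib

open MeasureTheory ProbabilityTheory

noncomputable section

namespace Crowd

/-! Labels and responses are elements of `ℤˣ = {1, -1}`.  Task types are elements of `Fin 2`:
`0` is the first ("easy") type and `1` is the second ("hard") type. -/

/-- The other task type. -/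
def otherType (k : Fin 2) : Fin 2 := if k = 0 then 1 else 0

/-- The numerical value `±1` of a label or response. -/
def val (s : ℤˣ) : ℝ := ((s : ℤ) : ℝ)

section Model

variable {Ω ι : Type*} {d : ℕ}

/-- The basic random signs: truth values `y j`, agreement signs `Y i j * y j`, and the fair
coins `U j` used to break ties. -/
def signFamily (y : Fin d → Ω → ℤˣ) (Y : ι → Fin d → Ω → ℤˣ) (U : Fin d → Ω → ℤˣ) :
    (Fin d ⊕ (ι × Fin d)) ⊕ Fin d → Ω → ℤˣ
  | Sum.inl (Sum.inl j) => y j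
  | Sum.inl (Sum.inr p) => fun ω => Y p.1 p.2 ω * y p.2 ω
  | Sum.inr j => U j

/-- The two-type Dawid-Skene model: the truth values are independent and uniform, worker `i`
answers task `j` correctly with probability `(1 + r (k j) i) / 2`, independently over workers and
tasks; `U` are independent fair coins. -/
structure IsTwoTypeModel [MeasurableSpace Ω] (μ : Measure Ω) (k : Fin d → Fin 2)
    (r : Fin 2 → ι → ℝ) (y : Fin d → Ω → ℤˣ) (Y : ι → Fin d → Ω → ℤˣ)
    (U : Fin d → Ω → ℤˣ) : Prop where
  measurable_y : ∀ j, Measurable (y j)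
  measurable_Y : ∀ i j, Measurable (Y i j)
  measurable_U : ∀ j, Measurable (U j)
  indep : iIndepFun (signFamily y Y U) μ
  prob_y : ∀ j, μ.real {ω | y j ω = 1} = 1 / 2
  prob_Y : ∀ i j, μ.real {ω | Y i j ω = y j ω} = (1 + r (k j) i) / 2
  prob_U : ∀ j, μ.real {ω | U j ω = 1} = 1 / 2

end Model

section Parameters

variable {ι : Type*} [Fintype ι] {d : ℕ}

/-- The reliability matrix `R`, with entries `r_{k_j}ᵀ r_{k_l}`. -/
def relMatrix (k : Fin d → Fin 2) (r : Fin 2 → ι → ℝ) : Matrix (Fin d) (Fin d) ℝ :=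
  Matrix.of fun j l => ∑ i, r (k j) i * r (k l) i

theorem relMatrix_isHermitian (k : Fin d → Fin 2) (r : Fin 2 → ι → ℝ) :
    (relMatrix k r).IsHermitian := by
  ext j l
  simp [relMatrix, Matrix.conjTranspose_apply, mul_comm]

/-- The `m`-th largest eigenvalue (counted from `0`, with multiplicity) of `R`. -/
def relEigenvalue (k : Fin d → Fin 2) (r : Fin 2 → ι → ℝ) (m : ℕ) : ℝ :=
  if h : m < Fintype.card (Fin d) then (relMatrix_isHermitian k r).eigenvalues₀ ⟨m, h⟩ else 0

/-- The scaled eigengap `Δ = 2 (λ₁ - λ₂) / (d n)`, i.e. the nonnegative number with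
`Δ² = 4 (λ₁ - λ₂)² / (d² n²)`. -/
def eigengap (k : Fin d → Fin 2) (r : Fin 2 → ι → ℝ) : ℝ :=
  2 / ((d : ℝ) * (Fintype.card ι : ℝ)) * (relEigenvalue k r 0 - relEigenvalue k r 1)

/-- `ω = |(‖r₁‖² - ‖r₂‖²) / (2 r₁ᵀ r₂)|`. -/
def omega (r : Fin 2 → ι → ℝ) : ℝ :=
  |(∑ i, r 0 i ^ 2 - ∑ i, r 1 i ^ 2) / (2 * ∑ i, r 0 i * r 1 i)|

/-- `γ = ω + √(ω² + 1)`. -/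
def gam (r : Fin 2 → ι → ℝ) : ℝ := omega r + Real.sqrt (omega r ^ 2 + 1)

/-- The average reliability. -/
def avgRel (r : ι → ℝ) : ℝ := (∑ i, r i) / (Fintype.card ι : ℝ)

/-- `V = min_i max_{a, b, i pairwise distinct} √|r_a r_b|`. -/
def informativeness (r : ι → ℝ) : ℝ :=
  ⨅ i : ι, ⨆ p : {p : ι × ι // p.1 ≠ p.2 ∧ p.1 ≠ i ∧ p.2 ≠ i},
    Real.sqrt |r p.1.1 * r p.1.2|

/-- `Φ = -(1 / (2 n)) ∑_i log (1 - r_i²)`. -/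
def renyi (r : ι → ℝ) : ℝ :=
  -(1 / (2 * (Fintype.card ι : ℝ))) * ∑ i, Real.log (1 - r i ^ 2)

/-- The exponent of the weighted majority vote with weights `w` under reliabilities `r`. -/
def wmvExponent (w r : ι → ℝ) : ℝ :=
  -⨅ t : Set.Ioi (0 : ℝ), (1 / (Fintype.card ι : ℝ)) * ∑ i,
    Real.log (1 / 2 * Real.exp (t * w i) * (1 - r i) + 1 / 2 * Real.exp (-t * w i) * (1 + r i))

/-- The Nitzan-Paroush weights. -/
def npWeights (r : ι → ℝ) : ι → ℝ := fun i => Real.log ((1 + r i) / (1 - r i))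

end Parameters

section Algorithm

variable {ι : Type*} [Fintype ι] {d : ℕ}

/-- The task-similarity matrix `T = (1 / n) Yᵀ Y`. -/
def taskSimilarity (B : ι → Fin d → ℤˣ) : Matrix (Fin d) (Fin d) ℝ :=
  Matrix.of fun j l => (1 / (Fintype.card ι : ℝ)) * ∑ i, val (B i j) * val (B i l)

/-- `v` is a unit-norm eigenvector of `T` for its largest eigenvalue. -/
def IsPrincipalEigenvector (T : Matrix (Fin d) (Fin d) ℝ) (v : Fin d → ℝ) : Prop :=
  ∑ j, v j ^ 2 = 1 ∧ ∃ lam : ℝ, T.mulVec v = lam • v ∧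
    ∀ lam' : ℝ, Module.End.HasEigenvalue (Matrix.toLin' T) lam' → lam' ≤ lam

/-- Type estimates obtained by thresholding the absolute entries of `v` at their average, with ties
broken by the coins `c`. -/
def clusterBy (v : Fin d → ℝ) (c : Fin d → ℤˣ) (j : Fin d) : Fin 2 :=
  if (∑ l, |v l|) / (d : ℝ) < |v j| then 0
  else if |v j| < (∑ l, |v l|) / (d : ℝ) then 1
  else if c j = 1 then 0 else 1

/-- The set of tasks assigned to type `k`. -/
def cluster (κ : Fin d → Fin 2) (k : Fin 2) : Finset (Fin d) :=
  Finset.univ.filter fun j => κ j = k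

/-- The worker-covariance matrix computed on the tasks in `J`. -/
def workerCov (J : Finset (Fin d)) (B : ι → Fin d → ℤˣ) (a b : ι) : ℝ :=
  (∑ j ∈ J, val (B a j) * val (B b j)) / (J.card : ℝ)

/-- Magnitude of the reliability of worker `i` estimated from the pair of co-workers `(a, b)`. -/
def teMagnitude (C : ι → ι → ℝ) (a b i : ι) : ℝ :=
  if 0 < |C a b| then Real.sqrt |C a i * C b i / C a b| else 0

open Classical in
/-- The sign statistic of worker `i`, for a magnitude estimate `m`. -/
def teSignStat (C : ι → ι → ℝ) (m : ℝ) (i : ι) : ℝ :=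
  m ^ 2 + ∑ l ∈ Finset.univ.filter (fun l => l ≠ i), C l i

/-- `rh` is an output of the Triangular Estimation algorithm on the worker-covariance matrix `C`:
`(a i, b i)` is a most informative pair of co-workers of `i`, `s` is a worker with largest sign
statistic in absolute value, and the other signs are assigned by reference to `s`.
Any maximizers may be used. -/
def IsTEEstimate (C : ι → ι → ℝ) (rh : ι → ℝ) : Prop :=
  ∃ (a b : ι → ι) (m : ι → ℝ) (s : ι),
    (∀ i, a i ≠ b i ∧ a i ≠ i ∧ b i ≠ i ∧
      ∀ a' b', a' ≠ b' → a' ≠ i → b' ≠ i → |C a' b'| ≤ |C (a i) (b i)|) ∧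
    (∀ i, m i = teMagnitude C (a i) (b i) i) ∧
    (∀ i, |teSignStat C (m i) i| ≤ |teSignStat C (m s) s|) ∧
    rh s = Real.sign (teSignStat C (m s) s) * m s ∧
    ∀ i, i ≠ s → rh i = Real.sign (rh s * C i s) * m i

/-- The weighted majority vote on task `j` (with value `0` in case of a tie). -/
def vote (w : ι → ℝ) (B : ι → Fin d → ℤˣ) (j : Fin d) : ℝ :=
  Real.sign (∑ i, w i * val (B i j))

end Algorithm

section Overall

variable {Ω : Type*} {n₁ n₂ d : ℕ}

/-- Type estimates of the overall algorithm, computed from the first group of workers; `evec`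
returns the principal eigenvector. -/
def typeEst (evec : (Fin n₁ → Fin d → ℤˣ) → Fin d → ℝ)
    (Y : Fin n₁ ⊕ Fin n₂ → Fin d → Ω → ℤˣ) (U : Fin d → Ω → ℤˣ) (ω : Ω) : Fin d → Fin 2 :=
  clusterBy (evec fun i j => Y (Sum.inl i) j ω) (fun j => U j ω)

/-- Reliability estimates of the overall algorithm for each type, computed from the second group of
workers on the estimated clusters; `te J` returns the Triangular Estimation output on the
tasks `J`. -/
def relEst (evec : (Fin n₁ → Fin d → ℤˣ) → Fin d → ℝ)
    (te : Finset (Fin d) → (Fin n₂ → Fin d → ℤˣ) → Fin n₂ → ℝ)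
    (Y : Fin n₁ ⊕ Fin n₂ → Fin d → Ω → ℤˣ) (U : Fin d → Ω → ℤˣ) (ω : Ω) :
    Fin 2 → Fin n₂ → ℝ :=
  fun k => te (cluster (typeEst evec Y U ω) k) (fun i j => Y (Sum.inr i) j ω)

/-- Label estimates of the overall algorithm: the Nitzan-Paroush vote of the second group of workers
with the reliabilities estimated on the cluster of the task. -/
def labelEst (evec : (Fin n₁ → Fin d → ℤˣ) → Fin d → ℝ)
    (te : Finset (Fin d) → (Fin n₂ → Fin d → ℤˣ) → Fin n₂ → ℝ)
    (Y : Fin n₁ ⊕ Fin n₂ → Fin d → Ω → ℤˣ) (U : Fin d → Ω → ℤˣ) (j : Fin d) (ω : Ω) : ℝ :=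
  vote (npWeights (relEst evec te Y U ω (typeEst evec Y U ω j)))
    (fun i j => Y (Sum.inr i) j ω) j

end Overall

end Crowd

end

noncomputable section

namespace Crowd

instance : MeasurableSingletonClass ℤˣ where
  measurableSet_singleton x := ⟨{(x : ℤ)}, measurableSet_singleton _, by
    ext y
    simp [Units.ext_iff]⟩

theorem val_one : val 1 = 1 := by simp [val]

theorem val_neg_one : val (-1) = -1 := by simp [val]

theorem val_mul (s t : ℤˣ) : val (s * t) = val s * val t := by simp [val]

theorem val_eq_or (s : ℤˣ) : val s = 1 ∨ val s = -1 := by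
  rcases Int.units_eq_one_or s with rfl | rfl
  · exact Or.inl val_one
  · exact Or.inr val_neg_one

theorem val_sq (s : ℤˣ) : val s ^ 2 = 1 := by
  rcases val_eq_or s with h | h <;> rw [h] <;> norm_num

theorem val_mul_self (s : ℤˣ) : val s * val s = 1 := by rw [← sq, val_sq]

theorem abs_val (s : ℤˣ) : |val s| = 1 := by
  rcases val_eq_or s with h | h <;> rw [h] <;> norm_num

variable {Ω α : Type*} [MeasurableSpace Ω] {μ : Measure Ω}

/-- An independent family of random signs with means `m`. -/
structure IsSignFamily (μ : Measure Ω) (X : α → Ω → ℤˣ) (m : α → ℝ) : Prop where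
  measurable : ∀ a, Measurable (X a)
  indep : iIndepFun X μ
  prob : ∀ a, μ.real {ω | X a ω = 1} = (1 + m a) / 2

theorem measurableSet_of_finite_range {β : Type*} [MeasurableSpace β] [DiscreteMeasurableSpace β]
    {Z : Ω → β} (hZ : Measurable Z) (s : Set β) : MeasurableSet {ω | Z ω ∈ s} :=
  hZ (MeasurableSet.of_discrete)

theorem integrable_comp_of_finite [IsFiniteMeasure μ] {β : Type*} [MeasurableSpace β]
    [DiscreteMeasurableSpace β] [Finite β] {Z : Ω → β} (hZ : Measurable Z) (f : β → ℝ) :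
    Integrable (fun ω => f (Z ω)) μ :=
  Integrable.comp_measurable (μ := μ) (f := Z) (g := f) Integrable.of_finite hZ

/-- A bound that holds for every frozen value of an independent variable holds jointly. -/
theorem measureReal_le_of_indepFun [IsProbabilityMeasure μ] {β γ : Type*} [MeasurableSpace β]
    [MeasurableSpace γ] [DiscreteMeasurableSpace β] [DiscreteMeasurableSpace γ] [Fintype γ]
    {A : Ω → β} {B : Ω → γ} (hB : Measurable B) (h : IndepFun A B μ)
    (S : β → γ → Prop) {δ : ℝ} (hS : ∀ b, μ.real {ω | S (A ω) b} ≤ δ) :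
    μ.real {ω | S (A ω) (B ω)} ≤ δ := by
  classical
  have h1 : {ω | S (A ω) (B ω)} = ⋃ b ∈ (Finset.univ : Finset γ),
      (A ⁻¹' {a | S a b} ∩ B ⁻¹' {b}) := by
    ext ω
    simp
  have h2 : ∀ b : γ, μ.real (A ⁻¹' {a | S a b} ∩ B ⁻¹' {b}) ≤ δ * μ.real (B ⁻¹' {b}) := by
    intro b
    have := h.measure_inter_preimage_eq_mul {a | S a b} {b} MeasurableSet.of_discrete
      MeasurableSet.of_discrete
    rw [measureReal_def, this, ENNReal.toReal_mul]
    exact mul_le_mul_of_nonneg_right (hS b) ENNReal.toReal_nonneg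
  have h3 : ∑ b, μ.real (B ⁻¹' {b}) = 1 := by
    have h4 : μ.real (⋃ b ∈ (Finset.univ : Finset γ), B ⁻¹' {b}) = ∑ b, μ.real (B ⁻¹' {b}) := by
      refine measureReal_biUnion_finset ?_ ?_
      · intro b _ c _ hbc
        exact Disjoint.preimage _ (by simpa using hbc)
      · intro b _
        exact hB (MeasurableSet.of_discrete)
    rw [← h4]
    have : (⋃ b ∈ (Finset.univ : Finset γ), B ⁻¹' {b}) = Set.univ := by
      ext ω; simp
    rw [this]; simp
  rw [h1]
  calc _ ≤ ∑ b, μ.real (A ⁻¹' {a | S a b} ∩ B ⁻¹' {b}) := measureReal_biUnion_finset_le _ _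
    _ ≤ ∑ b, δ * μ.real (B ⁻¹' {b}) := Finset.sum_le_sum fun b _ => h2 b
    _ = δ := by rw [← Finset.mul_sum, h3, mul_one]

theorem iIndepFun_of_indepFun_tuple [IsProbabilityMeasure μ] {κ β : Type*} [MeasurableSpace β]
    {g : κ → Ω → β}
    (h : ∀ j (S : Finset κ), j ∉ S → IndepFun (g j) (fun ω (l : S) => g l ω) μ) :
    iIndepFun g μ := by
  classical
  rw [iIndepFun_iff_measure_inter_preimage_eq_mul]
  intro S
  induction S using Finset.induction_on with
  | empty => intro s _; simp
  | insert j S hj ih =>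
    intro s hs
    rw [Finset.set_biInter_insert, Finset.prod_insert hj,
      ← ih fun i hi => hs i (Finset.mem_insert_of_mem hi)]
    have h1 : (⋂ i ∈ S, g i ⁻¹' s i) =
        (fun ω (l : S) => g l ω) ⁻¹' (Set.univ.pi fun l : S => s l) := by
      ext ω
      simp
    rw [h1]
    refine (h j S hj).measure_inter_preimage_eq_mul _ _ (hs j (Finset.mem_insert_self _ _)) ?_
    exact MeasurableSet.univ_pi fun l => hs l (Finset.mem_insert_of_mem l.2)

namespace IsSignFamily

variable {X : α → Ω → ℤˣ} {m : α → ℝ}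

theorem precomp (hX : IsSignFamily μ X m) {β : Type*} {g : β → α} (hg : Function.Injective g) :
    IsSignFamily μ (fun b => X (g b)) (fun b => m (g b)) :=
  ⟨fun _ => hX.measurable _, hX.indep.precomp hg, fun _ => hX.prob _⟩

/-- Functions of disjoint blocks of a sign family are independent. -/
theorem iIndepFun_blocks [IsProbabilityMeasure μ] (hX : IsSignFamily μ X m) {κ β : Type*}
    [MeasurableSpace β] (B : κ → Finset α) (hB : ∀ i j, i ≠ j → Disjoint (B i) (B j))
    (φ : ∀ j, (B j → ℤˣ) → β) :
    iIndepFun (fun j ω => φ j fun a => X a ω) μ := by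
  classical
  refine iIndepFun_of_indepFun_tuple fun j S hj => ?_
  have h1 : Disjoint (B j) (S.biUnion B) := by
    rw [Finset.disjoint_biUnion_right]
    intro i hi
    exact hB _ _ fun h => hj (h ▸ hi)
  have h2 := hX.indep.indepFun_finset _ _ h1 hX.measurable
  exact h2.comp (φ := φ j) (ψ := fun (f : ↥(S.biUnion B) → ℤˣ) (l : S) =>
    φ l fun a => f ⟨a, Finset.mem_biUnion.2 ⟨l, l.2, a.2⟩⟩)
    (Measurable.of_discrete) (measurable_pi_lambda _ fun l => Measurable.of_discrete)

theorem indepFun_restrict (hX : IsSignFamily μ X m) {β γ : Type*} [MeasurableSpace β]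
    [MeasurableSpace γ] (S T : Finset α) (hST : Disjoint S T)
    (φ : (S → ℤˣ) → β) (ψ : (T → ℤˣ) → γ) :
    IndepFun (fun ω => φ fun a => X a ω) (fun ω => ψ fun a => X a ω) μ :=
  (hX.indep.indepFun_finset _ _ hST hX.measurable).comp (φ := φ) (ψ := ψ)
    Measurable.of_discrete Measurable.of_discrete

variable [IsProbabilityMeasure μ]

theorem prob_neg (hX : IsSignFamily μ X m) (a : α) : μ.real {ω | X a ω = -1} = (1 - m a) / 2 := by
  have h1 : {ω | X a ω = -1} = {ω | X a ω = 1}ᶜ := by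
    ext ω
    rcases Int.units_eq_one_or (X a ω) with h | h <;> simp [h]
  rw [h1, probReal_compl_eq_one_sub, hX.prob]
  · ring
  · exact hX.measurable a (MeasurableSet.of_discrete (s := {1}))

theorem integral_comp (hX : IsSignFamily μ X m) (a : α) (f : ℤˣ → ℝ) :
    ∫ ω, f (X a ω) ∂μ = (1 + m a) / 2 * f 1 + (1 - m a) / 2 * f (-1) := by
  have hm : MeasurableSet {ω | X a ω = 1} :=
    hX.measurable a (MeasurableSet.of_discrete (s := {1}))
  have hm' : MeasurableSet {ω | X a ω = -1} :=
    hX.measurable a (MeasurableSet.of_discrete (s := {-1}))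
  have h1 : (fun ω => f (X a ω)) = fun ω =>
      {ω | X a ω = 1}.indicator (fun _ => f 1) ω +
      {ω | X a ω = -1}.indicator (fun _ => f (-1)) ω := by
    funext ω
    rcases Int.units_eq_one_or (X a ω) with h | h <;> simp [h]
  rw [h1, integral_add, integral_indicator_const _ hm, integral_indicator_const _ hm', hX.prob,
    hX.prob_neg]
  · simp
  · exact (integrable_const _).indicator hm
  · exact (integrable_const _).indicator hm'

theorem abs_mean_le (hX : IsSignFamily μ X m) (a : α) : |m a| ≤ 1 := by
  have h1 := hX.prob a
  have h2 := hX.prob_neg a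
  have h3 : 0 ≤ μ.real {ω | X a ω = 1} := measureReal_nonneg
  have h4 : 0 ≤ μ.real {ω | X a ω = -1} := measureReal_nonneg
  rw [abs_le]; constructor <;> linarith

theorem chernoff (hX : IsSignFamily μ X m) (s : Finset α) (h : α → ℤˣ → ℝ) (c : ℝ) :
    μ.real {ω | c ≤ ∑ a ∈ s, h a (X a ω)} ≤ Real.exp (-c) * ∏ a ∈ s,
      ((1 + m a) / 2 * Real.exp (h a 1) + (1 - m a) / 2 * Real.exp (h a (-1))) := by
  have hind : iIndepFun (fun a ω => h a (X a ω)) μ :=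
    hX.indep.comp (fun a => h a) fun a => Measurable.of_discrete
  have hmeas : ∀ a, Measurable fun ω => h a (X a ω) := fun a =>
    (Measurable.of_discrete (f := h a)).comp (hX.measurable a)
  have h1 := measure_ge_le_exp_mul_mgf (μ := μ) (X := ∑ a ∈ s, fun ω => h a (X a ω)) (t := 1) c
    zero_le_one (by
      simp only [one_mul, Finset.sum_apply]
      have := integrable_comp_of_finite (μ := μ) (Z := fun ω (a : s) => X a ω)
        (measurable_pi_lambda _ fun a => hX.measurable a)
        (fun v => Real.exp (∑ a : s, h a (v a)))
      refine this.congr (Filter.Eventually.of_forall fun ω => ?_)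
      simp only
      rw [Finset.sum_coe_sort s (fun a => h a (X a ω))])
  rw [hind.mgf_sum hmeas] at h1
  simp only [Finset.sum_apply, neg_mul, one_mul] at h1
  refine h1.trans (le_of_eq ?_)
  congr 1
  refine Finset.prod_congr rfl fun a _ => ?_
  simp only [mgf, one_mul]
  exact hX.integral_comp a fun x => Real.exp (h a x)

theorem exp_mean_le (hX : IsSignFamily μ X m) (a : α) (t : ℝ) :
    (1 + m a) / 2 * Real.exp (t * (1 - m a)) + (1 - m a) / 2 * Real.exp (t * (-1 - m a)) ≤
      Real.exp (t ^ 2 / 2) := by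
  have hmeas : Measurable fun ω => val (X a ω) :=
    (Measurable.of_discrete (f := val)).comp (hX.measurable a)
  have h1 := hasSubgaussianMGF_of_mem_Icc (μ := μ) (X := fun ω => val (X a ω)) (a := -1) (b := 1)
    hmeas.aemeasurable (Filter.Eventually.of_forall fun ω => by
      rcases val_eq_or (X a ω) with h | h <;> rw [h] <;> norm_num)
  have h2 := h1.mgf_le t
  have h3 : ∫ ω, val (X a ω) ∂μ = m a := by
    rw [hX.integral_comp a val, val_one, val_neg_one]; ring
  rw [h3] at h2
  simp only [mgf] at h2
  rw [hX.integral_comp a (fun x => Real.exp (t * (val x - m a))), val_one, val_neg_one] at h2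
  refine h2.trans (le_of_eq ?_)
  congr 1
  have : ‖(1 : ℝ) - -1‖₊ = 2 := by
    rw [← NNReal.coe_inj]; simp; norm_num
  rw [this]; norm_num

theorem hoeffding_upper (hX : IsSignFamily μ X m) (s : Finset α) (c : α → ℝ) {v t : ℝ}
    (hv : ∑ a ∈ s, c a ^ 2 ≤ v) (hv0 : 0 < v) (ht : 0 ≤ t) :
    μ.real {ω | t ≤ ∑ a ∈ s, c a * (val (X a ω) - m a)} ≤ Real.exp (-(t ^ 2 / (2 * v))) := by
  have h1 := hX.chernoff s (fun a x => t / v * (c a * (val x - m a))) (t ^ 2 / v)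
  have h2 : {ω | t ≤ ∑ a ∈ s, c a * (val (X a ω) - m a)} ⊆
      {ω | t ^ 2 / v ≤ ∑ a ∈ s, t / v * (c a * (val (X a ω) - m a))} := by
    intro ω hω
    simp only [Set.mem_ofPred_eq] at hω ⊢
    rw [← Finset.mul_sum]
    calc t ^ 2 / v = t / v * t := by ring
      _ ≤ _ := mul_le_mul_of_nonneg_left hω (by positivity)
  refine (measureReal_mono h2).trans (h1.trans ?_)
  have h3 : ∏ a ∈ s, ((1 + m a) / 2 * Real.exp (t / v * (c a * (val 1 - m a))) +
      (1 - m a) / 2 * Real.exp (t / v * (c a * (val (-1) - m a)))) ≤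
      ∏ a ∈ s, Real.exp ((t / v * c a) ^ 2 / 2) := by
    refine Finset.prod_le_prod (fun a _ => ?_) fun a _ => ?_
    · have := abs_le.1 (hX.abs_mean_le a)
      have h1 : 0 ≤ (1 + m a) / 2 := by linarith
      have h2 : 0 ≤ (1 - m a) / 2 := by linarith
      positivity
    · have := hX.exp_mean_le a (t / v * c a)
      rw [val_one, val_neg_one]
      simpa only [mul_assoc] using this
  rw [← Real.exp_sum] at h3
  refine (mul_le_mul_of_nonneg_left h3 (Real.exp_pos _).le).trans ?_
  rw [← Real.exp_add]
  apply Real.exp_le_exp.2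
  have h4 : ∑ a ∈ s, (t / v * c a) ^ 2 / 2 = (t / v) ^ 2 / 2 * ∑ a ∈ s, c a ^ 2 := by
    rw [Finset.mul_sum]; exact Finset.sum_congr rfl fun a _ => by ring
  rw [h4]
  have h5 : (t / v) ^ 2 / 2 * ∑ a ∈ s, c a ^ 2 ≤ (t / v) ^ 2 / 2 * v :=
    mul_le_mul_of_nonneg_left hv (by positivity)
  have h6 : (t / v) ^ 2 / 2 * v = t ^ 2 / (2 * v) := by field_simp
  have h7 : t ^ 2 / v = 2 * (t ^ 2 / (2 * v)) := by field_simp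
  linarith

theorem hoeffding (hX : IsSignFamily μ X m) (s : Finset α) (c : α → ℝ) {v t : ℝ}
    (hv : ∑ a ∈ s, c a ^ 2 ≤ v) (hv0 : 0 < v) (ht : 0 ≤ t) :
    μ.real {ω | t ≤ |∑ a ∈ s, c a * (val (X a ω) - m a)|} ≤
      2 * Real.exp (-(t ^ 2 / (2 * v))) := by
  have h1 := hX.hoeffding_upper s c hv hv0 ht
  have h2 := hX.hoeffding_upper s (fun a => -c a) (v := v) (by simpa using hv) hv0 ht
  have h3 : {ω | t ≤ |∑ a ∈ s, c a * (val (X a ω) - m a)|} ⊆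
      {ω | t ≤ ∑ a ∈ s, c a * (val (X a ω) - m a)} ∪
      {ω | t ≤ ∑ a ∈ s, -c a * (val (X a ω) - m a)} := by
    intro ω hω
    simp only [Set.mem_ofPred_eq, Set.mem_union, neg_mul, Finset.sum_neg_distrib] at hω ⊢
    exact le_abs.1 hω
  calc _ ≤ _ := measureReal_mono h3
    _ ≤ _ := measureReal_union_le _ _
    _ ≤ _ := by linarith

/-- Bernstein's inequality for signs with a common mean. -/
theorem bernstein_upper (hX : IsSignFamily μ X m) (s : Finset α) {r l σ : ℝ}
    (hm : ∀ a ∈ s, m a = r) (hr : r ≤ 1) (hl : 0 < l) (hσ : σ = 1 ∨ σ = -1) :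
    μ.real {ω | (2 * Real.sqrt ((1 - r) / 2 * l) + 4 * l) * s.card ≤
        ∑ a ∈ s, σ * ((r - val (X a ω)) / 2)} ≤ Real.exp (-(l * s.card)) := by
  set f := (1 - r) / 2 with hf
  have hf0 : 0 ≤ f := by rw [hf]; linarith
  have hσ2 : σ ^ 2 = 1 := by rcases hσ with h | h <;> rw [h] <;> norm_num
  have key : ∀ t : ℝ, 0 ≤ t → t ≤ 1 → ∀ z : ℝ,
      μ.real {ω | z ≤ ∑ a ∈ s, σ * ((r - val (X a ω)) / 2)} ≤
        Real.exp (-(t * z) + f * t ^ 2 * s.card) := by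
    intro t ht ht1 z
    have h1 := hX.chernoff s (fun a x => t * (σ * ((r - val x) / 2))) (t * z)
    have h2 : {ω | z ≤ ∑ a ∈ s, σ * ((r - val (X a ω)) / 2)} ⊆
        {ω | t * z ≤ ∑ a ∈ s, t * (σ * ((r - val (X a ω)) / 2))} := by
      intro ω hω
      simp only [Set.mem_ofPred_eq] at hω ⊢
      rw [← Finset.mul_sum]
      exact mul_le_mul_of_nonneg_left hω ht
    refine (measureReal_mono h2).trans (h1.trans ?_)
    rw [Real.exp_add]
    refine mul_le_mul_of_nonneg_left ?_ (Real.exp_pos _).le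
    have h3 : ∀ a ∈ s, (1 + m a) / 2 * Real.exp (t * (σ * ((r - val 1) / 2))) +
        (1 - m a) / 2 * Real.exp (t * (σ * ((r - val (-1)) / 2))) ≤ Real.exp (f * t ^ 2) := by
      intro a ha
      rw [hm a ha, val_one, val_neg_one]
      have e1 : t * (σ * ((r - 1) / 2)) = -(f * (t * σ)) := by rw [hf]; ring
      have e2 : t * (σ * ((r - -1) / 2)) = -(f * (t * σ)) + t * σ := by rw [hf]; ring
      have e3 : (1 + r) / 2 = 1 - f := by rw [hf]; ring
      rw [e1, e2, e3, Real.exp_add, ← hf]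
      have h4 : |Real.exp (t * σ) - 1 - t * σ| ≤ (t * σ) ^ 2 := by
        apply Real.abs_exp_sub_one_sub_id_le
        rcases hσ with h | h <;> rw [h] <;> simp [abs_of_nonneg ht, ht1]
      rw [mul_pow, hσ2, mul_one] at h4
      have h5 := (abs_le.1 h4).2
      calc (1 - f) * Real.exp (-(f * (t * σ))) +
            f * (Real.exp (-(f * (t * σ))) * Real.exp (t * σ))
          = Real.exp (-(f * (t * σ))) * (f * (Real.exp (t * σ) - 1) + 1) := by ring
        _ ≤ Real.exp (-(f * (t * σ))) * Real.exp (f * (Real.exp (t * σ) - 1)) :=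
          mul_le_mul_of_nonneg_left (Real.add_one_le_exp _) (Real.exp_pos _).le
        _ = Real.exp (f * (Real.exp (t * σ) - 1 - t * σ)) := by
          rw [← Real.exp_add]; congr 1; ring
        _ ≤ _ := Real.exp_le_exp.2 (mul_le_mul_of_nonneg_left h5 hf0)
    have h6 := Finset.prod_le_prod (s := s) (fun a ha => ?_) h3
    · refine h6.trans (le_of_eq ?_)
      rw [Finset.prod_const, ← Real.exp_nat_mul]; congr 1; ring
    · have := abs_le.1 (hX.abs_mean_le a)
      have h1 : 0 ≤ (1 + m a) / 2 := by linarith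
      have h2 : 0 ≤ (1 - m a) / 2 := by linarith
      positivity
  have hc : (0 : ℝ) ≤ s.card := Nat.cast_nonneg _
  rcases le_total f l with h | h
  · refine (key 1 zero_le_one le_rfl _).trans (Real.exp_le_exp.2 ?_)
    have h7 : 0 ≤ Real.sqrt (f * l) := Real.sqrt_nonneg _
    have : f * s.card ≤ l * s.card := mul_le_mul_of_nonneg_right h hc
    have h8 : 0 ≤ Real.sqrt (f * l) * s.card := mul_nonneg h7 hc
    have h9 : 0 ≤ l * s.card := mul_nonneg hl.le hc
    nlinarith
  · have hfp : 0 < f := lt_of_lt_of_le hl h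
    refine (key (Real.sqrt (l / f)) (Real.sqrt_nonneg _) ?_ _).trans (Real.exp_le_exp.2 ?_)
    · rw [Real.sqrt_le_left (by norm_num), one_pow]
      exact (div_le_one hfp).2 h
    · have h7 : Real.sqrt (l / f) * Real.sqrt (f * l) = l := by
        rw [← Real.sqrt_mul (by positivity)]
        rw [show l / f * (f * l) = l ^ 2 by field_simp]
        exact Real.sqrt_sq hl.le
      have h8 : f * Real.sqrt (l / f) ^ 2 = l := by
        rw [Real.sq_sqrt (by positivity)]; field_simp
      rw [h8]
      have h9 : 0 ≤ Real.sqrt (l / f) * l * s.card := by positivity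
      have : Real.sqrt (l / f) * ((2 * Real.sqrt (f * l) + 4 * l) * s.card) =
        2 * l * s.card + 4 * (Real.sqrt (l / f) * l * s.card) := by
        linear_combination (2 * (s.card : ℝ)) * h7
      rw [this]
      nlinarith

theorem bernstein (hX : IsSignFamily μ X m) (s : Finset α) {r l : ℝ}
    (hm : ∀ a ∈ s, m a = r) (hr : r ≤ 1) (hl : 0 < l) :
    μ.real {ω | (4 * Real.sqrt ((1 - r) / 2 * l) + 8 * l) * s.card ≤
        |∑ a ∈ s, (val (X a ω) - r)|} ≤ 2 * Real.exp (-(l * s.card)) := by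
  have h1 := hX.bernstein_upper s hm hr hl (σ := 1) (Or.inl rfl)
  have h2 := hX.bernstein_upper s hm hr hl (σ := -1) (Or.inr rfl)
  have h3 : {ω | (4 * Real.sqrt ((1 - r) / 2 * l) + 8 * l) * s.card ≤
        |∑ a ∈ s, (val (X a ω) - r)|} ⊆
      {ω | (2 * Real.sqrt ((1 - r) / 2 * l) + 4 * l) * s.card ≤
        ∑ a ∈ s, 1 * ((r - val (X a ω)) / 2)} ∪
      {ω | (2 * Real.sqrt ((1 - r) / 2 * l) + 4 * l) * s.card ≤
        ∑ a ∈ s, -1 * ((r - val (X a ω)) / 2)} := by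
    intro ω hω
    simp only [Set.mem_ofPred_eq, Set.mem_union] at hω ⊢
    have e1 : ∑ a ∈ s, 1 * ((r - val (X a ω)) / 2) = -(∑ a ∈ s, (val (X a ω) - r)) / 2 := by
      rw [← Finset.sum_neg_distrib, Finset.sum_div]
      exact Finset.sum_congr rfl fun a _ => by ring
    have e2 : ∑ a ∈ s, -1 * ((r - val (X a ω)) / 2) = (∑ a ∈ s, (val (X a ω) - r)) / 2 := by
      rw [Finset.sum_div]
      exact Finset.sum_congr rfl fun a _ => by ring
    rw [e1, e2]
    rcases le_abs.1 hω with h | h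
    · right; linarith
    · left; linarith
  calc _ ≤ _ := measureReal_mono h3
    _ ≤ _ := measureReal_union_le _ _
    _ ≤ _ := by linarith

end IsSignFamily

end Crowd

namespace Crowd

theorem abs_sign_le_one (x : ℝ) : |Real.sign x| ≤ 1 := by
  rcases Real.sign_apply_eq x with h | h | h <;> rw [h] <;> norm_num

theorem one_le_sign_mul_sign_sub {c w v : ℝ} (hc : c ≠ 0) (h : w + c = v ∨ w - c = v) :
    1 ≤ Real.sign c * (Real.sign (w + c - v) - Real.sign (w - c - v)) := by
  rcases lt_or_gt_of_ne hc with hc | hc <;> rcases h with h | h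
  · rw [Real.sign_of_neg hc, show w + c - v = 0 by linarith, Real.sign_zero,
      Real.sign_of_pos (show 0 < w - c - v by linarith)]; norm_num
  · rw [Real.sign_of_neg hc, show w - c - v = 0 by linarith, Real.sign_zero,
      Real.sign_of_neg (show w + c - v < 0 by linarith)]; norm_num
  · rw [Real.sign_of_pos hc, show w + c - v = 0 by linarith, Real.sign_zero,
      Real.sign_of_neg (show w - c - v < 0 by linarith)]; norm_num
  · rw [Real.sign_of_pos hc, show w - c - v = 0 by linarith, Real.sign_zero,
      Real.sign_of_pos (show 0 < w + c - v by linarith)]; norm_num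

theorem sign_mono {x y : ℝ} (h : x ≤ y) : Real.sign x ≤ Real.sign y := by
  rcases lt_trichotomy x 0 with hx | hx | hx <;> rcases lt_trichotomy y 0 with hy | hy | hy <;>
    first
    | (exfalso; linarith)
    | simp [Real.sign_of_neg, Real.sign_of_pos, hx, hy]

theorem zero_le_sign_mul_sign_sub {c w v : ℝ} (hc : c ≠ 0) :
    0 ≤ Real.sign c * (Real.sign (w + c - v) - Real.sign (w - c - v)) := by
  rcases lt_or_gt_of_ne hc with hc | hc
  · rw [Real.sign_of_neg hc]
    have := sign_mono (show w + c - v ≤ w - c - v by linarith)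
    linarith
  · rw [Real.sign_of_pos hc]
    have := sign_mono (show w - c - v ≤ w + c - v by linarith)
    linarith

variable {Ω α : Type*} [MeasurableSpace Ω] {μ : Measure Ω} [IsProbabilityMeasure μ]

theorem prob_eq_of_integral_val {Z : Ω → ℤˣ} (hZ : Measurable Z) :
    μ.real {ω | Z ω = 1} = (1 + ∫ ω, val (Z ω) ∂μ) / 2 := by
  have hm : MeasurableSet {ω | Z ω = 1} := hZ (MeasurableSet.of_discrete (s := {1}))
  have h1 : (fun ω => val (Z ω)) = fun ω =>
      {ω | Z ω = 1}.indicator (fun _ => (2 : ℝ)) ω - 1 := by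
    funext ω
    rcases Int.units_eq_one_or (Z ω) with h | h <;> simp [h, val_one, val_neg_one]
    norm_num
  rw [h1, integral_sub ((integrable_const _).indicator hm) (integrable_const _),
    integral_indicator_const _ hm]
  simp

namespace IsSignFamily

variable {X : α → Ω → ℤˣ} {m : α → ℝ}

theorem measurable_val (hX : IsSignFamily μ X m) (a : α) : Measurable fun ω => val (X a ω) :=
  (Measurable.of_discrete (f := val)).comp (hX.measurable a)

theorem integrable_val (hX : IsSignFamily μ X m) (a : α) : Integrable (fun ω => val (X a ω)) μ :=
  integrable_comp_of_finite (hX.measurable a) val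

theorem integral_val (hX : IsSignFamily μ X m) (a : α) : ∫ ω, val (X a ω) ∂μ = m a := by
  rw [hX.integral_comp a val, val_one, val_neg_one]; ring

/-- The products of two rows of a sign family form a sign family. -/
theorem mul_rows {ι κ : Type*} {X : ι × κ → Ω → ℤˣ} {m : ι × κ → ℝ} (hX : IsSignFamily μ X m)
    {a b : ι} (hab : a ≠ b) :
    IsSignFamily μ (fun j ω => X (a, j) ω * X (b, j) ω) (fun j => m (a, j) * m (b, j)) := by
  classical
  have hm : ∀ j, Measurable fun ω => X (a, j) ω * X (b, j) ω := fun j =>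
    (Measurable.of_discrete (f := fun p : ℤˣ × ℤˣ => p.1 * p.2)).comp
      ((hX.measurable (a, j)).prodMk (hX.measurable (b, j)))
  refine ⟨hm, ?_, fun j => ?_⟩
  · refine hX.iIndepFun_blocks (fun j => {(a, j), (b, j)}) ?_
      (fun j f => f ⟨(a, j), by simp⟩ * f ⟨(b, j), by simp⟩)
    intro i j hij
    rw [Finset.disjoint_left]
    intro p hp hp'
    simp only [Finset.mem_insert, Finset.mem_singleton] at hp hp'
    rcases hp with rfl | rfl <;> simp [hij] at hp'
  · rw [prob_eq_of_integral_val (hm j)]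
    simp only [val_mul]
    have h1 : IndepFun (fun ω => val (X (a, j) ω)) (fun ω => val (X (b, j) ω)) μ :=
      (hX.indep.indepFun (i := (a, j)) (j := (b, j)) (by simp [hab])).comp
        (φ := val) (ψ := val) Measurable.of_discrete Measurable.of_discrete
    rw [h1.integral_fun_mul_eq_mul_integral (hX.measurable_val _).aestronglyMeasurable
      (hX.measurable_val _).aestronglyMeasurable, hX.integral_val, hX.integral_val]

theorem integral_of_indep (hX : IsSignFamily μ X m) {β : Type*} [MeasurableSpace β]
    [DiscreteMeasurableSpace β] [Finite β] {Z : Ω → β} (hZ : Measurable Z) {a : α}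
    (h : IndepFun (X a) Z μ) (G : ℤˣ → β → ℝ) :
    ∫ ω, G (X a ω) (Z ω) ∂μ =
      (1 + m a) / 2 * ∫ ω, G 1 (Z ω) ∂μ + (1 - m a) / 2 * ∫ ω, G (-1) (Z ω) ∂μ := by
  have h1 : (fun ω => G (X a ω) (Z ω)) = fun ω =>
      (1 + val (X a ω)) / 2 * G 1 (Z ω) + (1 - val (X a ω)) / 2 * G (-1) (Z ω) := by
    funext ω
    rcases Int.units_eq_one_or (X a ω) with h | h <;> simp [h, val_one, val_neg_one]
  have hi : ∀ f : ℤˣ → ℝ, ∀ g : β → ℝ, Integrable (fun ω => f (X a ω) * g (Z ω)) μ := fun f g =>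
    integrable_comp_of_finite (μ := μ) (Z := fun ω => (X a ω, Z ω))
      ((hX.measurable a).prodMk hZ) (fun p => f p.1 * g p.2)
  have hp : ∀ f : ℤˣ → ℝ, ∀ g : β → ℝ, ∫ ω, f (X a ω) * g (Z ω) ∂μ =
      (∫ ω, f (X a ω) ∂μ) * ∫ ω, g (Z ω) ∂μ := fun f g =>
    (h.comp (φ := f) (ψ := g) Measurable.of_discrete
      Measurable.of_discrete).integral_fun_mul_eq_mul_integral
      ((Measurable.of_discrete (f := f)).comp (hX.measurable a)).aestronglyMeasurable
      ((Measurable.of_discrete (f := g)).comp hZ).aestronglyMeasurable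
  rw [h1, integral_add (hi (fun x => (1 + val x) / 2) (G 1))
    (hi (fun x => (1 - val x) / 2) (G (-1))), hp (fun x => (1 + val x) / 2) (G 1),
    hp (fun x => (1 - val x) / 2) (G (-1)), hX.integral_comp a (fun x => (1 + val x) / 2),
    hX.integral_comp a (fun x => (1 - val x) / 2), val_one, val_neg_one]
  ring

theorem integral_sq_sum (hX : IsSignFamily μ X m) (s : Finset α) (c : α → ℝ) :
    ∫ ω, (∑ a ∈ s, c a * (val (X a ω) - m a)) ^ 2 ∂μ = ∑ a ∈ s, c a ^ 2 * (1 - m a ^ 2) := by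
  have hmeas : ∀ a, Measurable fun ω => c a * (val (X a ω) - m a) := fun a =>
    ((hX.measurable_val a).sub_const _).const_mul _
  have hint : ∀ a, Integrable (fun ω => c a * (val (X a ω) - m a)) μ := fun a =>
    ((hX.integrable_val a).sub (integrable_const _)).const_mul _
  have h0 : ∀ a, ∫ ω, c a * (val (X a ω) - m a) ∂μ = 0 := fun a => by
    rw [integral_const_mul, integral_sub (hX.integrable_val a) (integrable_const _),
      hX.integral_val]
    simp
  have hmem : ∀ a, MemLp (fun ω => c a * (val (X a ω) - m a)) 2 μ := fun a =>
    (memLp_two_iff_integrable_sq (hmeas a).aestronglyMeasurable).2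
      (integrable_comp_of_finite (hX.measurable a) fun x => (c a * (val x - m a)) ^ 2)
  have h1 := IndepFun.variance_sum (μ := μ) (s := s) (X := fun a ω => c a * (val (X a ω) - m a))
    (fun a _ => hmem a) (fun a _ b _ hab =>
      (hX.indep.indepFun hab).comp (φ := fun x => c a * (val x - m a))
        (ψ := fun x => c b * (val x - m b)) Measurable.of_discrete Measurable.of_discrete)
  rw [variance_of_integral_eq_zero] at h1
  · simp only [Finset.sum_apply] at h1
    rw [h1]
    refine Finset.sum_congr rfl fun a _ => ?_
    rw [variance_of_integral_eq_zero (hmeas a).aemeasurable (h0 a),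
      hX.integral_comp a (fun x => (c a * (val x - m a)) ^ 2), val_one, val_neg_one]
    ring
  · refine Measurable.aemeasurable ?_
    have := Finset.measurable_sum s fun a (_ : a ∈ s) => hmeas a
    convert this using 1
    funext ω
    simp
  · simp only [Finset.sum_apply]
    rw [integral_finsetSum _ fun a _ => hint a]
    exact Finset.sum_eq_zero fun a _ => h0 a

/-- A Littlewood–Offord inequality for biased signs: a linear form with nonzero coefficients takes
each value with small probability. -/
theorem prob_sum_eq_sq_mul_le (hX : IsSignFamily μ X m) (s : Finset α) (c : α → ℝ)
    (hc : ∀ a ∈ s, c a ≠ 0) (v : ℝ) :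
    μ.real {ω | ∑ a ∈ s, c a * val (X a ω) = v} ^ 2 * ∑ a ∈ s, (1 - m a ^ 2) ≤ 4 := by
  classical
  set P := μ.real {ω | ∑ a ∈ s, c a * val (X a ω) = v} with hP
  set Q := ∑ a ∈ s, (1 - m a ^ 2) with hQ
  have hP0 : 0 ≤ P := measureReal_nonneg
  have hQ0 : 0 ≤ Q := Finset.sum_nonneg fun a _ => by
    have := hX.abs_mean_le a
    have := (sq_le_one_iff_abs_le_one _).2 this
    linarith
  rcases hQ0.eq_or_lt with hQ0 | hQ0
  · rw [← hQ0]; norm_num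
  have hset : MeasurableSet {ω | ∑ a ∈ s, c a * val (X a ω) = v} :=
    measurableSet_eq_fun
      (Finset.measurable_sum _ fun a _ => (hX.measurable_val a).const_mul _) measurable_const
  have htuple : Measurable fun ω (a : s) => X a ω := measurable_pi_lambda _ fun a => hX.measurable a
  have hint : ∀ f : (s → ℤˣ) → ℝ, Integrable (fun ω => f fun a : s => X a ω) μ := fun f =>
    integrable_comp_of_finite htuple f
  have hsum : ∀ (f : α → ℤˣ → ℝ) ω, ∑ a ∈ s, f a (X a ω) = ∑ a : s, f a (X a ω) := fun f ω =>
    (Finset.sum_coe_sort s fun a => f a (X a ω)).symm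
  have hone : ∀ a ∈ s, (1 - m a ^ 2) / 2 * P ≤
      ∫ ω, Real.sign (c a) * (val (X a ω) - m a) *
        Real.sign (∑ b ∈ s, c b * val (X b ω) - v) ∂μ := by
    intro a ha
    have hdisj : Disjoint ({a} : Finset α) (s.erase a) := by simp
    have hind : IndepFun (X a) (fun ω (b : s.erase a) => X b ω) μ :=
      hX.indepFun_restrict _ _ hdisj (fun f => f ⟨a, by simp⟩) id
    have hZ : Measurable fun ω (b : s.erase a) => X b ω :=
      measurable_pi_lambda _ fun b => hX.measurable b
    have h1 := hX.integral_of_indep hZ hind (fun x z => Real.sign (c a) * (val x - m a) *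
      Real.sign (c a * val x + ∑ b : s.erase a, c b * val (z b) - v))
    have hsplit : ∀ ω, ∑ b ∈ s, c b * val (X b ω) =
        c a * val (X a ω) + ∑ b : s.erase a, c b * val (X b ω) := by
      intro ω
      rw [← Finset.add_sum_erase _ _ ha, Finset.sum_coe_sort (s.erase a) fun b => c b * val (X b ω)]
    simp only [hsplit]
    rw [h1, val_one, val_neg_one, integral_const_mul, integral_const_mul]
    set W : Ω → ℝ := fun ω => ∑ b : s.erase a, c b * val (X b ω) with hW
    have hf : ∀ f : ℝ → ℝ, Integrable (fun ω => f (W ω)) μ := fun f =>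
      integrable_comp_of_finite hZ fun z => f (∑ b : s.erase a, c b * val (z b))
    have h2 : ∫ ω, Real.sign (c a) * (Real.sign (W ω + c a - v) -
        Real.sign (W ω - c a - v)) ∂μ = Real.sign (c a) *
        (∫ ω, Real.sign (c a * 1 + W ω - v) ∂μ - ∫ ω, Real.sign (c a * -1 + W ω - v) ∂μ) := by
      rw [integral_const_mul, integral_sub (hf fun w => Real.sign (w + c a - v))
        (hf fun w => Real.sign (w - c a - v))]
      congr 3
      · funext ω; congr 1; ring
      · funext ω; congr 1; ring
    have h3 : P ≤ ∫ ω, Real.sign (c a) * (Real.sign (W ω + c a - v) -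
        Real.sign (W ω - c a - v)) ∂μ := by
      have : P = ∫ ω, {ω | ∑ a ∈ s, c a * val (X a ω) = v}.indicator (fun _ => (1 : ℝ)) ω ∂μ := by
        rw [integral_indicator_const _ hset]; simp [hP]
      rw [this]
      refine integral_mono ((integrable_const _).indicator hset)
        (hf fun w => Real.sign (c a) * (Real.sign (w + c a - v) - Real.sign (w - c a - v))) ?_
      intro ω
      by_cases hω : ω ∈ {ω | ∑ a ∈ s, c a * val (X a ω) = v}
      · rw [Set.indicator_of_mem hω]
        apply one_le_sign_mul_sign_sub (hc a ha)
        have hω' : c a * val (X a ω) + W ω = v := by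
          rw [hW, ← hsplit]; exact hω
        rcases val_eq_or (X a ω) with h | h <;> rw [h] at hω'
        · left; linarith
        · right; linarith
      · rw [Set.indicator_of_notMem hω]
        exact zero_le_sign_mul_sign_sub (hc a ha)
    have h4 : 0 ≤ (1 - m a ^ 2) / 2 := by
      have := (sq_le_one_iff_abs_le_one _).2 (hX.abs_mean_le a)
      linarith
    have h5 := mul_le_mul_of_nonneg_left (h3.trans h2.le) h4
    refine h5.trans (le_of_eq ?_)
    ring
  have hT := hX.integral_sq_sum s fun a => Real.sign (c a)
  have hT' : ∑ a ∈ s, Real.sign (c a) ^ 2 * (1 - m a ^ 2) = Q := by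
    refine Finset.sum_congr rfl fun a ha => ?_
    rcases Real.sign_apply_eq_of_ne_zero _ (hc a ha) with h | h <;> rw [h] <;> ring
  rw [hT'] at hT
  have hkey : Q / 2 * P ≤ Real.sqrt Q := by
    have hl : 0 < Real.sqrt Q := Real.sqrt_pos.2 hQ0
    calc Q / 2 * P = ∑ a ∈ s, (1 - m a ^ 2) / 2 * P := by
          rw [← Finset.sum_mul, ← Finset.sum_div]
      _ ≤ ∑ a ∈ s, ∫ ω, Real.sign (c a) * (val (X a ω) - m a) *
            Real.sign (∑ b ∈ s, c b * val (X b ω) - v) ∂μ := Finset.sum_le_sum hone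
      _ = ∫ ω, ∑ a ∈ s, Real.sign (c a) * (val (X a ω) - m a) *
            Real.sign (∑ b ∈ s, c b * val (X b ω) - v) ∂μ := by
          rw [integral_finsetSum]
          intro a ha
          simp only [hsum fun b x => c b * val x]
          exact hint fun z => Real.sign (c a) * (val (z ⟨a, ha⟩) - m a) *
            Real.sign (∑ b : s, c b * val (z b) - v)
      _ ≤ ∫ ω, ((∑ a ∈ s, Real.sign (c a) * (val (X a ω) - m a)) ^ 2 * (2 * Real.sqrt Q)⁻¹ +
            Real.sqrt Q / 2) ∂μ := by
          refine integral_mono ?_ ?_ fun ω => ?_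
          · simp only [hsum fun b x => c b * val x, ← Finset.sum_mul,
              hsum fun b x => Real.sign (c b) * (val x - m b)]
            exact hint fun z => (∑ a : s, Real.sign (c a) * (val (z a) - m a)) *
              Real.sign (∑ b : s, c b * val (z b) - v)
          · simp only [hsum fun b x => Real.sign (c b) * (val x - m b)]
            exact hint fun z => (∑ a : s, Real.sign (c a) * (val (z a) - m a)) ^ 2 *
              (2 * Real.sqrt Q)⁻¹ + Real.sqrt Q / 2
          · simp only
            rw [← Finset.sum_mul]
            set T := ∑ a ∈ s, Real.sign (c a) * (val (X a ω) - m a)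
            set h := Real.sign (∑ b ∈ s, c b * val (X b ω) - v)
            have hh : |h| ≤ 1 := abs_sign_le_one _
            have h1 : T * h ≤ |T| := by
              calc T * h ≤ |T * h| := le_abs_self _
                _ = |T| * |h| := abs_mul _ _
                _ ≤ |T| * 1 := mul_le_mul_of_nonneg_left hh (abs_nonneg _)
                _ = |T| := mul_one _
            refine h1.trans ?_
            rw [← sub_nonneg]
            have : T ^ 2 * (2 * Real.sqrt Q)⁻¹ + Real.sqrt Q / 2 - |T| =
                (|T| - Real.sqrt Q) ^ 2 * (2 * Real.sqrt Q)⁻¹ := by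
              field_simp
              rw [← sq_abs T]; ring
            rw [this]; positivity
      _ = Real.sqrt Q := by
          rw [integral_add, integral_mul_const, hT]
          · simp only [integral_const, probReal_univ, smul_eq_mul, one_mul]
            have := Real.mul_self_sqrt hQ0.le
            field_simp
            nlinarith
          · simp only [hsum fun b x => Real.sign (c b) * (val x - m b)]
            exact hint fun z => (∑ a : s, Real.sign (c a) * (val (z a) - m a)) ^ 2 *
              (2 * Real.sqrt Q)⁻¹
          · exact integrable_const _
  have h1 : Q * P ≤ 2 * Real.sqrt Q := by linarith
  have h2 : (Q * P) ^ 2 ≤ (2 * Real.sqrt Q) ^ 2 := pow_le_pow_left₀ (by positivity) h1 2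
  rw [mul_pow, mul_pow, Real.sq_sqrt hQ0.le] at h2
  have h3 : Q * (P ^ 2 * Q) ≤ Q * 4 := by nlinarith
  exact le_of_mul_le_mul_left h3 hQ0

/-- The error bound for the optimally weighted vote, with slack `δ`. -/
theorem vote_error_le (hX : IsSignFamily μ X m) (s : Finset α) (hm : ∀ a ∈ s, |m a| < 1) (δ : ℝ) :
    μ.real {ω | ∑ a ∈ s, Real.log ((1 + m a) / (1 - m a)) * val (X a ω) ≤ δ} ≤
      Real.exp (δ / 2 + (∑ a ∈ s, Real.log (1 - m a ^ 2)) / 2) := by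
  have h1 := hX.chernoff s (fun a x => -(Real.log ((1 + m a) / (1 - m a)) * val x / 2)) (-(δ / 2))
  have h2 : {ω | ∑ a ∈ s, Real.log ((1 + m a) / (1 - m a)) * val (X a ω) ≤ δ} ⊆
      {ω | -(δ / 2) ≤ ∑ a ∈ s, -(Real.log ((1 + m a) / (1 - m a)) * val (X a ω) / 2)} := by
    intro ω hω
    simp only [Set.mem_ofPred_eq, Finset.sum_neg_distrib, ← Finset.sum_div] at hω ⊢
    linarith
  refine (measureReal_mono h2).trans (h1.trans (le_of_eq ?_))
  rw [neg_neg, Real.exp_add, Finset.sum_div, Real.exp_sum]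
  congr 1
  refine Finset.prod_congr rfl fun a ha => ?_
  obtain ⟨h3, h4⟩ := abs_lt.1 (hm a ha)
  have hp : 0 < 1 + m a := by linarith
  have hq : 0 < 1 - m a := by linarith
  rw [val_one, val_neg_one, Real.log_div hp.ne' hq.ne',
    show 1 - m a ^ 2 = (1 + m a) * (1 - m a) by ring, Real.log_mul hp.ne' hq.ne']
  have e1 : Real.exp (Real.log (1 + m a)) = 1 + m a := Real.exp_log hp
  have e2 : Real.exp (Real.log (1 - m a)) = 1 - m a := Real.exp_log hq
  have key : ∀ x A B : ℝ, Real.exp A = x →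
      x / 2 * Real.exp (-((A - B) * 1 / 2)) = Real.exp ((A + B) / 2) / 2 := by
    rintro x A B rfl
    rw [div_mul_eq_mul_div, ← Real.exp_add]
    congr 2; ring
  have k1 := key _ _ (Real.log (1 - m a)) e1
  have k2 := key _ _ (Real.log (1 + m a)) e2
  rw [k1, show -((Real.log (1 + m a) - Real.log (1 - m a)) * -1 / 2) =
    -((Real.log (1 - m a) - Real.log (1 + m a)) * 1 / 2) by ring, k2,
    add_comm (Real.log (1 - m a))]
  ring

end IsSignFamily

end Crowd

namespace Crowd

theorem sum_Icc_exp_neg_sq_le (B : ℕ) :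
    ∑ z ∈ Finset.Icc (-(B : ℤ)) B, Real.exp (-(z : ℝ) ^ 2) ≤ 4 := by
  classical
  have h1 : Finset.Icc (-(B : ℤ)) B ⊆ (Finset.range (B + 1)).image (fun k : ℕ => (k : ℤ)) ∪
      (Finset.range (B + 1)).image (fun k : ℕ => -(k : ℤ)) := by
    intro z hz
    rw [Finset.mem_Icc] at hz
    simp only [Finset.mem_union, Finset.mem_image, Finset.mem_range]
    rcases le_total 0 z with h | h
    · left; exact ⟨z.toNat, by omega, by omega⟩
    · right; exact ⟨(-z).toNat, by omega, by omega⟩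
  have hk : ∀ k : ℕ, Real.exp (-((k : ℤ) : ℝ) ^ 2) ≤ (1 / 2 : ℝ) ^ k := by
    intro k
    have h2 : Real.exp (-1) ≤ 1 / 2 := by
      rw [Real.exp_neg, inv_le_comm₀ (Real.exp_pos _) (by norm_num)]
      have := Real.add_one_le_exp (1 : ℝ)
      norm_num at this ⊢; linarith
    calc Real.exp (-((k : ℤ) : ℝ) ^ 2) ≤ Real.exp (k * (-1)) := by
          apply Real.exp_le_exp.2
          have : (k : ℝ) ≤ (k : ℝ) ^ 2 := by exact_mod_cast Nat.le_self_pow two_ne_zero k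
          push_cast; linarith
      _ = Real.exp (-1) ^ k := Real.exp_nat_mul _ _
      _ ≤ _ := pow_le_pow_left₀ (Real.exp_pos _).le h2 k
  have hg : ∑ k ∈ Finset.range (B + 1), (1 / 2 : ℝ) ^ k ≤ 2 := by
    have := Summable.sum_le_tsum (Finset.range (B + 1)) (fun k _ => by positivity)
      (summable_geometric_two)
    rwa [tsum_geometric_two] at this
  calc _ ≤ ∑ z ∈ (Finset.range (B + 1)).image (fun k : ℕ => (k : ℤ)) ∪
      (Finset.range (B + 1)).image (fun k : ℕ => -(k : ℤ)), Real.exp (-(z : ℝ) ^ 2) :=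
        Finset.sum_le_sum_of_subset_of_nonneg h1 fun _ _ _ => (Real.exp_pos _).le
    _ ≤ ∑ z ∈ (Finset.range (B + 1)).image (fun k : ℕ => (k : ℤ)), Real.exp (-(z : ℝ) ^ 2) +
        ∑ z ∈ (Finset.range (B + 1)).image (fun k : ℕ => -(k : ℤ)), Real.exp (-(z : ℝ) ^ 2) := by
        rw [← Finset.sum_union_inter]
        exact le_add_of_nonneg_right (Finset.sum_nonneg fun _ _ => (Real.exp_pos _).le)
    _ = ∑ k ∈ Finset.range (B + 1), Real.exp (-((k : ℤ) : ℝ) ^ 2) +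
        ∑ k ∈ Finset.range (B + 1), Real.exp (-((k : ℤ) : ℝ) ^ 2) := by
        rw [Finset.sum_image (by intro a _ b _ h; simpa using h),
          Finset.sum_image (by intro a _ b _ h; simpa using h)]
        simp
    _ ≤ 2 + 2 := by
        gcongr <;> exact (Finset.sum_le_sum fun k _ => hk k).trans hg
    _ = 4 := by norm_num

/-- Integer points in the ball of squared radius `7 n`. -/
def latticeNet (ι : Type*) [Fintype ι] [DecidableEq ι] : Finset (ι → ℤ) :=
  (Fintype.piFinset fun _ : ι => Finset.Icc (-((7 * Fintype.card ι : ℕ) : ℤ))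
    (7 * Fintype.card ι : ℕ)).filter fun z => ∑ i, z i ^ 2 ≤ 7 * Fintype.card ι

variable {ι κ : Type*} [Fintype ι] [DecidableEq ι] [Fintype κ] [DecidableEq κ]

theorem mem_latticeNet {z : ι → ℤ} : z ∈ latticeNet ι ↔ ∑ i, z i ^ 2 ≤ 7 * Fintype.card ι := by
  simp only [latticeNet, Finset.mem_filter, Fintype.mem_piFinset, Finset.mem_Icc,
    and_iff_right_iff_imp]
  intro h i
  have h1 : z i ^ 2 ≤ 7 * Fintype.card ι :=
    (Finset.single_le_sum (f := fun i => z i ^ 2) (fun _ _ => sq_nonneg _)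
      (Finset.mem_univ i)).trans h
  push_cast
  have h2 := Int.le_self_sq (z i)
  have h3 := Int.le_self_sq (-(z i))
  rw [neg_sq] at h3
  constructor <;> linarith

theorem card_latticeNet_le : ((latticeNet ι).card : ℝ) ≤ Real.exp (9 * Fintype.card ι) := by
  set n := Fintype.card ι with hn
  have h1 : ((latticeNet ι).card : ℝ) ≤
      ∑ z ∈ Fintype.piFinset fun _ : ι => Finset.Icc (-((7 * n : ℕ) : ℤ)) (7 * n : ℕ),
        Real.exp (7 * n) * ∏ i, Real.exp (-(z i : ℝ) ^ 2) := by
    rw [Finset.card_eq_sum_ones, latticeNet, Finset.sum_filter, Nat.cast_sum]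
    refine Finset.sum_le_sum fun z _ => ?_
    split_ifs with h
    · rw [Nat.cast_one]
      rw [← Real.exp_sum, ← Real.exp_add]
      apply Real.one_le_exp
      rw [Finset.sum_neg_distrib]
      have : ((∑ i, z i ^ 2 : ℤ) : ℝ) ≤ ((7 * n : ℤ) : ℝ) := by exact_mod_cast h
      push_cast at this
      linarith
    · simp only [Nat.cast_zero]; positivity
  refine h1.trans ?_
  rw [← Finset.mul_sum, Finset.sum_prod_piFinset _ fun (_ : ι) (z : ℤ) => Real.exp (-(z : ℝ) ^ 2),
    Finset.prod_const, Finset.card_univ, ← hn]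
  have h2 : (4 : ℝ) ≤ Real.exp 2 := by
    have h3 := Real.add_one_le_exp (1 : ℝ)
    have h4 : Real.exp 2 = Real.exp 1 * Real.exp 1 := by rw [← Real.exp_add]; norm_num
    nlinarith
  have h5 : (∑ z ∈ Finset.Icc (-((7 * n : ℕ) : ℤ)) (7 * n : ℕ), Real.exp (-(z : ℝ) ^ 2)) ^ n ≤
      Real.exp 2 ^ n :=
    pow_le_pow_left₀ (Finset.sum_nonneg fun _ _ => (Real.exp_pos _).le)
      ((sum_Icc_exp_neg_sq_le _).trans h2) n
  calc _ ≤ Real.exp (7 * n) * Real.exp 2 ^ n := mul_le_mul_of_nonneg_left h5 (Real.exp_pos _).le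
    _ = _ := by rw [← Real.exp_nat_mul, ← Real.exp_add]; congr 1; ring

omit [DecidableEq ι] in
theorem norm_sq_eq_sum (x : EuclideanSpace ℝ ι) : ‖x‖ ^ 2 = ∑ i, x i ^ 2 := by
  rw [EuclideanSpace.norm_eq, Real.sq_sqrt (Finset.sum_nonneg fun _ _ => sq_nonneg _)]
  simp

theorem exists_latticeNet_near (hn : 0 < Fintype.card ι) (x : EuclideanSpace ℝ ι) (hx : ‖x‖ = 1) :
    ∃ z ∈ latticeNet ι, ∃ x' : EuclideanSpace ℝ ι,
      (∀ i, x' i = z i / (2 * Real.sqrt (Fintype.card ι))) ∧ ‖x - x'‖ ≤ 1 / 4 := by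
  set n := Fintype.card ι with hnn
  set q := Real.sqrt n with hq
  have hn' : (0 : ℝ) < n := by exact_mod_cast hn
  have hq0 : 0 < q := Real.sqrt_pos.2 hn'
  have hqq : q ^ 2 = n := Real.sq_sqrt hn'.le
  let z : ι → ℤ := fun i => round (2 * q * x i)
  let x' : EuclideanSpace ℝ ι := WithLp.toLp 2 fun i => (z i : ℝ) / (2 * q)
  have hnear : ‖x - x'‖ ≤ 1 / 4 := by
    apply le_of_sq_le_sq _ (by norm_num)
    rw [norm_sq_eq_sum]
    have h1 : ∀ i, (x - x') i ^ 2 ≤ 1 / (16 * n) := by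
      intro i
      have h2 : (x - x') i = (2 * q * x i - z i) / (2 * q) := by
        simp only [PiLp.sub_apply, x']
        field_simp
      have h3 : |2 * q * x i - z i| ≤ 1 / 2 := abs_sub_round _
      have h4 : (2 * q * x i - z i) ^ 2 ≤ (1 / 2) ^ 2 := by
        rw [← sq_abs]; exact pow_le_pow_left₀ (abs_nonneg _) h3 2
      rw [h2, div_pow, mul_pow, hqq, div_le_div_iff₀ (by positivity) (by positivity)]
      nlinarith
    calc _ ≤ ∑ i : ι, (1 / (16 * n) : ℝ) := Finset.sum_le_sum fun i _ => h1 i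
      _ = (1 / 4) ^ 2 := by
        rw [Finset.sum_const, Finset.card_univ, ← hnn, nsmul_eq_mul]
        field_simp; norm_num
  refine ⟨z, ?_, x', fun i => rfl, hnear⟩
  rw [mem_latticeNet]
  have h1 : ‖x'‖ ≤ 5 / 4 := by
    have : x' = x - (x - x') := by abel
    rw [this]
    refine (norm_sub_le _ _).trans ?_
    rw [hx]; linarith
  have h2 : ‖x'‖ ^ 2 ≤ (5 / 4) ^ 2 := pow_le_pow_left₀ (norm_nonneg _) h1 2
  rw [norm_sq_eq_sum] at h2
  have h3 : ∑ i, x' i ^ 2 = (∑ i, (z i : ℝ) ^ 2) / (4 * n) := by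
    rw [Finset.sum_div]
    refine Finset.sum_congr rfl fun i _ => ?_
    simp only [x']
    rw [div_pow, mul_pow, hqq]; norm_num
  rw [h3, div_le_iff₀ (by positivity)] at h2
  have h4 : ((∑ i, z i ^ 2 : ℤ) : ℝ) ≤ ((7 * n : ℤ) : ℝ) := by
    push_cast; nlinarith
  exact_mod_cast h4

/-- A bilinear form that is bounded on the lattice nets is bounded. -/
theorem sum_sq_le_of_latticeNet (hn : 0 < Fintype.card ι) (hD : 0 < Fintype.card κ)
    (Z : ι → κ → ℝ) {L : ℝ} (hL : 0 ≤ L)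
    (h : ∀ z ∈ latticeNet ι, ∀ w ∈ latticeNet κ, |∑ i, ∑ j, (z i : ℝ) * w j * Z i j| ≤
      L * (4 * (Real.sqrt (Fintype.card ι) * Real.sqrt (Fintype.card κ)))) (p : ι → ℝ) :
    ∑ j, (∑ i, p i * Z i j) ^ 2 ≤ (16 / 7 * L) ^ 2 * ∑ i, p i ^ 2 := by
  set n := Fintype.card ι
  set D := Fintype.card κ
  let T : EuclideanSpace ℝ ι →L[ℝ] EuclideanSpace ℝ κ :=
    LinearMap.toContinuousLinearMap (Matrix.toEuclideanLin (Matrix.of fun j i => Z i j))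
  have hT : ∀ x j, T x j = ∑ i, x i * Z i j := by
    intro x j
    simp [T, Matrix.toEuclideanLin, Matrix.mulVec, dotProduct, mul_comm]
  have hin : ∀ (x : EuclideanSpace ℝ ι) (y : EuclideanSpace ℝ κ),
      inner ℝ y (T x) = ∑ i, ∑ j, x i * y j * Z i j := by
    intro x y
    rw [PiLp.inner_apply, Finset.sum_comm]
    refine Finset.sum_congr rfl fun j _ => ?_
    rw [hT]
    simp only [RCLike.inner_apply, conj_trivial, Finset.sum_mul]
    exact Finset.sum_congr rfl fun i _ => by ring
  have hunit : ∀ x : EuclideanSpace ℝ ι, ∀ y : EuclideanSpace ℝ κ, ‖x‖ = 1 → ‖y‖ = 1 →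
      inner ℝ y (T x) ≤ L + 9 / 16 * ‖T‖ := by
    intro x y hx hy
    obtain ⟨z, hz, x', hx', hxx⟩ := exists_latticeNet_near hn x hx
    obtain ⟨w, hw, y', hy', hyy⟩ := exists_latticeNet_near hD y hy
    have h1 : inner ℝ y' (T x') ≤ L := by
      rw [hin]
      have e : ∑ i, ∑ j, x' i * y' j * Z i j =
          (∑ i, ∑ j, (z i : ℝ) * w j * Z i j) / (4 * (Real.sqrt n * Real.sqrt D)) := by
        rw [Finset.sum_div]
        refine Finset.sum_congr rfl fun i _ => ?_
        rw [Finset.sum_div]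
        refine Finset.sum_congr rfl fun j _ => ?_
        rw [hx', hy']; ring
      have h0 : 0 < 4 * (Real.sqrt n * Real.sqrt D) := by
        have : (0 : ℝ) < n := by exact_mod_cast hn
        have : (0 : ℝ) < D := by exact_mod_cast hD
        positivity
      rw [e, div_le_iff₀ h0]
      exact (le_abs_self _).trans (h z hz w hw)
    have hyn : ‖y'‖ ≤ 5 / 4 := by
      have : y' = y - (y - y') := by abel
      rw [this]
      refine (norm_sub_le _ _).trans ?_
      rw [hy]; linarith
    have h2 : inner ℝ y (T x) = inner ℝ y' (T x') + inner ℝ y' (T (x - x')) +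
        inner ℝ (y - y') (T x) := by
      rw [map_sub, inner_sub_right, inner_sub_left]; ring
    have h3 : inner ℝ y' (T (x - x')) ≤ 5 / 4 * (‖T‖ * (1 / 4)) := by
      refine (real_inner_le_norm _ _).trans ?_
      refine mul_le_mul hyn ((T.le_opNorm _).trans ?_) (norm_nonneg _) (by norm_num)
      exact mul_le_mul_of_nonneg_left hxx (norm_nonneg _)
    have h4 : inner ℝ (y - y') (T x) ≤ 1 / 4 * (‖T‖ * 1) := by
      refine (real_inner_le_norm _ _).trans ?_
      refine mul_le_mul hyy ((T.le_opNorm _).trans ?_) (norm_nonneg _) (by norm_num)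
      rw [hx]
    rw [h2]; linarith
  have hop : ‖T‖ ≤ L + 9 / 16 * ‖T‖ := by
    refine T.opNorm_le_bound (by positivity) fun x => ?_
    rcases eq_or_ne (T x) 0 with h0 | h0
    · rw [h0, norm_zero]; positivity
    have hx0 : x ≠ 0 := by rintro rfl; exact h0 (map_zero T)
    have hxn := norm_pos_iff.2 hx0
    have hTn := norm_pos_iff.2 h0
    have h1 := hunit (‖x‖⁻¹ • x) (‖T x‖⁻¹ • T x) (by rw [norm_smul]; simp [hxn.ne'])
      (by rw [norm_smul]; simp [hTn.ne'])
    rw [map_smul, inner_smul_left, inner_smul_right, real_inner_self_eq_norm_sq] at h1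
    simp only [conj_trivial] at h1
    have : ‖T x‖⁻¹ * (‖x‖⁻¹ * ‖T x‖ ^ 2) = ‖T x‖ / ‖x‖ := by field_simp
    rw [this, div_le_iff₀ hxn] at h1
    exact h1
  have hfin : ‖T‖ ≤ 16 / 7 * L := by linarith
  have h1 := T.le_opNorm (WithLp.toLp 2 p)
  have h2 : ‖T (WithLp.toLp 2 p)‖ ^ 2 ≤ (16 / 7 * L * ‖WithLp.toLp 2 p‖) ^ 2 :=
    pow_le_pow_left₀ (norm_nonneg _)
      (h1.trans (mul_le_mul_of_nonneg_right hfin (norm_nonneg _))) 2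
  rw [mul_pow, norm_sq_eq_sum, norm_sq_eq_sum] at h2
  simpa only [hT] using h2

variable {Ω : Type*} [MeasurableSpace Ω] {μ : Measure Ω} [IsProbabilityMeasure μ]

/-- The centred matrix of an independent sign family has operator norm of the order of the square
root of its larger dimension. -/
theorem IsSignFamily.prob_opNorm_le {X : ι × κ → Ω → ℤˣ} {m : ι × κ → ℝ} (hX : IsSignFamily μ X m)
    (hn : 0 < Fintype.card ι) (hnD : Fintype.card ι ≤ Fintype.card κ) :
    μ.real {ω | ¬ ∀ p : ι → ℝ, ∑ j, (∑ i, p i * (val (X (i, j) ω) - m (i, j))) ^ 2 ≤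
      700 * Fintype.card κ * ∑ i, p i ^ 2} ≤ 2 * Real.exp (-(2 * Fintype.card κ)) := by
  set n := Fintype.card ι with hnn
  set D := Fintype.card κ with hDD
  have hn' : (0 : ℝ) < n := by exact_mod_cast hn
  have hnD' : (n : ℝ) ≤ D := by exact_mod_cast hnD
  have hD' : (0 : ℝ) < D := hn'.trans_le hnD'
  set L := Real.sqrt (130 * D) with hL
  have hLL : L ^ 2 = 130 * D := Real.sq_sqrt (by positivity)
  set t := L * (4 * (Real.sqrt n * Real.sqrt D)) with ht
  have htt : t ^ 2 = 130 * D * 16 * (n * D) := by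
    rw [ht, mul_pow, mul_pow, mul_pow, hLL, Real.sq_sqrt hn'.le, Real.sq_sqrt hD'.le]; ring
  have hone : ∀ z ∈ latticeNet ι, ∀ w ∈ latticeNet κ,
      μ.real {ω | t ≤ |∑ q : ι × κ, (z q.1 : ℝ) * w q.2 * (val (X q ω) - m q)|} ≤
        2 * Real.exp (-(20 * D)) := by
    intro z hz w hw
    rw [mem_latticeNet] at hz hw
    have h1 : ((∑ i, z i ^ 2 : ℤ) : ℝ) ≤ ((7 * n : ℤ) : ℝ) := by exact_mod_cast hz
    have h2 : ((∑ i, w i ^ 2 : ℤ) : ℝ) ≤ ((7 * D : ℤ) : ℝ) := by exact_mod_cast hw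
    push_cast at h1 h2
    have h3 : ∑ q : ι × κ, ((z q.1 : ℝ) * w q.2) ^ 2 ≤ 49 * (n * D) := by
      rw [Fintype.sum_prod_type]
      simp only [mul_pow, ← Finset.mul_sum, ← Finset.sum_mul]
      calc _ ≤ (7 * n : ℝ) * (7 * D) :=
            mul_le_mul h1 h2 (Finset.sum_nonneg fun _ _ => sq_nonneg _) (by positivity)
        _ = _ := by ring
    have h4 := hX.hoeffding Finset.univ (fun q => (z q.1 : ℝ) * w q.2) (t := t) h3
      (by positivity) (by positivity)
    refine h4.trans ?_
    gcongr
    rw [htt, le_div_iff₀ (by positivity)]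
    have : 0 < (D : ℝ) * (n * D) := by positivity
    nlinarith
  have hsub : {ω | ¬ ∀ p : ι → ℝ, ∑ j, (∑ i, p i * (val (X (i, j) ω) - m (i, j))) ^ 2 ≤
      700 * D * ∑ i, p i ^ 2} ⊆ ⋃ q ∈ latticeNet ι ×ˢ latticeNet κ,
        {ω | t ≤ |∑ r : ι × κ, (q.1 r.1 : ℝ) * q.2 r.2 * (val (X r ω) - m r)|} := by
    intro ω hω
    by_contra hcon
    simp only [Set.mem_iUnion, Set.mem_ofPred_eq, not_exists, not_le, Finset.mem_product,
      and_imp, Prod.forall] at hcon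
    apply hω
    intro p
    have h1 := sum_sq_le_of_latticeNet hn (hn.trans_le hnD)
      (fun i j => val (X (i, j) ω) - m (i, j)) (L := L) (Real.sqrt_nonneg _) (by
        intro z hz w hw
        have := (hcon z w hz hw).le
        rw [Fintype.sum_prod_type] at this
        exact this) p
    refine h1.trans (mul_le_mul_of_nonneg_right ?_ (Finset.sum_nonneg fun _ _ => sq_nonneg _))
    rw [mul_pow, hLL]; nlinarith
  refine (measureReal_mono hsub (measure_ne_top _ _)).trans ((measureReal_biUnion_finset_le _ _).trans ?_)
  calc _ ≤ ∑ q ∈ latticeNet ι ×ˢ latticeNet κ, 2 * Real.exp (-(20 * D)) :=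
        Finset.sum_le_sum fun q hq => by
          rw [Finset.mem_product] at hq
          exact hone q.1 hq.1 q.2 hq.2
    _ = ((latticeNet ι).card : ℝ) * (latticeNet κ).card * (2 * Real.exp (-(20 * D))) := by
        rw [Finset.sum_const, Finset.card_product, nsmul_eq_mul]; push_cast; ring
    _ ≤ Real.exp (9 * D) * Real.exp (9 * D) * (2 * Real.exp (-(20 * D))) := by
        have h1 : ((latticeNet ι).card : ℝ) ≤ Real.exp (9 * D) :=
          card_latticeNet_le.trans (Real.exp_le_exp.2 (by linarith))
        have h2 : ((latticeNet κ).card : ℝ) ≤ Real.exp (9 * D) := card_latticeNet_le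
        gcongr
    _ = _ := by
        rw [show Real.exp (9 * D) * Real.exp (9 * D) * (2 * Real.exp (-(20 * D))) =
          2 * (Real.exp (9 * D) * Real.exp (9 * D) * Real.exp (-(20 * D))) by ring,
          ← Real.exp_add, ← Real.exp_add]
        congr 2; ring

end Crowd

namespace Crowd

section Means

variable {κ : Type*} [Fintype κ] {k : κ → Fin 2} {m : ℝ}

/-- Decomposition of a sum of squares into within-class and between-class parts. -/
theorem sum_sq_eq_within_add_between (hm : 0 < m)
    (hk : ∀ a, ((Finset.univ.filter fun j => k j = a).card : ℝ) = m) (f : κ → ℝ) :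
    ∑ j, f j ^ 2 = ∑ j, (f j - (∑ l ∈ Finset.univ.filter (fun l => k l = k j), f l) / m) ^ 2 +
      m * ∑ a, ((∑ l ∈ Finset.univ.filter (fun l => k l = a), f l) / m) ^ 2 := by
  have h1 : ∀ h : κ → ℝ, ∑ j, h j = ∑ a, ∑ j ∈ Finset.univ.filter (fun j => k j = a), h j :=
    fun h => (Finset.sum_fiberwise _ _ _).symm
  rw [h1, h1 fun j => (f j - _) ^ 2, Finset.mul_sum, ← Finset.sum_add_distrib]
  refine Finset.sum_congr rfl fun a _ => ?_
  set F := ∑ l ∈ Finset.univ.filter (fun l => k l = a), f l with hF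
  have h2 : ∑ j ∈ Finset.univ.filter (fun j => k j = a),
      (f j - (∑ l ∈ Finset.univ.filter (fun l => k l = k j), f l) / m) ^ 2 =
      ∑ j ∈ Finset.univ.filter (fun j => k j = a), (f j ^ 2 - 2 * (F / m) * f j + (F / m) ^ 2) := by
    refine Finset.sum_congr rfl fun j hj => ?_
    rw [(Finset.mem_filter.1 hj).2, ← hF]; ring
  rw [h2, Finset.sum_add_distrib, Finset.sum_sub_distrib, ← Finset.mul_sum, ← hF,
    Finset.sum_const, nsmul_eq_mul, hk a]
  field_simp
  ring

end Means

section Spectral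

variable {E : Type*} [NormedAddCommGroup E] [InnerProductSpace ℝ E] {κ : Type*}

local notation "⟪" a ", " b "⟫" => inner ℝ a b

/-- `p` is a unit vector that maximizes `∑ ⟪x j, p⟫²` over `s`. -/
def IsPrincipal (x : κ → E) (s : Finset κ) (p : E) : Prop :=
  ‖p‖ = 1 ∧ ∀ q, ‖q‖ = 1 → ∑ j ∈ s, ⟪x j, q⟫ ^ 2 ≤ ∑ j ∈ s, ⟪x j, p⟫ ^ 2

theorem IsPrincipal.le {x : κ → E} {s : Finset κ} {p : E} (h : IsPrincipal x s p) (q : E) :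
    ∑ j ∈ s, ⟪x j, q⟫ ^ 2 ≤ ‖q‖ ^ 2 * ∑ j ∈ s, ⟪x j, p⟫ ^ 2 := by
  rcases eq_or_ne q 0 with rfl | hq
  · simp
  have hq' := norm_pos_iff.2 hq
  have h1 := h.2 (‖q‖⁻¹ • q) (by rw [norm_smul]; simp [hq'.ne'])
  simp only [inner_smul_right, mul_pow] at h1
  rw [← Finset.mul_sum] at h1
  calc ∑ j ∈ s, ⟪x j, q⟫ ^ 2 = ‖q‖ ^ 2 * (‖q‖⁻¹ ^ 2 * ∑ j ∈ s, ⟪x j, q⟫ ^ 2) := by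
        field_simp
    _ ≤ _ := mul_le_mul_of_nonneg_left h1 (by positivity)

theorem IsPrincipal.sum_mul_eq_zero {x : κ → E} {s : Finset κ} {p q : E} (h : IsPrincipal x s p)
    (hpq : ⟪p, q⟫ = 0) : ∑ j ∈ s, ⟪x j, p⟫ * ⟪x j, q⟫ = 0 := by
  set b := ∑ j ∈ s, ⟪x j, p⟫ * ⟪x j, q⟫ with hb
  set Q := ∑ j ∈ s, ⟪x j, p⟫ ^ 2 with hQ
  set R := ∑ j ∈ s, ⟪x j, q⟫ ^ 2 with hR
  have h1 : ∀ t : ℝ, 2 * t * b + t ^ 2 * R ≤ t ^ 2 * (‖q‖ ^ 2 * Q) := by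
    intro t
    have h2 := h.le (p + t • q)
    have h3 : ‖p + t • q‖ ^ 2 = 1 + t ^ 2 * ‖q‖ ^ 2 := by
      rw [norm_add_sq_real, h.1, inner_smul_right, hpq, norm_smul, mul_pow, Real.norm_eq_abs,
        sq_abs]; ring
    have h4 : ∑ j ∈ s, ⟪x j, p + t • q⟫ ^ 2 = Q + 2 * t * b + t ^ 2 * R := by
      rw [hQ, hb, hR, Finset.mul_sum, Finset.mul_sum, ← Finset.sum_add_distrib,
        ← Finset.sum_add_distrib]
      refine Finset.sum_congr rfl fun j _ => ?_
      rw [inner_add_right, inner_smul_right]; ring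
    rw [h3, h4] at h2
    linarith
  by_contra hne
  set c := ‖q‖ ^ 2 * Q - R with hc
  have h2 : ∀ t : ℝ, 2 * t * b ≤ t ^ 2 * c := fun t => by
    have := h1 t
    rw [hc, mul_sub]; linarith
  have h3 := h2 (b / (1 + |c|))
  have hpos : 0 < 1 + |c| := by positivity
  have h4 : 2 * (b / (1 + |c|)) * b = 2 * b ^ 2 / (1 + |c|) := by ring
  have h5 : (b / (1 + |c|)) ^ 2 * c ≤ b ^ 2 / (1 + |c|) := by
    rw [div_pow, div_mul_eq_mul_div, div_le_div_iff₀ (by positivity) hpos]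
    have : c * (1 + |c|) ≤ (1 + |c|) ^ 2 := by
      have := le_abs_self c
      nlinarith [abs_nonneg c]
    nlinarith [sq_nonneg b]
  have h6 : 0 < b ^ 2 / (1 + |c|) := by positivity
  have h7 : 2 * b ^ 2 / (1 + |c|) = 2 * (b ^ 2 / (1 + |c|)) := by ring
  linarith

theorem inner_sq_add_inner_sq_le {v p q : E} (hp : ‖p‖ = 1) (hq : ‖q‖ = 1) (hpq : ⟪p, q⟫ = 0) :
    ⟪v, p⟫ ^ 2 + ⟪v, q⟫ ^ 2 ≤ ‖v‖ ^ 2 := by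
  have h : 0 ≤ ‖v - (⟪v, p⟫ • p + ⟪v, q⟫ • q)‖ ^ 2 := sq_nonneg _
  rw [norm_sub_sq_real, norm_add_sq_real, inner_add_right, inner_smul_right, inner_smul_right,
    norm_smul, norm_smul, hp, hq, inner_smul_left, inner_smul_right, hpq, mul_one, mul_one,
    Real.norm_eq_abs, Real.norm_eq_abs, sq_abs, sq_abs] at h
  simp only [mul_zero] at h
  linarith

/-- Perturbation of a principal vector when one vector is removed, under a spectral gap. -/
theorem IsPrincipal.abs_inner_sub_le [Fintype κ] {x : κ → E} [DecidableEq κ] {p q : E} {j : κ} {gap b : ℝ}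
    (hp : IsPrincipal x Finset.univ p) (hq : IsPrincipal x (Finset.univ.erase j) q)
    (hgap : ∀ w, ‖w‖ = 1 → ⟪p, w⟫ = 0 →
      ∑ l, ⟪x l, w⟫ ^ 2 ≤ ∑ l, ⟪x l, p⟫ ^ 2 - gap)
    (hb : ‖x j‖ ≤ b) (hb0 : 0 < b) (hgb : 4 * b ^ 2 ≤ gap) (hpq : 0 ≤ ⟪p, q⟫) :
    b * ‖p - q‖ ≤ 8 * b ^ 2 / gap * |⟪x j, q⟫| := by
  set a := ⟪p, q⟫ with ha
  have hgap0 : 0 < gap := by have : 0 < 4 * b ^ 2 := by positivity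
                             linarith
  set Q : E → ℝ := fun v => ∑ l, ⟪x l, v⟫ ^ 2 with hQ
  set w := q - a • p with hw
  have ha1 : a ≤ 1 := by
    have := real_inner_le_norm p q
    rw [hp.1, hq.1] at this; linarith
  have hpw : ⟪p, w⟫ = 0 := by
    rw [hw, inner_sub_right, inner_smul_right, real_inner_self_eq_norm_sq, hp.1]
    rw [← ha]; ring
  have hww : ‖w‖ ^ 2 = 1 - a ^ 2 := by
    rw [hw, norm_sub_sq_real, inner_smul_right, norm_smul, hp.1, hq.1, real_inner_comm, ← ha,
      Real.norm_eq_abs, mul_one, sq_abs]; ring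
  have hQw : Q w ≤ ‖w‖ ^ 2 * (Q p - gap) := by
    rcases eq_or_ne w 0 with h0 | h0
    · rw [h0]; simp [hQ]
    have hw' := norm_pos_iff.2 h0
    have h1 := hgap (‖w‖⁻¹ • w) (by rw [norm_smul]; simp [hw'.ne'])
      (by rw [inner_smul_right, hpw, mul_zero])
    simp only [inner_smul_right, mul_pow] at h1
    rw [← Finset.mul_sum] at h1
    calc Q w = ‖w‖ ^ 2 * (‖w‖⁻¹ ^ 2 * Q w) := by field_simp
      _ ≤ _ := mul_le_mul_of_nonneg_left h1 (by positivity)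
  have hcross := hp.sum_mul_eq_zero hpw
  have hQq : Q q = a ^ 2 * Q p + Q w := by
    have h1 : Q q = a ^ 2 * Q p + 2 * a * ∑ l, ⟪x l, p⟫ * ⟪x l, w⟫ + Q w := by
      simp only [hQ]
      rw [Finset.mul_sum, Finset.mul_sum, ← Finset.sum_add_distrib, ← Finset.sum_add_distrib]
      refine Finset.sum_congr rfl fun l _ => ?_
      have : q = a • p + w := by rw [hw]; abel
      nth_rw 1 [this]
      rw [inner_add_right, inner_smul_right]; ring
    rw [h1, hcross]; ring
  have hpq2 : ‖p - q‖ ^ 2 = 2 - 2 * a := by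
    rw [norm_sub_sq_real, hp.1, hq.1, ← ha]; ring
  set e := ‖p - q‖ with he
  have he0 : 0 ≤ e := norm_nonneg _
  have h1 : e ^ 2 * (gap / 2) ≤ Q p - Q q := by
    rw [hQq, hpq2]
    rw [hww] at hQw
    have : 0 ≤ a * (1 - a) * gap := mul_nonneg (mul_nonneg hpq (by linarith)) hgap0.le
    linarith
  have hsplit : ∀ v, Q v = ⟪x j, v⟫ ^ 2 + ∑ l ∈ Finset.univ.erase j, ⟪x l, v⟫ ^ 2 := fun v =>
    (Finset.add_sum_erase _ _ (Finset.mem_univ j)).symm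
  have h2 : Q p - Q q ≤ ⟪x j, p⟫ ^ 2 - ⟪x j, q⟫ ^ 2 := by
    have := hq.2 p hp.1
    rw [hsplit p, hsplit q]; linarith
  have h3 : |⟪x j, p⟫ - ⟪x j, q⟫| ≤ b * e := by
    rw [← inner_sub_right]
    exact (abs_real_inner_le_norm _ _).trans (mul_le_mul_of_nonneg_right hb he0)
  have h4 : ⟪x j, p⟫ ^ 2 - ⟪x j, q⟫ ^ 2 ≤ b * e * (2 * |⟪x j, q⟫| + b * e) := by
    have e1 : ⟪x j, p⟫ ^ 2 - ⟪x j, q⟫ ^ 2 =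
        (⟪x j, p⟫ - ⟪x j, q⟫) * (2 * ⟪x j, q⟫ + (⟪x j, p⟫ - ⟪x j, q⟫)) := by ring
    rw [e1]
    refine (le_abs_self _).trans ?_
    rw [abs_mul]
    refine mul_le_mul h3 ((abs_add_le _ _).trans ?_) (abs_nonneg _) (by positivity)
    rw [abs_mul, abs_two]; linarith
  rcases he0.eq_or_lt with h0 | h0
  · rw [← h0, mul_zero]; positivity
  have h5 : e * (gap / 2) ≤ b * (2 * |⟪x j, q⟫| + b * e) := by
    have : e * (e * (gap / 2)) ≤ e * (b * (2 * |⟪x j, q⟫| + b * e)) := by nlinarith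
    exact le_of_mul_le_mul_left this h0
  have h6 : e * (gap / 4) ≤ 2 * b * |⟪x j, q⟫| := by nlinarith
  rw [div_mul_eq_mul_div, le_div_iff₀ hgap0]
  nlinarith

end Spectral

end Crowd

namespace Crowd

set_option maxHeartbeats 400000 in
/-- A point of a slightly inflated ellipse that is nearly as long as its major semiaxis nearly has
the direction of that axis. -/
theorem abs_sub_abs_ge_of_ellipse {a₀ a₁ u₀ u₁ Ap Am B δ : ℝ} (hu : u₀ ^ 2 + u₁ ^ 2 = 1)
    (hu0 : 0 ≤ u₀) (hδ : δ = u₀ - |u₁|) (hδ0 : 0 < δ) (hB : 0 < B) (hAm : 0 ≤ Am)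
    (hg : 10 ^ 6 * B ≤ (Ap - Am) * δ ^ 2)
    (hell : ∀ s t : ℝ, (s * (u₀ * a₀ + u₁ * a₁) + t * (u₀ * a₁ - u₁ * a₀)) ^ 2 ≤
      s ^ 2 * (Ap + 8 * B) + t ^ 2 * (Am + 8 * B))
    (hlow : Ap - 10 * B ≤ a₀ ^ 2 + a₁ ^ 2) :
    98 / 100 * (δ * Real.sqrt Ap) ≤ |a₀| - |a₁| := by
  set U := u₀ * a₀ + u₁ * a₁ with hU
  set W := u₀ * a₁ - u₁ * a₀ with hW
  set A := Ap + 8 * B with hA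
  set A' := Am + 8 * B with hA'
  have hu1 : |u₁| ≤ 1 := abs_le_one_iff_mul_self_le_one.2 (by nlinarith)
  have hu0' : u₀ ≤ 1 := by nlinarith
  have hδ1 : δ ≤ 1 := by have := abs_nonneg u₁; linarith
  have hδsq : δ ^ 2 ≤ 1 := by nlinarith
  have hδsq0 : 0 < δ ^ 2 := by positivity
  have hg0 : 0 < Ap - Am := by
    by_contra h
    have : (Ap - Am) * δ ^ 2 ≤ 0 := mul_nonpos_of_nonpos_of_nonneg (not_lt.1 h) hδsq0.le
    linarith
  have hgB : 10 ^ 6 * B ≤ Ap - Am := by nlinarith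
  have hA'0 : 0 < A' := by positivity
  have hA0 : 0 < A := by rw [hA]; linarith
  have hUW : U ^ 2 + W ^ 2 = a₀ ^ 2 + a₁ ^ 2 := by
    have : U ^ 2 + W ^ 2 = (u₀ ^ 2 + u₁ ^ 2) * (a₀ ^ 2 + a₁ ^ 2) := by rw [hU, hW]; ring
    rw [this, hu, one_mul]
  have h1 : U ^ 2 * A' + W ^ 2 * A ≤ A * A' := by
    have h2 := hell (U / A) (W / A')
    have e1 : U / A * U + W / A' * W = (U ^ 2 * A' + W ^ 2 * A) / (A * A') := by
      field_simp
    have e2 : (U / A) ^ 2 * A + (W / A') ^ 2 * A' = (U ^ 2 * A' + W ^ 2 * A) / (A * A') := by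
      field_simp
    rw [e1, e2] at h2
    set Y := (U ^ 2 * A' + W ^ 2 * A) / (A * A') with hY
    have h3 : Y ≤ 1 := by
      by_contra h
      have : 1 < Y := not_le.1 h
      nlinarith
    rwa [hY, div_le_one (by positivity)] at h3
  have h2 : W ^ 2 * (Ap - Am) ≤ 18 * B * A := by
    have h3 : A - 18 * B ≤ U ^ 2 + W ^ 2 := by rw [hUW, hA]; linarith
    have h4 : W ^ 2 * (A - A') ≤ 18 * B * A' := by nlinarith
    have h5 : A - A' = Ap - Am := by rw [hA, hA']; ring
    rw [h5] at h4
    have : A' ≤ A := by linarith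
    nlinarith
  have hAp : A ≤ 101 / 100 * Ap := by rw [hA]; linarith
  have hAp0 : 0 < Ap := by linarith
  have h3 : W ^ 2 ≤ 2 / 10 ^ 5 * (Ap * δ ^ 2) := by
    have h4 : W ^ 2 * (10 ^ 6 * B) ≤ W ^ 2 * ((Ap - Am) * δ ^ 2) :=
      mul_le_mul_of_nonneg_left hg (sq_nonneg _)
    have h5 : W ^ 2 * (Ap - Am) * δ ^ 2 ≤ 18 * B * A * δ ^ 2 :=
      mul_le_mul_of_nonneg_right h2 hδsq0.le
    have h6 : 18 * B * A * δ ^ 2 ≤ 18 * B * (101 / 100 * Ap) * δ ^ 2 := by gcongr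
    have h7 : B * (10 ^ 6 * W ^ 2) ≤ B * (20 * (Ap * δ ^ 2)) := by
      have : 0 ≤ B * (Ap * δ ^ 2) := by positivity
      nlinarith
    have := le_of_mul_le_mul_left h7 hB
    linarith
  set M := Real.sqrt Ap with hM
  have hM0 : 0 < M := Real.sqrt_pos.2 hAp0
  have hMM : M ^ 2 = Ap := Real.sq_sqrt hAp0.le
  have h4 : |W| ≤ 5 / 1000 * (δ * M) := by
    apply abs_le_of_sq_le_sq _ (by positivity)
    have h0 : (5 / 1000 * (δ * M)) ^ 2 = 25 / 10 ^ 6 * (Ap * δ ^ 2) := by rw [← hMM]; ring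
    have h1 : 0 < Ap * δ ^ 2 := by positivity
    rw [h0]; linarith
  have h5 : 99 / 100 * M ≤ |U| := by
    apply le_of_sq_le_sq _ (abs_nonneg U)
    rw [sq_abs, mul_pow, hMM]
    have h6 : Ap * δ ^ 2 ≤ Ap := mul_le_of_le_one_right hAp0.le hδsq
    linarith
  have e0 : a₀ = u₀ * U - u₁ * W := by
    calc a₀ = (u₀ ^ 2 + u₁ ^ 2) * a₀ := by rw [hu, one_mul]
      _ = _ := by rw [hU, hW]; ring
  have e1 : a₁ = u₁ * U + u₀ * W := by
    calc a₁ = (u₀ ^ 2 + u₁ ^ 2) * a₁ := by rw [hu, one_mul]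
      _ = _ := by rw [hU, hW]; ring
  have h6 : u₀ * |U| - |W| ≤ |a₀| := by
    have := abs_sub_abs_le_abs_sub (u₀ * U) (u₁ * W)
    rw [← e0, abs_mul, abs_mul, abs_of_nonneg hu0] at this
    have : |u₁| * |W| ≤ |W| := mul_le_of_le_one_left (abs_nonneg _) hu1
    linarith
  have h7 : |a₁| ≤ |u₁| * |U| + |W| := by
    have := abs_add_le (u₁ * U) (u₀ * W)
    rw [← e1, abs_mul, abs_mul, abs_of_nonneg hu0] at this
    have : u₀ * |W| ≤ |W| := mul_le_of_le_one_left (abs_nonneg _) hu0'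
    linarith
  have h8 : δ * (99 / 100 * M) ≤ δ * |U| := mul_le_mul_of_nonneg_left h5 hδ0.le
  have h9 : δ * |U| = u₀ * |U| - |u₁| * |U| := by rw [hδ]; ring
  linarith

section Spectral

variable {E : Type*} [NormedAddCommGroup E] [InnerProductSpace ℝ E] {κ : Type*} [Fintype κ]
  [DecidableEq κ]

local notation "⟪" a ", " b "⟫" => inner ℝ a b

set_option maxHeartbeats 1600000 in
/-- Entrywise separation of the principal direction: the vectors `x j` are noisy versions of two
class centres `r 0` and `r 1`, and the top eigenvector `(u₀, u₁)` of the Gram matrix of the centres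
has entries of different sizes. -/
theorem IsPrincipal.separates {k : κ → Fin 2} {m : ℝ} (hm : 0 < m)
    (hk : ∀ a, ((Finset.univ.filter fun j => k j = a).card : ℝ) = m)
    {x : κ → E} {r : Fin 2 → E} {C τ B Ap Am u₀ u₁ δ : ℝ}
    (hnoise : ∀ p, ∑ j, ⟪x j - r (k j), p⟫ ^ 2 ≤ 2 * m * C * ‖p‖ ^ 2)
    (hgram : ∀ a b, |∑ j ∈ Finset.univ.filter (fun j => k j = b), ⟪r a, x j - r (k j)⟫| ≤ m * τ)
    (hx : ∀ j, ‖x j‖ ^ 2 ≤ 2 * m) (hr : ∀ a, ‖r a‖ ^ 2 ≤ 2 * m)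
    (hloo : ∀ j, ∃ q, IsPrincipal x (Finset.univ.erase j) q ∧ |⟪x j - r (k j), q⟫| ≤ τ)
    (hu : u₀ ^ 2 + u₁ ^ 2 = 1) (hu0 : 0 ≤ u₀) (hδ : δ = u₀ - |u₁|) (hδ0 : 0 < δ)
    (hA0 : ‖r 0‖ ^ 2 * u₀ + ⟪r 0, r 1⟫ * u₁ = Ap * u₀)
    (hA1 : ⟪r 0, r 1⟫ * u₀ + ‖r 1‖ ^ 2 * u₁ = Ap * u₁)
    (htr : ‖r 0‖ ^ 2 + ‖r 1‖ ^ 2 = Ap + Am) (hAm : 0 ≤ Am)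
    (hτ : 1 ≤ τ) (hC0 : 0 ≤ C) (hτB : τ ^ 2 ≤ B) (hCB : C ≤ B)
    (hg : 10 ^ 6 * B ≤ (Ap - Am) * δ ^ 2)
    {p : E} (hp : IsPrincipal x Finset.univ p) :
    ∃ (a : Fin 2 → ℝ) (e : ℝ), 0 < e ∧ 4 * e < a 0 - a 1 ∧ ∀ j, |(|⟪x j, p⟫|) - a (k j)| ≤ e := by
  have hB1 : 1 ≤ B := by nlinarith
  have hB : 0 < B := by linarith
  have hτ' : τ ≤ B := by nlinarith
  have hu1 : |u₁| ≤ 1 := abs_le_one_iff_mul_self_le_one.2 (by nlinarith)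
  have hu0' : u₀ ≤ 1 := by nlinarith
  have hδ1 : δ ≤ 1 := by have := abs_nonneg u₁; linarith
  have hδsq : δ ^ 2 ≤ 1 := by nlinarith
  have hδsq0 : 0 < δ ^ 2 := by positivity
  have hg0 : 0 < Ap - Am := by
    by_contra h
    have : (Ap - Am) * δ ^ 2 ≤ 0 := mul_nonpos_of_nonpos_of_nonneg (not_lt.1 h) hδsq0.le
    linarith
  have hgB : 10 ^ 6 * B ≤ Ap - Am := by nlinarith
  have hAp0 : 0 < Ap := by linarith
  set S : Fin 2 → Finset κ := fun a => Finset.univ.filter fun j => k j = a with hS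
  set zb : Fin 2 → E := fun a => m⁻¹ • ∑ j ∈ S a, (x j - r (k j)) with hzb
  set rt : Fin 2 → E := fun a => r a + zb a with hrt
  have hrt_inner : ∀ a q, ⟪rt a, q⟫ = (∑ j ∈ S a, ⟪x j, q⟫) / m := by
    intro a q
    have h1 : ∑ j ∈ S a, ⟪x j - r (k j), q⟫ = ∑ j ∈ S a, ⟪x j, q⟫ - m * ⟪r a, q⟫ := by
      rw [← hk a, ← nsmul_eq_mul, ← Finset.sum_const, ← Finset.sum_sub_distrib]
      refine Finset.sum_congr rfl fun j hj => ?_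
      rw [inner_sub_left, (Finset.mem_filter.1 hj).2]
    simp only [hrt, hzb, inner_add_left, inner_smul_left, sum_inner, conj_trivial]
    rw [h1]; field_simp; ring
  set Q : E → ℝ := fun q => ∑ j, ⟪x j, q⟫ ^ 2 with hQ
  set P : E → ℝ := fun q => ∑ a, ⟪rt a, q⟫ ^ 2 with hP
  have hPQ : ∀ q, m * P q ≤ Q q ∧ Q q ≤ m * P q + 2 * m * C * ‖q‖ ^ 2 := by
    intro q
    have h1 := sum_sq_eq_within_add_between hm hk fun j => ⟪x j, q⟫
    have h2 := sum_sq_eq_within_add_between hm hk fun j => ⟪x j - r (k j), q⟫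
    have h3 : m * ∑ a, ((∑ l ∈ Finset.univ.filter (fun l => k l = a), ⟪x l, q⟫) / m) ^ 2 =
        m * P q := by
      simp only [hP, hrt_inner, hS]
    have h4 : ∀ j, ⟪x j - r (k j), q⟫ -
        (∑ l ∈ Finset.univ.filter (fun l => k l = k j), ⟪x l - r (k l), q⟫) / m =
        ⟪x j, q⟫ - (∑ l ∈ Finset.univ.filter (fun l => k l = k j), ⟪x l, q⟫) / m := by
      intro j
      have h1 : ∑ l ∈ Finset.univ.filter (fun l => k l = k j), ⟪x l - r (k l), q⟫ =
          ∑ l ∈ Finset.univ.filter (fun l => k l = k j), ⟪x l, q⟫ - m * ⟪r (k j), q⟫ := by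
        rw [← hk (k j), ← nsmul_eq_mul, ← Finset.sum_const, ← Finset.sum_sub_distrib]
        refine Finset.sum_congr rfl fun l hl => ?_
        rw [inner_sub_left, (Finset.mem_filter.1 hl).2]
      rw [h1, inner_sub_left]; field_simp; ring
    simp only [h4] at h2
    rw [h3] at h1
    have h5 : 0 ≤ m * ∑ a, ((∑ l ∈ Finset.univ.filter (fun l => k l = a),
        ⟪x l - r (k l), q⟫) / m) ^ 2 :=
      mul_nonneg hm.le (Finset.sum_nonneg fun _ _ => sq_nonneg _)
    have h6 := hnoise q
    have h7 : 0 ≤ ∑ j, (⟪x j, q⟫ -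
        (∑ l ∈ Finset.univ.filter (fun l => k l = k j), ⟪x l, q⟫) / m) ^ 2 :=
      Finset.sum_nonneg fun _ _ => sq_nonneg _
    simp only [hQ]
    constructor <;> linarith
  have hzbq : ∀ a q, ⟪zb a, q⟫ ^ 2 ≤ 2 * C * ‖q‖ ^ 2 := by
    intro a q
    have h1 : ⟪zb a, q⟫ = m⁻¹ * ∑ j ∈ S a, ⟪x j - r (k j), q⟫ := by
      simp only [hzb, inner_smul_left, sum_inner, conj_trivial]
    have h2 : (∑ j ∈ S a, ⟪x j - r (k j), q⟫) ^ 2 ≤ m * ∑ j ∈ S a, ⟪x j - r (k j), q⟫ ^ 2 := by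
      have := sq_sum_le_card_mul_sum_sq (s := S a) (f := fun j => ⟪x j - r (k j), q⟫)
      rwa [hk a] at this
    have h3 : ∑ j ∈ S a, ⟪x j - r (k j), q⟫ ^ 2 ≤ 2 * m * C * ‖q‖ ^ 2 :=
      (Finset.sum_le_sum_of_subset_of_nonneg (Finset.subset_univ _)
        fun _ _ _ => sq_nonneg _).trans (hnoise q)
    rw [h1, mul_pow, inv_pow, inv_mul_le_iff₀ (by positivity)]
    calc _ ≤ _ := h2
      _ ≤ m * (2 * m * C * ‖q‖ ^ 2) := mul_le_mul_of_nonneg_left h3 hm.le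
      _ = _ := by ring
  have hzbn : ∀ a, ‖zb a‖ ^ 2 ≤ 2 * C := by
    intro a
    have h1 := hzbq a (zb a)
    rw [real_inner_self_eq_norm_sq] at h1
    by_contra h
    have : 2 * C < ‖zb a‖ ^ 2 := not_le.1 h
    nlinarith
  have hrz : ∀ a b, |⟪r a, zb b⟫| ≤ τ := by
    intro a b
    have h1 : ⟪r a, zb b⟫ = m⁻¹ * ∑ j ∈ S b, ⟪r a, x j - r (k j)⟫ := by
      simp only [hzb, inner_smul_right, inner_sum]
    rw [h1, abs_mul, abs_of_pos (inv_pos.2 hm), inv_mul_le_iff₀ hm]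
    exact hgram a b
  have hgr : ∀ a b, |⟪rt a, rt b⟫ - ⟪r a, r b⟫| ≤ 4 * B := by
    intro a b
    have h1 : ⟪rt a, rt b⟫ - ⟪r a, r b⟫ = ⟪r a, zb b⟫ + ⟪r b, zb a⟫ + ⟪zb a, zb b⟫ := by
      simp only [hrt, inner_add_left, inner_add_right]
      rw [real_inner_comm (r b) (zb a)]; ring
    have h2 : |⟪zb a, zb b⟫| ≤ 2 * C := by
      apply abs_le_of_sq_le_sq _ (by positivity)
      calc ⟪zb a, zb b⟫ ^ 2 ≤ 2 * C * ‖zb b‖ ^ 2 := hzbq a _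
        _ ≤ 2 * C * (2 * C) := mul_le_mul_of_nonneg_left (hzbn b) (by positivity)
        _ = _ := by ring
    rw [h1]
    refine (abs_add_three _ _ _).trans ?_
    have := hrz a b
    have := hrz b a
    linarith
  have hform : ∀ c₀ c₁ : ℝ, |‖c₀ • rt 0 + c₁ • rt 1‖ ^ 2 -
      (c₀ ^ 2 * ‖r 0‖ ^ 2 + 2 * (c₀ * c₁ * ⟪r 0, r 1⟫) + c₁ ^ 2 * ‖r 1‖ ^ 2)| ≤
      8 * B * (c₀ ^ 2 + c₁ ^ 2) := by
    intro c₀ c₁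
    have h0 := hgr 0 0
    have h1 := hgr 0 1
    have h2 := hgr 1 1
    rw [norm_add_sq_real, inner_smul_left, inner_smul_right, norm_smul, norm_smul, mul_pow,
      mul_pow, Real.norm_eq_abs, Real.norm_eq_abs, sq_abs, sq_abs, conj_trivial]
    rw [real_inner_self_eq_norm_sq, real_inner_self_eq_norm_sq] at h0 h2
    have e : c₀ ^ 2 * ‖rt 0‖ ^ 2 + 2 * (c₀ * (c₁ * ⟪rt 0, rt 1⟫)) + c₁ ^ 2 * ‖rt 1‖ ^ 2 -
        (c₀ ^ 2 * ‖r 0‖ ^ 2 + 2 * (c₀ * c₁ * ⟪r 0, r 1⟫) + c₁ ^ 2 * ‖r 1‖ ^ 2) =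
        c₀ ^ 2 * (‖rt 0‖ ^ 2 - ‖r 0‖ ^ 2) + 2 * (c₀ * c₁) * (⟪rt 0, rt 1⟫ - ⟪r 0, r 1⟫) +
        c₁ ^ 2 * (‖rt 1‖ ^ 2 - ‖r 1‖ ^ 2) := by ring
    rw [e]
    refine (abs_add_three _ _ _).trans ?_
    rw [abs_mul (c₀ ^ 2), abs_mul (2 * (c₀ * c₁)), abs_mul (c₁ ^ 2), abs_of_nonneg (sq_nonneg c₀),
      abs_of_nonneg (sq_nonneg c₁)]
    have h3 : |2 * (c₀ * c₁)| ≤ c₀ ^ 2 + c₁ ^ 2 := by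
      rw [abs_le]; constructor <;> nlinarith [sq_nonneg (c₀ - c₁), sq_nonneg (c₀ + c₁)]
    have k0 : c₀ ^ 2 * |‖rt 0‖ ^ 2 - ‖r 0‖ ^ 2| ≤ c₀ ^ 2 * (4 * B) :=
      mul_le_mul_of_nonneg_left h0 (sq_nonneg _)
    have k2 : c₁ ^ 2 * |‖rt 1‖ ^ 2 - ‖r 1‖ ^ 2| ≤ c₁ ^ 2 * (4 * B) :=
      mul_le_mul_of_nonneg_left h2 (sq_nonneg _)
    have k1 : |2 * (c₀ * c₁)| * |⟪rt 0, rt 1⟫ - ⟪r 0, r 1⟫| ≤ (c₀ ^ 2 + c₁ ^ 2) * (4 * B) :=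
      mul_le_mul h3 h1 (abs_nonneg _) (by positivity)
    linarith
  have hPsum : ∀ q, P q = ⟪rt 0, q⟫ ^ 2 + ⟪rt 1, q⟫ ^ 2 := fun q => by
    simp only [hP, Fin.sum_univ_two]
  -- a good test vector
  have hPlow : Ap - 10 * B ≤ P p := by
    set w := u₀ • rt 0 + u₁ • rt 1 with hw
    have h1 : Ap - 8 * B ≤ ‖w‖ ^ 2 := by
      have h2 := (abs_le.1 (hform u₀ u₁)).1
      have h3 : u₀ ^ 2 * ‖r 0‖ ^ 2 + 2 * (u₀ * u₁ * ⟪r 0, r 1⟫) + u₁ ^ 2 * ‖r 1‖ ^ 2 = Ap := by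
        linear_combination u₀ * hA0 + u₁ * hA1 + Ap * hu
      rw [hu, h3] at h2
      linarith
    have hw0 : 0 < ‖w‖ ^ 2 := by linarith
    have hwn : 0 < ‖w‖ := by
      rcases (norm_nonneg w).eq_or_lt with h | h
      · rw [← h] at hw0; norm_num at hw0
      · exact h
    have h2 : ‖w‖ ^ 2 * ‖w‖ ^ 2 ≤ P w := by
      have h3 : ‖w‖ ^ 2 = u₀ * ⟪rt 0, w⟫ + u₁ * ⟪rt 1, w⟫ := by
        rw [← real_inner_self_eq_norm_sq]
        nth_rw 1 [hw]
        generalize rt 0 = v₀, rt 1 = v₁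
        rw [inner_add_left, inner_smul_left, inner_smul_left, conj_trivial, conj_trivial]
      rw [hPsum]
      have h4 : (u₀ * ⟪rt 0, w⟫ + u₁ * ⟪rt 1, w⟫) ^ 2 ≤
          (u₀ ^ 2 + u₁ ^ 2) * (⟪rt 0, w⟫ ^ 2 + ⟪rt 1, w⟫ ^ 2) := by
        have := sq_nonneg (u₀ * ⟪rt 1, w⟫ - u₁ * ⟪rt 0, w⟫)
        linarith
      rw [hu, one_mul, ← h3] at h4
      exact (sq (‖w‖ ^ 2)).symm.le.trans h4
    have h3 := hp.le w
    have h4 := (hPQ w).1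
    have h5 := (hPQ p).2
    rw [hp.1, one_pow, mul_one] at h5
    have h6 : ‖w‖ ^ 2 * (m * ‖w‖ ^ 2) ≤ ‖w‖ ^ 2 * (m * P p + 2 * m * C) := by
      calc ‖w‖ ^ 2 * (m * ‖w‖ ^ 2) = m * (‖w‖ ^ 2 * ‖w‖ ^ 2) := by ring
        _ ≤ m * P w := mul_le_mul_of_nonneg_left h2 hm.le
        _ ≤ Q w := h4
        _ ≤ ‖w‖ ^ 2 * Q p := h3
        _ ≤ _ := mul_le_mul_of_nonneg_left h5 hw0.le
    have h7 := le_of_mul_le_mul_left h6 hw0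
    have h8 : m * ‖w‖ ^ 2 ≤ m * (P p + 2 * C) := by linarith
    have h9 := le_of_mul_le_mul_left h8 hm
    linarith
  -- the two class responses
  have hsep : 98 / 100 * (δ * Real.sqrt Ap) ≤ |⟪rt 0, p⟫| - |⟪rt 1, p⟫| := by
    refine abs_sub_abs_ge_of_ellipse hu hu0 hδ hδ0 hB hAm hg ?_ (by rw [← hPsum]; exact hPlow)
    intro s t
    have h1 : s * (u₀ * ⟪rt 0, p⟫ + u₁ * ⟪rt 1, p⟫) + t * (u₀ * ⟪rt 1, p⟫ - u₁ * ⟪rt 0, p⟫) =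
        ⟪(s * u₀ - t * u₁) • rt 0 + (s * u₁ + t * u₀) • rt 1, p⟫ := by
      generalize rt 0 = v₀, rt 1 = v₁
      rw [inner_add_left, inner_smul_left, inner_smul_left, conj_trivial, conj_trivial]; ring
    have h2 : ⟪(s * u₀ - t * u₁) • rt 0 + (s * u₁ + t * u₀) • rt 1, p⟫ ^ 2 ≤
        ‖(s * u₀ - t * u₁) • rt 0 + (s * u₁ + t * u₀) • rt 1‖ ^ 2 := by
      have := abs_real_inner_le_norm ((s * u₀ - t * u₁) • rt 0 + (s * u₁ + t * u₀) • rt 1) p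
      rw [hp.1, mul_one] at this
      rw [← sq_abs]; exact pow_le_pow_left₀ (abs_nonneg _) this 2
    have h3 := (abs_le.1 (hform (s * u₀ - t * u₁) (s * u₁ + t * u₀))).2
    have h4 : (s * u₀ - t * u₁) ^ 2 + (s * u₁ + t * u₀) ^ 2 = s ^ 2 + t ^ 2 := by
      linear_combination (s ^ 2 + t ^ 2) * hu
    have h5 : (s * u₀ - t * u₁) ^ 2 * ‖r 0‖ ^ 2 + 2 * ((s * u₀ - t * u₁) * (s * u₁ + t * u₀) *
        ⟪r 0, r 1⟫) + (s * u₁ + t * u₀) ^ 2 * ‖r 1‖ ^ 2 = s ^ 2 * Ap + t ^ 2 * Am := by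
      have hAm' : u₁ ^ 2 * ‖r 0‖ ^ 2 - 2 * (u₀ * u₁ * ⟪r 0, r 1⟫) + u₀ ^ 2 * ‖r 1‖ ^ 2 = Am := by
        linear_combination (-u₀) * hA0 - u₁ * hA1 - (Ap - ‖r 0‖ ^ 2 - ‖r 1‖ ^ 2) * hu + htr
      have hAp' : u₀ ^ 2 * ‖r 0‖ ^ 2 + 2 * (u₀ * u₁ * ⟪r 0, r 1⟫) + u₁ ^ 2 * ‖r 1‖ ^ 2 = Ap := by
        linear_combination u₀ * hA0 + u₁ * hA1 + Ap * hu
      linear_combination s ^ 2 * hAp' + t ^ 2 * hAm' - 2 * s * t * u₁ * hA0 + 2 * s * t * u₀ * hA1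
    rw [h4, h5] at h3
    rw [h1]
    linarith
  -- the spectral gap
  have hgap : ∀ w, ‖w‖ = 1 → ⟪p, w⟫ = 0 → Q w ≤ Q p - m * (Ap - Am) / 2 := by
    intro w hw hpw
    have h1 : P p + P w ≤ ‖rt 0‖ ^ 2 + ‖rt 1‖ ^ 2 := by
      rw [hPsum, hPsum]
      have := inner_sq_add_inner_sq_le (v := rt 0) hp.1 hw hpw
      have := inner_sq_add_inner_sq_le (v := rt 1) hp.1 hw hpw
      linarith
    have h2 := (abs_le.1 (hgr 0 0)).2
    have h3 := (abs_le.1 (hgr 1 1)).2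
    rw [real_inner_self_eq_norm_sq, real_inner_self_eq_norm_sq] at h2 h3
    have h4 := (hPQ w).2
    have h5 := (hPQ p).1
    rw [hw, one_pow, mul_one] at h4
    have h6 : P w + 2 * C ≤ P p - (Ap - Am) / 2 := by linarith
    have h7 := mul_le_mul_of_nonneg_left h6 hm.le
    linarith
  set M := Real.sqrt Ap with hM
  have hM0 : 0 < M := Real.sqrt_pos.2 hAp0
  have hMM : M ^ 2 = Ap := Real.sq_sqrt hAp0.le
  set g := Ap - Am with hgdef
  have hBM : Real.sqrt B ≤ δ * M / 1000 := by
    apply Real.sqrt_le_iff.2 ⟨by positivity, ?_⟩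
    have h0 : (δ * M / 1000) ^ 2 = Ap * δ ^ 2 / 10 ^ 6 := by rw [← hMM]; ring
    have h1 : (Ap - Am) * δ ^ 2 ≤ Ap * δ ^ 2 :=
      mul_le_mul_of_nonneg_right (by linarith) hδsq0.le
    rw [h0]; linarith
  have hsB : 1 ≤ Real.sqrt B := Real.one_le_sqrt.2 hB1
  have hsB2 : Real.sqrt B ^ 2 = B := Real.sq_sqrt hB.le
  have hτs : τ ≤ Real.sqrt B := Real.le_sqrt_of_sq_le hτB
  refine ⟨fun a => |⟪rt a, p⟫|, 2 / 10 * (δ * M), by positivity, ?_, fun j => ?_⟩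
  · have : 0 < δ * M := by positivity
    linarith
  refine (abs_abs_sub_abs_le _ _).trans ?_
  obtain ⟨q, hq, hqτ⟩ := hloo j
  wlog hpq : 0 ≤ ⟪p, q⟫ generalizing q
  · refine this (-q) ⟨by rw [norm_neg, hq.1], fun w hw => ?_⟩ (by rwa [inner_neg_right, abs_neg])
      (by rw [inner_neg_right]; linarith [not_le.1 hpq])
    have := hq.2 w hw
    simpa only [inner_neg_right, neg_sq] using this
  set b := Real.sqrt (2 * m) with hb
  have hbb : b ^ 2 = 2 * m := Real.sq_sqrt (by positivity)
  have hb0 : 0 < b := Real.sqrt_pos.2 (by positivity)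
  have hxb : ∀ l, ‖x l‖ ≤ b := fun l => Real.le_sqrt_of_sq_le (hx l)
  have hrb : ∀ a, ‖r a‖ ≤ b := fun a => Real.le_sqrt_of_sq_le (hr a)
  have h1 := hp.abs_inner_sub_le hq (gap := m * g / 2) hgap (hxb j) hb0
    (by rw [hbb]
        have : m * 10 ^ 6 ≤ m * g := mul_le_mul_of_nonneg_left (by linarith) hm.le
        linarith) hpq
  have h2 : 8 * b ^ 2 / (m * g / 2) = 32 / g := by
    rw [hbb]; field_simp; norm_num
  rw [h2] at h1
  have hrM : ‖r (k j)‖ ≤ 2 * M := by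
    apply le_of_sq_le_sq _ (by positivity)
    have h3 : ‖r (k j)‖ ^ 2 ≤ Ap + Am := by
      rw [← htr]
      have e0 : 0 ≤ ‖r 0‖ ^ 2 := by positivity
      have e1 : 0 ≤ ‖r 1‖ ^ 2 := by positivity
      have hkj : k j = 0 ∨ k j = 1 := by omega
      rcases hkj with h | h <;> rw [h] <;> linarith
    rw [mul_pow, hMM]; linarith
  have h3 : |⟪x j, q⟫| ≤ τ + 2 * M := by
    have e : ⟪x j, q⟫ = ⟪x j - r (k j), q⟫ + ⟪r (k j), q⟫ := by rw [inner_sub_left]; ring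
    rw [e]
    refine (abs_add_le _ _).trans (add_le_add hqτ ?_)
    have := abs_real_inner_le_norm (r (k j)) q
    rw [hq.1, mul_one] at this
    exact this.trans hrM
  have hMB : 1 ≤ M := by
    have : Real.sqrt B ≤ M / 1000 := hBM.trans (by
      have : δ * M ≤ M := mul_le_of_le_one_left hM0.le hδ1
      linarith)
    linarith
  have h4 : b * ‖p - q‖ ≤ δ * M / 1000 := by
    refine h1.trans ?_
    have h5 : τ + 2 * M ≤ 3 * M := by
      have : Real.sqrt B ≤ M / 1000 := hBM.trans (by
        have : δ * M ≤ M := mul_le_of_le_one_left hM0.le hδ1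
        linarith)
      linarith
    have hg0' : 0 < g := hg0
    rw [div_mul_eq_mul_div, div_le_iff₀ hg0']
    have h6 : 10 ^ 6 * M ≤ g * δ * M := by
      refine mul_le_mul_of_nonneg_right ?_ hM0.le
      have : g * δ ^ 2 ≤ g * δ := by
        rw [sq, ← mul_assoc]; exact mul_le_of_le_one_right (by positivity) hδ1
      linarith
    have h7 : 32 * |⟪x j, q⟫| ≤ 32 * (3 * M) := by linarith
    calc _ ≤ _ := h7
      _ ≤ 10 ^ 6 * M / 1000 := by linarith
      _ ≤ g * δ * M / 1000 := by linarith
      _ = _ := by ring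
  have h5 : |⟪x j - r (k j), p⟫| ≤ τ + 2 * (δ * M / 1000) := by
    have e : ⟪x j - r (k j), p⟫ = ⟪x j - r (k j), q⟫ + ⟪x j - r (k j), p - q⟫ := by
      rw [inner_sub_right (x j - r (k j))]; ring
    rw [e]
    refine (abs_add_le _ _).trans (add_le_add hqτ ?_)
    refine (abs_real_inner_le_norm _ _).trans ?_
    have h6 : ‖x j - r (k j)‖ ≤ 2 * b := (norm_sub_le _ _).trans (by
      have := hxb j
      have := hrb (k j)
      linarith)
    calc _ ≤ 2 * b * ‖p - q‖ := mul_le_mul_of_nonneg_right h6 (norm_nonneg _)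
      _ ≤ _ := by linarith
  have h6 : |⟪zb (k j), p⟫| ≤ 2 * Real.sqrt B := by
    apply abs_le_of_sq_le_sq _ (by positivity)
    have := hzbq (k j) p
    rw [hp.1] at this
    rw [mul_pow, hsB2]; linarith
  have h7 : ⟪x j, p⟫ - ⟪rt (k j), p⟫ = ⟪x j - r (k j), p⟫ - ⟪zb (k j), p⟫ := by
    simp only [hrt, inner_sub_left, inner_add_left]; ring
  rw [h7]
  refine (abs_sub _ _).trans ?_
  have : 0 < δ * M := by positivity
  linarith

end Spectral

end Crowd

namespace Crowd

/-- The spectrum of a `2 × 2` Gram matrix `(A, P; P, B)` in terms of `γ = ω + √(ω² + 1)`,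
`ω = |(A - B) / (2 P)|`. -/
theorem exists_gram_eigenpair {A B P : ℝ} (hAB : B < A) (hP : P ≠ 0) (hPAB : P ^ 2 ≤ A * B)
    (hB : 0 ≤ B) :
    let ω := |(A - B) / (2 * P)|
    let γ := ω + Real.sqrt (ω ^ 2 + 1)
    ∃ u₀ u₁ Ap Am δ : ℝ, u₀ ^ 2 + u₁ ^ 2 = 1 ∧ 0 < u₀ ∧ δ = u₀ - |u₁| ∧ 0 < δ ∧
      δ ^ 2 = (γ - 1) ^ 2 / (γ ^ 2 + 1) ∧ 1 < γ ∧
      A * u₀ + P * u₁ = Ap * u₀ ∧ P * u₀ + B * u₁ = Ap * u₁ ∧ A + B = Ap + Am ∧ 0 ≤ Am ∧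
      Am < Ap := by
  intro ω γ
  have hP' : 0 < |P| := abs_pos.2 hP
  have hω : ω = (A - B) / (2 * |P|) := by
    simp only [ω]
    rw [abs_div, abs_mul, abs_two, abs_of_pos (by linarith : 0 < A - B)]
  have hω0 : 0 < ω := by rw [hω]; exact div_pos (by linarith) (by positivity)
  have hs : Real.sqrt (ω ^ 2 + 1) ^ 2 = ω ^ 2 + 1 := Real.sq_sqrt (by positivity)
  have hs1 : 1 < Real.sqrt (ω ^ 2 + 1) := by
    apply Real.lt_sqrt_of_sq_lt; nlinarith
  have hγ : γ ^ 2 = 2 * ω * γ + 1 := by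
    simp only [γ]; nlinarith
  have hγ1 : 1 < γ := by simp only [γ]; linarith
  have hωγ : ω < γ := by simp only [γ]; linarith
  clear_value γ ω
  have hdiff : A - B = 2 * ω * |P| := by rw [hω]; field_simp
  set N := Real.sqrt (γ ^ 2 + 1) with hN
  have hN0 : 0 < N := Real.sqrt_pos.2 (by positivity)
  have hNN : N ^ 2 = γ ^ 2 + 1 := Real.sq_sqrt (by positivity)
  have hPP : |P| * |P| = P ^ 2 := by rw [← sq, sq_abs]
  have hAp : 0 < B + |P| * γ := by positivity
  refine ⟨γ / N, P / |P| / N, B + |P| * γ, A - |P| * γ, (γ - 1) / N, ?_, by positivity, ?_,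
    div_pos (by linarith) hN0, ?_, hγ1, ?_, ?_, by ring, ?_, ?_⟩
  · rw [div_pow, div_pow, div_pow, sq_abs, hNN]
    have : P ^ 2 ≠ 0 := by positivity
    field_simp
  · rw [abs_div, abs_div, abs_abs, div_self hP'.ne', abs_of_pos hN0]; ring
  · rw [div_pow, hNN]
  · field_simp
    linear_combination (|P| * γ) * hdiff - |P| * |P| * hγ - hPP
  · field_simp
    ring
  · have h1 : (B + |P| * γ) * (A - |P| * γ) = A * B - P ^ 2 := by
      linear_combination (|P| * γ) * hdiff - hPP - |P| * |P| * hγ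
    by_contra h
    have : (B + |P| * γ) * (A - |P| * γ) < 0 := mul_neg_of_pos_of_neg hAp (not_le.1 h)
    linarith
  · nlinarith

section Eigengap

variable {ι : Type*} [Fintype ι] {d : ℕ} {k : Fin d → Fin 2} {m : ℝ}

theorem relMatrix_mulVec (r : Fin 2 → ι → ℝ) (v : Fin d → ℝ) (j : Fin d) :
    (relMatrix k r).mulVec v j =
      ∑ a, (∑ i, r (k j) i * r a i) * ∑ l ∈ Finset.univ.filter (fun l => k l = a), v l := by
  have h1 : (relMatrix k r).mulVec v j = ∑ l, (∑ i, r (k j) i * r (k l) i) * v l := by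
    simp [relMatrix, Matrix.mulVec, dotProduct]
  rw [h1, ← Finset.sum_fiberwise (s := Finset.univ) (g := k)]
  refine Finset.sum_congr rfl fun a _ => ?_
  rw [Finset.mul_sum]
  refine Finset.sum_congr rfl fun l hl => ?_
  rw [(Finset.mem_filter.1 hl).2]

/-- The eigengap of the reliability matrix is that of the Gram matrix of the two reliability
vectors. -/
theorem card_mul_eigengap (hm : 0 < m)
    (hk : ∀ a, ((Finset.univ.filter fun j => k j = a).card : ℝ) = m) (hd : (d : ℝ) = 2 * m)
    (hn : 0 < Fintype.card ι) (r : Fin 2 → ι → ℝ) {u₀ u₁ Ap Am : ℝ}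
    (hu0 : 0 < u₀)
    (h0 : (∑ i, r 0 i ^ 2) * u₀ + (∑ i, r 0 i * r 1 i) * u₁ = Ap * u₀)
    (h1 : (∑ i, r 0 i * r 1 i) * u₀ + (∑ i, r 1 i ^ 2) * u₁ = Ap * u₁)
    (htr : ∑ i, r 0 i ^ 2 + ∑ i, r 1 i ^ 2 = Ap + Am) (hAm : 0 ≤ Am) (hlt : Am < Ap) :
    Fintype.card ι * eigengap k r = Ap - Am := by
  set A := ∑ i, r 0 i ^ 2 with hA
  set B := ∑ i, r 1 i ^ 2 with hB
  set P := ∑ i, r 0 i * r 1 i with hP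
  have hdet : Ap * Am = A * B - P ^ 2 := by
    have e1 : (A - Ap) * u₀ = -P * u₁ := by linear_combination h0
    have e2 : (B - Ap) * u₁ = -P * u₀ := by linear_combination h1
    have e3 : (A - Ap) * (B - Ap) = P ^ 2 := by
      have e4 : ((A - Ap) * (B - Ap) - P ^ 2) * u₀ = 0 := by
        linear_combination (B - Ap) * e1 - P * e2
      have := (mul_eq_zero.1 e4).resolve_right hu0.ne'
      linarith
    linear_combination (-Ap) * htr - e3
  have hG : ∀ a b, ∑ i, r a i * r b i = if a = 0 then (if b = 0 then A else P)
      else (if b = 0 then P else B) := by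
    intro a b
    fin_cases a <;> fin_cases b <;> simp [hA, hB, hP, sq, mul_comm]
  have hR := relMatrix_isHermitian k r
  have hcases : ∀ c ∈ spectrum ℝ (relMatrix k r), c = 0 ∨ c = m * Ap ∨ c = m * Am := by
    intro c hc
    rw [← Matrix.spectrum_toLin', ← Module.End.hasEigenvalue_iff_mem_spectrum] at hc
    obtain ⟨v, hv⟩ := hc.exists_hasEigenvector
    have hv1 : (relMatrix k r).mulVec v = c • v := by
      have := hv.apply_eq_smul
      rwa [Matrix.toLin'_apply] at this
    set s : Fin 2 → ℝ := fun a => ∑ l ∈ Finset.univ.filter (fun l => k l = a), v l with hs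
    have hvj : ∀ j, c * v j = ∑ a, (∑ i, r (k j) i * r a i) * s a := fun j => by
      rw [← relMatrix_mulVec, hv1]; rfl
    have hsum : ∀ b, c * s b = m * ∑ a, (∑ i, r b i * r a i) * s a := by
      intro b
      rw [hs]
      simp only
      rw [Finset.mul_sum, ← hk b, ← nsmul_eq_mul, ← Finset.sum_const]
      refine Finset.sum_congr rfl fun j hj => ?_
      rw [hvj, (Finset.mem_filter.1 hj).2]
    have hs0 := hsum 0
    have hs1 := hsum 1
    simp only [Fin.sum_univ_two, hG, if_true, one_ne_zero, if_false] at hs0 hs1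
    by_cases hz : s 0 = 0 ∧ s 1 = 0
    · left
      by_contra hc0
      apply hv.2
      funext j
      have := hvj j
      rw [Fin.sum_univ_two, hz.1, hz.2, mul_zero, mul_zero, add_zero] at this
      exact (mul_eq_zero.1 this).resolve_left hc0
    · right
      have hchar : (c - m * Ap) * (c - m * Am) = 0 := by
        have e : (c - m * Ap) * (c - m * Am) = (c - m * A) * (c - m * B) - m ^ 2 * P ^ 2 := by
          linear_combination (-(c * m)) * (-htr) + m ^ 2 * hdet
        have e1 : ((c - m * A) * (c - m * B) - m ^ 2 * P ^ 2) * s 0 = 0 := by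
          linear_combination (c - m * B) * hs0 + m * P * hs1
        have e2 : ((c - m * A) * (c - m * B) - m ^ 2 * P ^ 2) * s 1 = 0 := by
          linear_combination (c - m * A) * hs1 + m * P * hs0
        rw [e]
        by_contra hne
        exact hz ⟨(mul_eq_zero.1 e1).resolve_left hne, (mul_eq_zero.1 e2).resolve_left hne⟩
      rcases mul_eq_zero.1 hchar with h | h
      · left; linarith
      · right; linarith
  have hmem : m * Ap ∈ spectrum ℝ (relMatrix k r) := by
    rw [← Matrix.spectrum_toLin', ← Module.End.hasEigenvalue_iff_mem_spectrum]
    set v : Fin d → ℝ := fun j => if k j = 0 then u₀ else u₁ with hv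
    refine Module.End.hasEigenvalue_of_hasEigenvector (x := v)
      ⟨Module.End.mem_eigenspace_iff.2 ?_, ?_⟩
    · rw [Matrix.toLin'_apply]
      have hs : ∀ a, ∑ l ∈ Finset.univ.filter (fun l => k l = a), v l =
          m * if a = 0 then u₀ else u₁ := by
        intro a
        rw [← hk a, ← nsmul_eq_mul, ← Finset.sum_const]
        refine Finset.sum_congr rfl fun j hj => ?_
        rw [hv]; simp only [(Finset.mem_filter.1 hj).2]
      funext j
      rw [relMatrix_mulVec, Fin.sum_univ_two, hs, hs, hG, hG]
      simp only [hv, Pi.smul_apply, smul_eq_mul, if_true, one_ne_zero, if_false]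
      split_ifs
      · linear_combination m * h0
      · linear_combination m * h1
    · intro h
      have hne : (Finset.univ.filter fun j => k j = 0).Nonempty := by
        rw [← Finset.card_pos]
        have := hk 0
        have : (0 : ℝ) < (Finset.univ.filter fun j => k j = 0).card := by rw [this]; exact hm
        exact_mod_cast this
      obtain ⟨j, hj⟩ := hne
      have := congrFun h j
      simp only [hv, (Finset.mem_filter.1 hj).2, if_true, Pi.zero_apply] at this
      exact hu0.ne' this
  have hApp : 0 < Ap := by linarith
  have hmA : 0 ≤ m * Am := by positivity
  have hmlt : m * Am < m * Ap := mul_lt_mul_of_pos_left hlt hm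
  have hd2 : 1 < Fintype.card (Fin d) := by
    rw [Fintype.card_fin]
    have h2 : (1 : ℝ) ≤ m := by
      rw [← hk 0] at hm ⊢
      exact_mod_cast hm
    have : (1 : ℝ) < d := by linarith
    exact_mod_cast this
  set L := hR.eigenvalues₀ with hL
  have hLmem : ∀ i, L i ∈ spectrum ℝ (relMatrix k r) := by
    intro i
    have := hR.eigenvalues_mem_spectrum_real
      ((Fintype.equivOfCardEq (Fintype.card_fin _)) i)
    simpa [Matrix.IsHermitian.eigenvalues, hL] using this
  have hLnn : ∀ i, 0 ≤ L i := fun i => by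
    rcases hcases _ (hLmem i) with h | h | h <;> rw [h]
    exact hmA.trans hmlt.le
    exact hmA
  have hLsum : ∑ i, L i = m * (Ap + Am) := by
    have h2 := hR.trace_eq_sum_eigenvalues
    have h3 : ∑ i, hR.eigenvalues i = ∑ i, L i := by
      simp only [Matrix.IsHermitian.eigenvalues, hL]
      exact Equiv.sum_comp (Fintype.equivOfCardEq (Fintype.card_fin _)).symm hR.eigenvalues₀
    simp only [RCLike.ofReal_real_eq_id, id_eq] at h2
    rw [← h3, ← h2, Matrix.trace, ← htr]
    have h4 : ∀ j, (relMatrix k r).diag j = ∑ i, r (k j) i * r (k j) i := fun j => by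
      simp [relMatrix]
    simp only [h4]
    rw [← Finset.sum_fiberwise (s := Finset.univ) (g := k), Fin.sum_univ_two, mul_add]
    congr 1
    · rw [← hk 0, ← nsmul_eq_mul, ← Finset.sum_const]
      refine Finset.sum_congr rfl fun j hj => ?_
      rw [(Finset.mem_filter.1 hj).2, hG]; simp
    · rw [← hk 1, ← nsmul_eq_mul, ← Finset.sum_const]
      refine Finset.sum_congr rfl fun j hj => ?_
      rw [(Finset.mem_filter.1 hj).2, hG]; simp
  have hanti : Antitone L := hR.eigenvalues₀_antitone
  set i0 : Fin (Fintype.card (Fin d)) := ⟨0, by omega⟩ with hi0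
  set i1 : Fin (Fintype.card (Fin d)) := ⟨1, hd2⟩ with hi1
  have h01 : i0 ≠ i1 := by simp [hi0, hi1]
  have hL0 : L i0 = m * Ap := by
    apply le_antisymm
    · rcases hcases _ (hLmem i0) with h | h | h <;> rw [h]
      exact hmA.trans hmlt.le
      exact hmlt.le
    · rw [hR.spectrum_real_eq_range_eigenvalues] at hmem
      obtain ⟨j, hj⟩ := hmem
      rw [← hj]
      exact hanti (Fin.mk_le_of_le_val (Nat.zero_le _))
  have hL1 : L i1 = m * Am := by
    have hrest : ∑ i ∈ Finset.univ.erase i0, L i = m * Am := by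
      have := Finset.add_sum_erase Finset.univ L (Finset.mem_univ i0)
      rw [hLsum, hL0] at this; linarith
    have hle : L i1 ≤ m * Am := by
      rw [← hrest]
      exact Finset.single_le_sum (fun i _ => hLnn i) (by simp [h01.symm])
    rcases hcases _ (hLmem i1) with h | h | h
    · have hz : ∑ i ∈ Finset.univ.erase i0, L i = 0 := by
        refine Finset.sum_eq_zero fun i hi => le_antisymm ?_ (hLnn i)
        rw [← h]
        apply hanti
        rw [Fin.le_def, hi1]
        have : (i : ℕ) ≠ 0 := fun h' => (Finset.mem_erase.1 hi).1 (Fin.ext h')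
        show 1 ≤ (i : ℕ)
        omega
      rw [h, ← hrest, hz]
    · linarith
    · exact h
  have hn' : (0 : ℝ) < Fintype.card ι := by exact_mod_cast hn
  rw [eigengap, relEigenvalue, relEigenvalue, dif_pos (by omega), dif_pos hd2]
  change (Fintype.card ι : ℝ) * (2 / (d * Fintype.card ι) * (L i0 - L i1)) = _
  rw [hL0, hL1, hd]
  field_simp

end Eigengap

end Crowd

namespace Crowd

section Columns

local notation "⟪" a ", " b "⟫" => inner ℝ a b

theorem exists_isPrincipal {E κ : Type*} [NormedAddCommGroup E] [InnerProductSpace ℝ E]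
    [FiniteDimensional ℝ E] [Nontrivial E] (x : κ → E) (s : Finset κ) : ∃ p, IsPrincipal x s p := by
  have hne : (Metric.sphere (0 : E) 1).Nonempty := NormedSpace.sphere_nonempty.2 zero_le_one
  obtain ⟨p, hp, hmax⟩ := (isCompact_sphere (0 : E) 1).exists_isMaxOn hne
    (f := fun q => ∑ j ∈ s, ⟪x j, q⟫ ^ 2) (by fun_prop)
  refine ⟨p, by simpa using hp, fun q hq => hmax (by simpa using hq)⟩

theorem IsPrincipal.congr {E κ : Type*} [NormedAddCommGroup E] [InnerProductSpace ℝ E]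
    {x x' : κ → E} {s : Finset κ} {p : E} (h : IsPrincipal x s p) (hx : ∀ j ∈ s, x j = x' j) :
    IsPrincipal x' s p := by
  have e : ∀ q, ∑ j ∈ s, ⟪x' j, q⟫ ^ 2 = ∑ j ∈ s, ⟪x j, q⟫ ^ 2 := fun q =>
    Finset.sum_congr rfl fun j hj => by rw [hx j hj]
  exact ⟨h.1, fun q hq => by rw [e, e]; exact h.2 q hq⟩

theorem IsPrincipal.sum_smul {E κ : Type*} [NormedAddCommGroup E] [InnerProductSpace ℝ E]
    {x : κ → E} {s : Finset κ} {p : E} (h : IsPrincipal x s p) :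
    ∑ j ∈ s, ⟪x j, p⟫ • x j = (∑ j ∈ s, ⟪x j, p⟫ ^ 2) • p := by
  set Q := ∑ j ∈ s, ⟪x j, p⟫ ^ 2 with hQ
  set w := ∑ j ∈ s, ⟪x j, p⟫ • x j with hw
  have h1 : ∀ q, ⟪w, q⟫ = ∑ j ∈ s, ⟪x j, p⟫ * ⟪x j, q⟫ := fun q => by
    rw [hw, sum_inner]
    exact Finset.sum_congr rfl fun j _ => by rw [inner_smul_left]; rfl
  have hpp : ⟪p, p⟫ = 1 := by rw [real_inner_self_eq_norm_sq, h.1, one_pow]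
  have hwp : ⟪w, p⟫ = Q := by
    rw [h1, hQ]; exact Finset.sum_congr rfl fun j _ => by ring
  have h2 : ⟪p, w - Q • p⟫ = 0 := by
    rw [inner_sub_right, inner_smul_right, hpp, real_inner_comm, hwp]; ring
  have h3 : ⟪w, w - Q • p⟫ = 0 := by rw [h1]; exact h.sum_mul_eq_zero h2
  have h4 : ⟪w - Q • p, w - Q • p⟫ = 0 := by
    rw [inner_sub_left, h3, inner_smul_left, h2]; simp
  exact sub_eq_zero.1 (inner_self_eq_zero.1 h4)

variable {ι : Type*} [Fintype ι] {d : ℕ}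

/-- The responses to a task, as a vector. -/
def respVec (B : ι → Fin d → ℤˣ) (j : Fin d) : EuclideanSpace ℝ ι :=
  WithLp.toLp 2 fun i => val (B i j)

theorem inner_toLp (f g : ι → ℝ) :
    ⟪(WithLp.toLp 2 f : EuclideanSpace ℝ ι), (WithLp.toLp 2 g : EuclideanSpace ℝ ι)⟫ =
      ∑ i, f i * g i := by
  simp [PiLp.inner_apply, mul_comm]

theorem inner_respVec (B : ι → Fin d → ℤˣ) (j : Fin d) (p : EuclideanSpace ℝ ι) :
    ⟪respVec B j, p⟫ = ∑ i, p i * val (B i j) := by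
  simp [respVec, PiLp.inner_apply]

theorem norm_respVec_sq (B : ι → Fin d → ℤˣ) (j : Fin d) :
    ‖respVec B j‖ ^ 2 = Fintype.card ι := by
  rw [EuclideanSpace.norm_sq_eq]
  simp [respVec, abs_val]

theorem taskSimilarity_mulVec (B : ι → Fin d → ℤˣ) (v : Fin d → ℝ) (j : Fin d) :
    (taskSimilarity B).mulVec v j =
      1 / (Fintype.card ι : ℝ) * ⟪respVec B j, ∑ l, v l • respVec B l⟫ := by
  rw [inner_sum, Finset.mul_sum]
  simp only [Matrix.mulVec, dotProduct, taskSimilarity, Matrix.of_apply]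
  refine Finset.sum_congr rfl fun l _ => ?_
  rw [inner_smul_right, respVec, respVec, inner_toLp]; ring

/-- The principal eigenvector of the task-similarity matrix is proportional to the projections of
the response vectors on their principal direction. -/
theorem IsPrincipalEigenvector.exists_isPrincipal [Nonempty ι] {B : ι → Fin d → ℤˣ}
    {v : Fin d → ℝ} (hv : IsPrincipalEigenvector (taskSimilarity B) v) :
    ∃ p, IsPrincipal (respVec B) Finset.univ p ∧
      ∃ c : ℝ, 0 < c ∧ ∀ j, |v j| = c * |⟪respVec B j, p⟫| := by
  obtain ⟨hv1, lam, hlam, hmax⟩ := hv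
  set n : ℝ := (Fintype.card ι : ℝ) with hn
  have hn0 : 0 < n := by rw [hn]; exact_mod_cast Fintype.card_pos
  obtain ⟨j0⟩ : Nonempty (Fin d) := by
    by_contra h
    rw [not_nonempty_iff] at h
    simp at hv1
  obtain ⟨ps, hps⟩ := Crowd.exists_isPrincipal (respVec B) Finset.univ
  set Q := ∑ j, ⟪respVec B j, ps⟫ ^ 2 with hQ
  have hQ0 : 0 < Q := by
    have h1 := hps.le (respVec B j0)
    have h2 : ⟪respVec B j0, respVec B j0⟫ ^ 2 ≤ ∑ j, ⟪respVec B j, respVec B j0⟫ ^ 2 :=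
      Finset.single_le_sum (f := fun j => ⟪respVec B j, respVec B j0⟫ ^ 2)
        (fun _ _ => sq_nonneg _) (Finset.mem_univ j0)
    rw [real_inner_self_eq_norm_sq, norm_respVec_sq] at h2
    rw [norm_respVec_sq] at h1
    have h3 : n ^ 2 ≤ n * Q := h2.trans h1
    have : 0 < n * Q := lt_of_lt_of_le (by positivity) h3
    exact (mul_pos_iff_of_pos_left hn0).1 this
  have heig : Q / n ≤ lam := by
    apply hmax
    apply Module.End.hasEigenvalue_of_hasEigenvector (x := fun j => ⟪respVec B j, ps⟫)
    refine Module.End.hasEigenvector_iff.2 ⟨Module.End.mem_eigenspace_iff.2 ?_, ?_⟩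
    · rw [Matrix.toLin'_apply]
      funext j
      rw [taskSimilarity_mulVec, hps.sum_smul, inner_smul_right, Pi.smul_apply, smul_eq_mul]
      ring
    · intro h
      have : Q = 0 := by
        rw [hQ]; exact Finset.sum_eq_zero fun j _ => by
          have := congrFun h j
          simp only [Pi.zero_apply] at this
          rw [this]; norm_num
      exact hQ0.ne' this
  have hlam0 : 0 < lam := lt_of_lt_of_le (by positivity) heig
  set q := ∑ l, v l • respVec B l with hq
  have hzq : ∀ j, ⟪respVec B j, q⟫ = n * lam * v j := by
    intro j
    have := congrFun hlam j
    rw [taskSimilarity_mulVec, Pi.smul_apply, smul_eq_mul] at this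
    rw [mul_assoc, ← this, ← hq, ← hn]
    field_simp
  have hqq : ‖q‖ ^ 2 = n * lam := by
    rw [← real_inner_self_eq_norm_sq]
    conv_lhs => rw [hq]
    rw [sum_inner]
    calc ∑ l, ⟪v l • respVec B l, q⟫ = n * lam * ∑ l, v l ^ 2 := by
          rw [Finset.mul_sum]
          refine Finset.sum_congr rfl fun l _ => ?_
          rw [inner_smul_left, hzq]; simp; ring
      _ = n * lam := by rw [hv1, mul_one]
  have hnl : 0 < n * lam := by positivity
  have hq0 : 0 < ‖q‖ := by
    have : ‖q‖ ≠ 0 := fun h => by rw [h] at hqq; simp at hqq; rcases hqq with h | h <;> linarith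
    exact lt_of_le_of_ne (norm_nonneg _) this.symm
  refine ⟨‖q‖⁻¹ • q, ⟨by rw [norm_smul]; simp [hq0.ne'], fun w hw => ?_⟩, ‖q‖⁻¹, by positivity,
    fun j => ?_⟩
  · refine (hps.2 w hw).trans ?_
    have : ∑ j, ⟪respVec B j, ‖q‖⁻¹ • q⟫ ^ 2 = n * lam := by
      simp only [inner_smul_right, hzq, mul_pow]
      rw [← Finset.mul_sum, ← Finset.mul_sum, hv1, inv_pow, hqq]
      field_simp
    rw [this]
    rw [div_le_iff₀ hn0] at heig
    linarith
  · rw [inner_smul_right, hzq, abs_mul, abs_of_pos (by positivity : 0 < ‖q‖⁻¹), abs_mul,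
      abs_of_pos hnl, ← hqq]
    field_simp

theorem IsPrincipal.signs {B : ι → Fin d → ℤˣ} {y : Fin d → ℤˣ} {s : Finset (Fin d)}
    {p : EuclideanSpace ℝ ι} (h : IsPrincipal (respVec B) s p) :
    IsPrincipal (respVec fun i j => B i j * y j) s p := by
  have e : ∀ q j, ⟪respVec (fun i j => B i j * y j) j, q⟫ ^ 2 = ⟪respVec B j, q⟫ ^ 2 := by
    intro q j
    simp only [inner_respVec, val_mul, ← mul_assoc]
    rw [← Finset.sum_mul, mul_pow, val_sq, mul_one]
  exact ⟨h.1, fun q hq => by simp only [e]; exact h.2 q hq⟩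

theorem abs_inner_respVec_signs (B : ι → Fin d → ℤˣ) (y : Fin d → ℤˣ) (j : Fin d)
    (p : EuclideanSpace ℝ ι) :
    |⟪respVec (fun i j => B i j * y j) j, p⟫| = |⟪respVec B j, p⟫| := by
  simp only [inner_respVec, val_mul, ← mul_assoc]
  rw [← Finset.sum_mul, abs_mul, abs_val, mul_one]

end Columns

theorem clusterBy_eq {d : ℕ} {k : Fin d → Fin 2} {m : ℝ} (hm : 0 < m)
    (hk : ∀ a, ((Finset.univ.filter fun j => k j = a).card : ℝ) = m) (hd : (d : ℝ) = 2 * m)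
    {v : Fin d → ℝ} {a : Fin 2 → ℝ} {e : ℝ} (he : 4 * e < a 0 - a 1)
    (hv : ∀ j, |(|v j|) - a (k j)| ≤ e) (c : Fin d → ℤˣ) : clusterBy v c = k := by
  have hsum : |∑ l, |v l| - m * (a 0 + a 1)| ≤ 2 * m * e := by
    have h1 : m * (a 0 + a 1) = ∑ l, a (k l) := by
      rw [← Finset.sum_fiberwise (s := Finset.univ) (g := k), Fin.sum_univ_two, mul_add]
      congr 1
      · rw [← hk 0, ← nsmul_eq_mul, ← Finset.sum_const]
        exact Finset.sum_congr rfl fun j hj => by rw [(Finset.mem_filter.1 hj).2]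
      · rw [← hk 1, ← nsmul_eq_mul, ← Finset.sum_const]
        exact Finset.sum_congr rfl fun j hj => by rw [(Finset.mem_filter.1 hj).2]
    rw [h1, ← Finset.sum_sub_distrib]
    refine (Finset.abs_sum_le_sum_abs _ _).trans ((Finset.sum_le_sum fun l _ => hv l).trans ?_)
    simp [hd]
  have hmean : |(∑ l, |v l|) / d - (a 0 + a 1) / 2| ≤ e := by
    rw [hd]
    have : (∑ l, |v l|) / (2 * m) - (a 0 + a 1) / 2 = (∑ l, |v l| - m * (a 0 + a 1)) / (2 * m) := by
      field_simp
    rw [this, abs_div, abs_of_pos (by positivity : 0 < 2 * m), div_le_iff₀ (by positivity)]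
    linarith
  rw [abs_le] at hmean
  funext j
  have hj := abs_le.1 (hv j)
  have : k j = 0 ∨ k j = 1 := by
    rcases k j with ⟨t, ht⟩
    interval_cases t <;> simp
  unfold clusterBy
  rcases this with h | h
  · rw [h] at hj ⊢
    rw [if_pos (by linarith)]
  · rw [h] at hj ⊢
    rw [if_neg (by linarith), if_pos (by linarith)]

end Crowd

namespace Crowd

section ClusterProb

local notation "⟪" a ", " b "⟫" => inner ℝ a b

variable {ι Ω : Type*} [Fintype ι] {d : ℕ} [MeasurableSpace Ω] {μ : Measure Ω}
  [IsProbabilityMeasure μ] {k : Fin d → Fin 2} {r : Fin 2 → ι → ℝ} {X : ι × Fin d → Ω → ℤˣ}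

/-- A vector computed from all columns but one is nearly orthogonal to the noise in that column. -/
theorem IsSignFamily.prob_leaveOneOut_le [Nonempty ι]
    (hX : IsSignFamily μ X fun p => r (k p.2) p.1) (j : Fin d) {τ : ℝ} (hτ : 0 ≤ τ) :
    μ.real {ω | ¬ ∃ q, IsPrincipal (respVec fun i l => X (i, l) ω) (Finset.univ.erase j) q ∧
      |⟪respVec (fun i l => X (i, l) ω) j - WithLp.toLp 2 (r (k j)), q⟫| ≤ τ} ≤
      2 * Real.exp (-(τ ^ 2 / 2)) := by
  classical
  choose Q hQ using fun M : ι → Fin d → ℤˣ =>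
    Crowd.exists_isPrincipal (respVec M) (Finset.univ.erase j)
  set S : Finset (ι × Fin d) := Finset.univ ×ˢ {j} with hS
  set T : Finset (ι × Fin d) := Finset.univ ×ˢ (Finset.univ.erase j) with hT
  set A : Ω → ι → ℤˣ := fun ω i => X (i, j) ω with hA
  set M : Ω → ι → Fin d → ℤˣ := fun ω i l => if l = j then 1 else X (i, l) ω with hM
  have hind : IndepFun A M μ := by
    have h1 := hX.indepFun_restrict S T (by
      rw [Finset.disjoint_left]
      rintro ⟨i, l⟩ h1 h2
      simp [hS, hT] at h1 h2
      exact h2 h1.symm)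
      (fun f (i : ι) => f ⟨(i, j), by simp [hS]⟩)
      (fun f (i : ι) (l : Fin d) => if h : l = j then 1 else f ⟨(i, l), by simp [hT, h]⟩)
    exact h1
  have hMm : Measurable M := by
    refine measurable_pi_lambda _ fun i => measurable_pi_lambda _ fun l => ?_
    by_cases h : l = j
    · simp [hM, h]
    · simpa [hM, h] using hX.measurable (i, l)
  have hin : ∀ ω (p : EuclideanSpace ℝ ι),
      ⟪respVec (fun i l => X (i, l) ω) j - WithLp.toLp 2 (r (k j)), p⟫ =
        ∑ i, p i * (val (A ω i) - r (k j) i) := by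
    intro ω p
    rw [inner_sub_left, inner_respVec]
    simp only [mul_sub, Finset.sum_sub_distrib, hA]
    simp [PiLp.inner_apply]
  have key := measureReal_le_of_indepFun (μ := μ) hMm hind
    (fun a b => τ ≤ |∑ i, Q b i * (val (a i) - r (k j) i)|) (δ := 2 * Real.exp (-(τ ^ 2 / 2)))
    (by
      intro b
      have h2 := (hX.precomp (g := fun i : ι => (i, j)) fun a b h => (Prod.mk.inj h).1).hoeffding
        Finset.univ (fun i => Q b i) (v := 1) (t := τ)
        (by rw [← EuclideanSpace.real_norm_sq_eq, (hQ b).1, one_pow]) one_pos hτ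
      simpa using h2)
  refine le_trans (measureReal_mono ?_ (measure_ne_top _ _)) key
  intro ω hω
  simp only [Set.mem_ofPred_eq] at hω ⊢
  by_contra h
  apply hω
  refine ⟨Q (M ω), (hQ (M ω)).congr fun l hl => ?_, ?_⟩
  · have : l ≠ j := by simpa using hl
    simp [respVec, hM, this]
  · rw [hin]; exact (not_le.1 h).le

theorem IsSignFamily.prob_gram_le {m : ℝ} (hm : 0 < m)
    (hX : IsSignFamily μ X fun p => r (k p.2) p.1)
    (hk : ∀ a, ((Finset.univ.filter fun j => k j = a).card : ℝ) = m) (hr : ∀ a i, |r a i| ≤ 1)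
    (hn : (Fintype.card ι : ℝ) ≤ 2 * m) (a b : Fin 2) {τ : ℝ} (hτ : 0 ≤ τ) :
    μ.real {ω | ¬ |∑ j ∈ Finset.univ.filter (fun j => k j = b),
      ⟪(WithLp.toLp 2 (r a) : EuclideanSpace ℝ ι),
        respVec (fun i l => X (i, l) ω) j - WithLp.toLp 2 (r (k j))⟫| ≤ m * τ} ≤
      2 * Real.exp (-(τ ^ 2 / 4)) := by
  have h1 := hX.hoeffding (Finset.univ ×ˢ Finset.univ.filter fun j => k j = b)
    (fun p => r a p.1) (v := 2 * m ^ 2) (t := m * τ) (by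
      rw [Finset.sum_product_right]
      simp only [Finset.sum_const, nsmul_eq_mul, hk]
      have : ∑ i, r a i ^ 2 ≤ 2 * m := by
        refine le_trans (Finset.sum_le_sum (g := fun _ => (1 : ℝ)) fun i _ => ?_) ?_
        · rw [← sq_abs]; exact pow_le_one₀ (abs_nonneg _) (hr a i)
        · simpa using hn
      nlinarith) (by positivity) (by positivity)
  have h2 : (m * τ) ^ 2 / (2 * (2 * m ^ 2)) = τ ^ 2 / 4 := by field_simp; norm_num
  rw [h2] at h1
  refine le_trans (measureReal_mono ?_ (measure_ne_top _ _)) h1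
  intro ω hω
  simp only [Set.mem_ofPred_eq, not_le] at hω ⊢
  refine hω.le.trans (le_of_eq ?_)
  congr 1
  rw [Finset.sum_product_right]
  refine Finset.sum_congr rfl fun j _ => ?_
  rw [inner_sub_right, real_inner_comm, inner_respVec, inner_toLp, ← Finset.sum_sub_distrib]
  exact Finset.sum_congr rfl fun i _ => by ring

theorem cluster_failure_le {d e : ℝ} (hd : 61 ≤ d) (he : e ≤ 1 / d ^ 3) :
    2 * e + (8 * (1 / d ^ 3) + d * (2 * (1 / d ^ 6))) ≤ 1 / d ^ 2 := by
  have hd0 : 0 < d := by linarith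
  have h6 : d * (2 * (1 / d ^ 6)) ≤ 2 * (1 / d ^ 3) := by
    have : d * (2 * (1 / d ^ 6)) = 2 * (1 / d ^ 3) * (1 / d ^ 2) := by field_simp
    rw [this]
    apply mul_le_of_le_one_right (by positivity)
    rw [div_le_one (by positivity)]
    nlinarith
  have h7 : 12 * (1 / d ^ 3) ≤ 1 / d ^ 2 := by
    have : 12 * (1 / d ^ 3) = 1 / d ^ 2 * (12 / d) := by field_simp
    rw [this]
    apply mul_le_of_le_one_right (by positivity)
    rw [div_le_one hd0]; linarith
  generalize 1 / d ^ 3 = u at *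
  linarith

/-- With high probability the entries of the principal eigenvector of the task-similarity matrix
separate the two types of tasks. -/
theorem IsSignFamily.prob_not_separates_le [Nonempty ι] {m : ℝ} (hm : 0 < m)
    (hX : IsSignFamily μ X fun p => r (k p.2) p.1)
    (hk : ∀ a, ((Finset.univ.filter fun j => k j = a).card : ℝ) = m) (hd : (d : ℝ) = 2 * m)
    (hnd : Fintype.card ι ≤ d) (hr : ∀ a i, |r a i| ≤ 1)
    (hlt : ∑ i, r 1 i ^ 2 < ∑ i, r 0 i ^ 2) (hne : ∑ i, r 0 i * r 1 i ≠ 0)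
    (hlog : 60 ≤ Real.log d)
    (hgap : 12 * 10 ^ 6 * Real.log d * ((gam r ^ 2 + 1) / (gam r - 1) ^ 2) ≤
      Fintype.card ι * eigengap k r) :
    μ.real {ω | ¬ ∀ p, IsPrincipal (respVec fun i l => X (i, l) ω) Finset.univ p →
      ∃ (a : Fin 2 → ℝ) (e : ℝ), 0 < e ∧ 4 * e < a 0 - a 1 ∧
        ∀ j, |(|⟪respVec (fun i l => X (i, l) ω) j, p⟫|) - a (k j)| ≤ e} ≤ 1 / (d : ℝ) ^ 2 := by
  classical
  have hn0 : 0 < Fintype.card ι := Fintype.card_pos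
  have hn' : (Fintype.card ι : ℝ) ≤ 2 * m := by rw [← hd]; exact_mod_cast hnd
  have hP2 : (∑ i, r 0 i * r 1 i) ^ 2 ≤ (∑ i, r 0 i ^ 2) * ∑ i, r 1 i ^ 2 :=
    Finset.sum_mul_sq_le_sq_mul_sq _ _ _
  obtain ⟨u₀, u₁, Ap, Am, δ, hu, hu0, hδ, hδ0, hδsq, hγ, e0, e1, htr, hAm, hAlt⟩ :=
    exists_gram_eigenpair hlt hne hP2 (Finset.sum_nonneg fun i _ => sq_nonneg (r 1 i))
  have hgapeq := card_mul_eigengap hm hk hd hn0 r hu0 e0 e1 htr hAm hAlt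
  rw [hgapeq] at hgap
  have hγ' : 1 < gam r := hγ
  have hδsq' : δ ^ 2 = (gam r - 1) ^ 2 / (gam r ^ 2 + 1) := hδsq
  set L := Real.log d with hL
  have hgδ : 10 ^ 6 * (12 * L) ≤ (Ap - Am) * δ ^ 2 := by
    have h1 : (gam r ^ 2 + 1) / (gam r - 1) ^ 2 * δ ^ 2 = 1 := by
      rw [hδsq']
      have : gam r - 1 ≠ 0 := by linarith
      field_simp
    calc 10 ^ 6 * (12 * L) = 12 * 10 ^ 6 * L * ((gam r ^ 2 + 1) / (gam r - 1) ^ 2 * δ ^ 2) := by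
          rw [h1]; ring
      _ = 12 * 10 ^ 6 * L * ((gam r ^ 2 + 1) / (gam r - 1) ^ 2) * δ ^ 2 := by ring
      _ ≤ _ := mul_le_mul_of_nonneg_right hgap (sq_nonneg _)
  set τ := Real.sqrt (12 * L) with hτ
  have hττ : τ ^ 2 = 12 * L := Real.sq_sqrt (by linarith)
  have hτ0 : 0 ≤ τ := Real.sqrt_nonneg _
  have hτ1 : 1 ≤ τ := by nlinarith
  set R : Fin 2 → EuclideanSpace ℝ ι := fun a => WithLp.toLp 2 (r a) with hR
  have hRn : ∀ a, ‖R a‖ ^ 2 = ∑ i, r a i ^ 2 := fun a => by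
    rw [EuclideanSpace.real_norm_sq_eq]
  have hRi : ⟪R 0, R 1⟫ = ∑ i, r 0 i * r 1 i := inner_toLp _ _
  set Bad1 : Set Ω := {ω | ¬ ∀ p : ι → ℝ, ∑ j, (∑ i, p i * (val (X (i, j) ω) - r (k j) i)) ^ 2 ≤
      700 * Fintype.card (Fin d) * ∑ i, p i ^ 2} with hBad1
  set Bad2 : Fin 2 → Fin 2 → Set Ω := fun a b =>
    {ω | ¬ |∑ j ∈ Finset.univ.filter (fun j => k j = b),
      ⟪R a, respVec (fun i l => X (i, l) ω) j - R (k j)⟫| ≤ m * τ} with hBad2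
  set Bad3 : Fin d → Set Ω := fun j =>
    {ω | ¬ ∃ q, IsPrincipal (respVec fun i l => X (i, l) ω) (Finset.univ.erase j) q ∧
      |⟪respVec (fun i l => X (i, l) ω) j - R (k j), q⟫| ≤ τ} with hBad3
  have hsub : {ω | ¬ ∀ p, IsPrincipal (respVec fun i l => X (i, l) ω) Finset.univ p →
      ∃ (a : Fin 2 → ℝ) (e : ℝ), 0 < e ∧ 4 * e < a 0 - a 1 ∧
        ∀ j, |(|⟪respVec (fun i l => X (i, l) ω) j, p⟫|) - a (k j)| ≤ e} ⊆
      Bad1 ∪ ((⋃ a, ⋃ b, Bad2 a b) ∪ ⋃ j, Bad3 j) := by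
    intro ω hω
    by_contra hbad
    simp only [Set.mem_union, Set.mem_iUnion, not_or, not_exists] at hbad
    obtain ⟨h1, h2, h3⟩ := hbad
    apply hω
    intro p hp
    have h1' := not_not.1 h1
    refine IsPrincipal.separates (r := R) (C := 700) (τ := τ) (B := 12 * L) hm hk ?_
      (fun a b => not_not.1 (h2 a b)) ?_ ?_ (fun j => not_not.1 (h3 j)) hu hu0.le hδ hδ0
      (by rw [hRn, hRi]; exact e0) (by rw [hRn, hRi]; exact e1) (by rw [hRn, hRn]; exact htr)
      hAm hτ1 (by norm_num) hττ.le (by linarith) hgδ hp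
    · intro p
      have := h1' p
      rw [Fintype.card_fin, hd] at this
      have e : ∀ j, ⟪respVec (fun i l => X (i, l) ω) j - R (k j), p⟫ =
          ∑ i, p i * (val (X (i, j) ω) - r (k j) i) := fun j => by
        rw [inner_sub_left, inner_respVec]
        simp only [mul_sub, Finset.sum_sub_distrib, hR]
        simp [PiLp.inner_apply]
      simp only [e]
      refine this.trans (le_of_eq ?_)
      rw [EuclideanSpace.real_norm_sq_eq]; ring
    · intro j; rw [norm_respVec_sq]; exact hn'
    · intro a
      rw [hRn]
      refine le_trans (Finset.sum_le_sum (g := fun _ => (1 : ℝ)) fun i _ => ?_) ?_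
      · rw [← sq_abs]; exact pow_le_one₀ (abs_nonneg _) (hr a i)
      · simpa using hn'
  have hb1 : μ.real Bad1 ≤ 2 * Real.exp (-(2 * d)) := by
    have := hX.prob_opNorm_le hn0 (by simpa using hnd)
    rw [hBad1]
    simpa only [Fintype.card_fin] using this
  have hb2 : ∀ a b, μ.real (Bad2 a b) ≤ 2 * Real.exp (-(τ ^ 2 / 4)) := fun a b =>
    hX.prob_gram_le hm hk hr hn' a b hτ0
  have hb3 : ∀ j, μ.real (Bad3 j) ≤ 2 * Real.exp (-(τ ^ 2 / 2)) := fun j =>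
    hX.prob_leaveOneOut_le j hτ0
  have hd0 : (0 : ℝ) < d := by rw [hd]; linarith
  have hexp3 : Real.exp (-(τ ^ 2 / 4)) = 1 / (d : ℝ) ^ 3 := by
    rw [hττ, one_div, ← Real.exp_log (by positivity : (0 : ℝ) < (d : ℝ) ^ 3), ← Real.exp_neg,
      Real.log_pow]
    congr 1; push_cast; ring
  have hexp6 : Real.exp (-(τ ^ 2 / 2)) = 1 / (d : ℝ) ^ 6 := by
    rw [hττ, one_div, ← Real.exp_log (by positivity : (0 : ℝ) < (d : ℝ) ^ 6), ← Real.exp_neg,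
      Real.log_pow]
    congr 1; push_cast; ring
  have hd60 : 61 ≤ (d : ℝ) := by
    have := Real.add_one_le_exp L
    rw [hL, Real.exp_log hd0] at this
    linarith
  have hexpd : Real.exp (-(2 * (d : ℝ))) ≤ 1 / (d : ℝ) ^ 3 := by
    rw [← hexp3, hττ]
    apply Real.exp_le_exp.2
    have h1 : L ≤ d / 2 := by
      have h2 := Real.log_le_sub_one_of_pos (x := (d : ℝ) / 4) (by positivity)
      rw [Real.log_div hd0.ne' (by norm_num)] at h2
      have h3 : Real.log 4 ≤ 3 := by
        have := Real.log_le_sub_one_of_pos (x := 4) (by norm_num); linarith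
      linarith
    linarith
  have hb2' : μ.real (⋃ a, ⋃ b, Bad2 a b) ≤ 8 * (1 / (d : ℝ) ^ 3) := by
    refine (measureReal_iUnion_fintype_le _).trans ?_
    refine (Finset.sum_le_sum fun a _ => (measureReal_iUnion_fintype_le _).trans
      (Finset.sum_le_sum fun b _ => hb2 a b)).trans ?_
    rw [hexp3]; simp; ring_nf; exact le_rfl
  have hb3' : μ.real (⋃ j, Bad3 j) ≤ d * (2 * (1 / (d : ℝ) ^ 6)) := by
    refine (measureReal_iUnion_fintype_le _).trans ((Finset.sum_le_sum fun j _ => hb3 j).trans ?_)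
    rw [hexp6]; simp
  have htot := (measureReal_mono hsub (measure_ne_top _ _)).trans ((measureReal_union_le _ _).trans
    (add_le_add hb1 ((measureReal_union_le _ _).trans (add_le_add hb2' hb3'))))
  exact htot.trans (cluster_failure_le hd60 hexpd)

end ClusterProb

end Crowd

namespace Crowd

section Informativeness

variable {ι : Type*} [Fintype ι] {r : ι → ℝ}

theorem exists_pair_of_informativeness_pos (hV : 0 < informativeness r) (i : ι) :
    ∃ a b, a ≠ b ∧ a ≠ i ∧ b ≠ i ∧ informativeness r ^ 2 ≤ |r a * r b| := by
  have h1 : informativeness r ≤ ⨆ p : {p : ι × ι // p.1 ≠ p.2 ∧ p.1 ≠ i ∧ p.2 ≠ i},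
      Real.sqrt |r p.1.1 * r p.1.2| := ciInf_le (Set.finite_range _).bddBelow i
  rcases isEmpty_or_nonempty {p : ι × ι // p.1 ≠ p.2 ∧ p.1 ≠ i ∧ p.2 ≠ i} with h | h
  · rw [Real.iSup_of_isEmpty] at h1
    linarith
  · obtain ⟨⟨⟨a, b⟩, hab, ha, hb⟩, h2⟩ := exists_eq_ciSup_of_finite
      (f := fun p : {p : ι × ι // p.1 ≠ p.2 ∧ p.1 ≠ i ∧ p.2 ≠ i} => Real.sqrt |r p.1.1 * r p.1.2|)
    rw [← h2] at h1
    exact ⟨a, b, hab, ha, hb, (Real.le_sqrt hV.le (abs_nonneg _)).1 h1⟩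

theorem exists_worst_of_informativeness_pos (hV : 0 < informativeness r) :
    ∃ i, ∀ a b, a ≠ b → a ≠ i → b ≠ i → |r a * r b| ≤ informativeness r ^ 2 := by
  rcases isEmpty_or_nonempty ι with h | h
  · rw [informativeness, Real.iInf_of_isEmpty] at hV
    exact absurd hV (lt_irrefl _)
  · obtain ⟨i, hi⟩ := exists_eq_ciInf_of_finite (f := fun i : ι =>
      ⨆ p : {p : ι × ι // p.1 ≠ p.2 ∧ p.1 ≠ i ∧ p.2 ≠ i}, Real.sqrt |r p.1.1 * r p.1.2|)
    refine ⟨i, fun a b hab ha hb => ?_⟩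
    have h1 : Real.sqrt |r a * r b| ≤ informativeness r := by
      rw [informativeness, ← hi]
      exact le_ciSup (f := fun p : {p : ι × ι // p.1 ≠ p.2 ∧ p.1 ≠ i ∧ p.2 ≠ i} =>
        Real.sqrt |r p.1.1 * r p.1.2|) (Set.finite_range _).bddAbove ⟨(a, b), hab, ha, hb⟩
    exact (Real.sqrt_le_left hV.le).1 h1

theorem informativeness_le_one (hr : ∀ i, |r i| ≤ 1) (hV : 0 < informativeness r) :
    informativeness r ≤ 1 := by
  obtain ⟨i, -⟩ := exists_worst_of_informativeness_pos hV
  obtain ⟨a, b, -, -, -, h⟩ := exists_pair_of_informativeness_pos hV i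
  have : |r a * r b| ≤ 1 := by
    rw [abs_mul]; exact mul_le_one₀ (hr a) (abs_nonneg _) (hr b)
  nlinarith

/-- All workers but two have reliability at most `V`. -/
theorem exists_abs_le_informativeness (hV : 0 < informativeness r) :
    ∃ i a, i ≠ a ∧ ∀ b, b ≠ i → b ≠ a → |r b| ≤ informativeness r := by
  classical
  obtain ⟨i, hi⟩ := exists_worst_of_informativeness_pos hV
  obtain ⟨a', -, -, ha', -⟩ := exists_pair_of_informativeness_pos hV i
  obtain ⟨a, ha, hmax⟩ := Finset.exists_max_image (Finset.univ.erase i) (fun b => |r b|)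
    ⟨a', by simp [ha']⟩
  have hai : a ≠ i := (Finset.mem_erase.1 ha).1
  refine ⟨i, a, hai.symm, fun b hb hba => ?_⟩
  have h1 := hi a b hba.symm hai hb
  have h2 := hmax b (by simp [hb])
  rw [abs_mul] at h1
  have h3 : |r b| ^ 2 ≤ informativeness r ^ 2 := by
    refine le_trans ?_ h1
    rw [sq]; exact mul_le_mul_of_nonneg_right h2 (abs_nonneg _)
  exact (pow_le_pow_iff_left₀ (abs_nonneg _) hV.le two_ne_zero).1 h3

theorem one_le_card_mul_informativeness (hr : ∀ i, |r i| ≤ 1) (hV : 0 < informativeness r)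
    (hS : 3 ≤ ∑ i, r i) : 1 ≤ Fintype.card ι * informativeness r := by
  classical
  obtain ⟨i, a, hia, h⟩ := exists_abs_le_informativeness hV
  have h1 : ∑ b, r b ≤ ∑ b, (informativeness r + ((if b = i then 1 else 0) +
      (if b = a then 1 else 0))) := by
    refine Finset.sum_le_sum fun b _ => ?_
    have := le_abs_self (r b)
    by_cases hb : b = i
    · rw [if_pos hb]; split_ifs <;> linarith [hr b]
    · by_cases hb' : b = a
      · rw [if_neg hb, if_pos hb']; linarith [hr b]
      · rw [if_neg hb, if_neg hb']; linarith [h b hb hb']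
  simp [Finset.sum_add_distrib] at h1
  linarith

end Informativeness

section Renyi

variable {ι : Type*} [Fintype ι] {r : ι → ℝ}

theorem card_mul_renyi [Nonempty ι] : Fintype.card ι * renyi r = -(∑ i, Real.log (1 - r i ^ 2)) / 2 := by
  rw [renyi]
  have : (Fintype.card ι : ℝ) ≠ 0 := by exact_mod_cast Fintype.card_ne_zero
  field_simp

theorem sq_sum_le_card_mul_renyi [Nonempty ι] (hr : ∀ i, |r i| < 1) :
    (∑ i, r i) ^ 2 ≤ 2 * Fintype.card ι * (Fintype.card ι * renyi r) := by
  rw [card_mul_renyi]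
  have h1 : ∑ i, r i ^ 2 ≤ -(∑ i, Real.log (1 - r i ^ 2)) := by
    rw [← Finset.sum_neg_distrib]
    refine Finset.sum_le_sum fun i _ => ?_
    have h2 : r i ^ 2 < 1 := by
      rw [← sq_abs]; exact pow_lt_one₀ (abs_nonneg _) (hr i) two_ne_zero
    have := Real.log_le_sub_one_of_pos (x := 1 - r i ^ 2) (by linarith)
    linarith
  have h3 := sq_sum_le_card_mul_sum_sq (s := Finset.univ) (f := r)
  rw [Finset.card_univ] at h3
  refine h3.trans ?_
  have : (0 : ℝ) ≤ Fintype.card ι := Nat.cast_nonneg _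
  nlinarith

theorem two_mul_le_one_sub_sq {ρ x : ℝ} (hρ : 0 < ρ) (hρ' : ρ < 1 / 2) (h : |x| ≤ 1 - 2 * ρ) :
    2 * ρ ≤ 1 - x ^ 2 := by
  have : x ^ 2 ≤ (1 - 2 * ρ) ^ 2 := by
    rw [← sq_abs]; exact pow_le_pow_left₀ (abs_nonneg _) h 2
  nlinarith

theorem renyi_mul_le_informativeness [Nonempty ι] {ρ : ℝ} (hρ : 0 < ρ) (hρ' : ρ < 1 / 2)
    (hr : ∀ i, |r i| ≤ 1 - 2 * ρ) (hV : 0 < informativeness r) (hS : 3 ≤ ∑ i, r i) :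
    renyi r * ρ ≤ informativeness r := by
  classical
  have hr1 : ∀ i, |r i| ≤ 1 := fun i => (hr i).trans (by linarith)
  have hVn := one_le_card_mul_informativeness hr1 hV hS
  have hV1 := informativeness_le_one hr1 hV
  set V := informativeness r with hVdef
  set n : ℝ := (Fintype.card ι : ℝ) with hn
  have hn0 : 0 < n := by rw [hn]; exact_mod_cast Fintype.card_pos
  have hlog : ∀ i, -Real.log (1 - r i ^ 2) * ρ ≤ r i ^ 2 / 2 := by
    intro i
    have h1 := two_mul_le_one_sub_sq hρ hρ' (hr i)
    have h0 : 0 < 1 - r i ^ 2 := by linarith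
    have h2 := Real.one_sub_inv_le_log_of_pos h0
    have h3 : -Real.log (1 - r i ^ 2) ≤ r i ^ 2 / (1 - r i ^ 2) := by
      have : r i ^ 2 / (1 - r i ^ 2) = (1 - r i ^ 2)⁻¹ - 1 := by field_simp; ring
      rw [this]; linarith
    calc _ ≤ r i ^ 2 / (1 - r i ^ 2) * ρ := mul_le_mul_of_nonneg_right h3 hρ.le
      _ = r i ^ 2 * (ρ / (1 - r i ^ 2)) := by ring
      _ ≤ r i ^ 2 * (1 / 2) := by
        refine mul_le_mul_of_nonneg_left ?_ (sq_nonneg _)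
        rw [div_le_iff₀ h0]; linarith
      _ = _ := by ring
  obtain ⟨i, a, hia, h⟩ := exists_abs_le_informativeness hV
  have h1 : ∑ b, r b ^ 2 ≤ ∑ b, (V ^ 2 + ((if b = i then 1 else 0) +
      (if b = a then 1 else 0))) := by
    refine Finset.sum_le_sum fun b _ => ?_
    have hb1 : r b ^ 2 ≤ 1 := by rw [← sq_abs]; exact pow_le_one₀ (abs_nonneg _) (hr1 b)
    have hV2 := sq_nonneg V
    by_cases hb : b = i
    · rw [if_pos hb]; split_ifs <;> linarith
    · by_cases hb' : b = a
      · rw [if_neg hb, if_pos hb']; linarith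
      · rw [if_neg hb, if_neg hb']
        have := pow_le_pow_left₀ (abs_nonneg _) (h b hb hb') 2
        rw [sq_abs] at this; linarith
  simp only [Finset.sum_add_distrib, Finset.sum_const, Finset.card_univ, nsmul_eq_mul,
    Finset.sum_ite_eq', Finset.mem_univ, if_true, ← hn] at h1
  have h2 : n * renyi r * ρ ≤ (∑ b, r b ^ 2) / 4 := by
    rw [hn, card_mul_renyi]
    have := Finset.sum_le_sum fun i (_ : i ∈ Finset.univ) => hlog i
    rw [← Finset.sum_mul, Finset.sum_neg_distrib, ← Finset.sum_div] at this
    linarith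
  have h3 : n * (renyi r * ρ) ≤ n * V := by nlinarith
  exact le_of_mul_le_mul_left h3 hn0

theorem two_mul_le_exp_neg_renyi [Nonempty ι] {ρ : ℝ} (hρ : 0 < ρ) (hρ' : ρ < 1 / 2)
    (hr : ∀ i, |r i| ≤ 1 - 2 * ρ) : 2 * ρ ≤ Real.exp (-(2 * renyi r)) := by
  have h1 : ∀ i, -Real.log (1 - r i ^ 2) ≤ -Real.log (2 * ρ) := fun i =>
    neg_le_neg (Real.log_le_log (by linarith) (two_mul_le_one_sub_sq hρ hρ' (hr i)))
  have h2 := Finset.sum_le_sum fun i (_ : i ∈ Finset.univ) => h1 i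
  rw [Finset.sum_neg_distrib] at h2
  simp only [Finset.sum_const, Finset.card_univ, nsmul_eq_mul] at h2
  have hn0 : (0 : ℝ) < Fintype.card ι := by exact_mod_cast Fintype.card_pos
  have h3 : (Fintype.card ι : ℝ) * (2 * renyi r) ≤ Fintype.card ι * (-Real.log (2 * ρ)) := by
    rw [mul_left_comm, card_mul_renyi]; linarith
  have h4 := le_of_mul_le_mul_left h3 hn0
  rw [← Real.exp_log (by linarith : 0 < 2 * ρ)]
  exact Real.exp_le_exp.2 (by linarith)

end Renyi

section TriangularEstimation

theorem sq_teMagnitude_sub_le {ι : Type*} {C : ι → ι → ℝ} {r : ι → ℝ} {a b i : ι} {e c : ℝ}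
    (hra : |r a| ≤ 1) (hrb : |r b| ≤ 1) (hc : 0 < c) (hC : c ≤ |C a b|)
    (hai : |C a i - r a * r i| ≤ e) (hbi : |C b i - r b * r i| ≤ e)
    (hab : |C a b - r a * r b| ≤ e) :
    |teMagnitude C a b i ^ 2 - r i ^ 2| ≤ (2 * |r i| * e + e ^ 2 + r i ^ 2 * e) / c := by
  have hC0 : 0 < |C a b| := hc.trans_le hC
  have hCne : C a b ≠ 0 := abs_pos.1 hC0
  have he : 0 ≤ e := (abs_nonneg _).trans hab
  rw [teMagnitude, if_pos hC0, Real.sq_sqrt (abs_nonneg _)]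
  have h1 : |(|C a i * C b i / C a b| - r i ^ 2)| ≤ |C a i * C b i / C a b - r i ^ 2| := by
    have := abs_abs_sub_abs_le_abs_sub (C a i * C b i / C a b) (r i ^ 2)
    rwa [abs_of_nonneg (sq_nonneg (r i))] at this
  refine h1.trans ?_
  set e1 := C a i - r a * r i with he1
  set e2 := C b i - r b * r i with he2
  set e3 := C a b - r a * r b with he3
  have h2 : C a i * C b i / C a b - r i ^ 2 =
      (r i * (r a * e2 + r b * e1) + e1 * e2 - r i ^ 2 * e3) / C a b := by
    field_simp; rw [he1, he2, he3]; ring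
  rw [h2, abs_div]
  have h3 : |r i * (r a * e2 + r b * e1) + e1 * e2 - r i ^ 2 * e3| ≤
      2 * |r i| * e + e ^ 2 + r i ^ 2 * e := by
    have t1 : |r a * e2 + r b * e1| ≤ 2 * e := by
      refine (abs_add_le _ _).trans ?_
      rw [abs_mul, abs_mul]
      have := mul_le_mul hra hbi (abs_nonneg _) zero_le_one
      have := mul_le_mul hrb hai (abs_nonneg _) zero_le_one
      linarith
    have t2 : |e1 * e2| ≤ e ^ 2 := by
      rw [abs_mul, sq]; exact mul_le_mul hai hbi (abs_nonneg _) he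
    have t3 : |r i ^ 2 * e3| ≤ r i ^ 2 * e := by
      rw [abs_mul, abs_of_nonneg (sq_nonneg _)]
      exact mul_le_mul_of_nonneg_left hab (sq_nonneg _)
    have t4 : |r i * (r a * e2 + r b * e1)| ≤ |r i| * (2 * e) := by
      rw [abs_mul]; exact mul_le_mul_of_nonneg_left t1 (abs_nonneg _)
    calc _ ≤ |r i * (r a * e2 + r b * e1) + e1 * e2| + |r i ^ 2 * e3| := abs_sub _ _
      _ ≤ |r i * (r a * e2 + r b * e1)| + |e1 * e2| + |r i ^ 2 * e3| := by
        linarith [abs_add_le (r i * (r a * e2 + r b * e1)) (e1 * e2)]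
      _ ≤ _ := by linarith
  exact div_le_div₀ (by positivity) h3 hc hC

theorem abs_sub_le_of_sq_sub_le {x m η : ℝ} (hx : 0 ≤ x) (hm : 0 ≤ m) (hη : 0 ≤ η)
    (h : |m ^ 2 - x ^ 2| ≤ 3.2 * η * (x + η)) : |m - x| ≤ 6.4 * η := by
  rw [abs_le] at h ⊢
  rcases le_total η x with hc | hc
  · constructor <;> nlinarith
  · constructor <;> nlinarith

theorem sign_mul_sub_le {z x m e : ℝ} (hz : 0 < z * x) (h : |m - (|x|)| ≤ e) :
    |Real.sign z * m - x| ≤ e := by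
  rcases pos_and_pos_or_neg_and_neg_of_mul_pos hz with ⟨h1, h2⟩ | ⟨h1, h2⟩
  · rw [Real.sign_of_pos h1, one_mul]; rwa [abs_of_pos h2] at h
  · rw [Real.sign_of_neg h1, ← abs_neg]; rw [abs_of_neg h2] at h
    convert h using 2; ring

variable {ι : Type*} [Fintype ι] [DecidableEq ι] {C : ι → ι → ℝ} {r rh : ι → ℝ} {s η σ : ℝ}

/-- Deterministic analysis of Triangular Estimation: uniform accuracy of the covariances and of the
sign statistics implies uniform accuracy of the estimates. -/
theorem IsTEEstimate.accurate (h : IsTEEstimate C rh) (hr : ∀ i, |r i| ≤ 1)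
    (hV : 0 < informativeness r) (hC : ∀ a b, a ≠ b → |C a b - r a * r b| ≤ s)
    (hs : s ≤ η * informativeness r ^ 2) (hη : 0 ≤ η) (hηV : 100 * η ≤ informativeness r)
    (hS : 3 ≤ ∑ i, r i)
    (hsign : ∀ i, |∑ l ∈ Finset.univ.erase i, C l i - r i * ∑ l ∈ Finset.univ.erase i, r l| ≤ σ)
    (hσ : σ ≤ informativeness r * (∑ i, r i) / 10) :
    ∃ a b : ι → ι, (∀ i, a i ≠ b i ∧ a i ≠ i ∧ b i ≠ i ∧
        ∀ a' b', a' ≠ b' → a' ≠ i → b' ≠ i → |C a' b'| ≤ |C (a i) (b i)|) ∧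
      ∀ i, |rh i - r i| ≤ 11 * η ∧
        (2 * η < |r i| → |rh i| = teMagnitude C (a i) (b i) i) := by
  obtain ⟨a, b, m, t, hab, hm, hmax, ht, hrh⟩ := h
  set V := informativeness r with hVdef
  have hV1 : V ≤ 1 := informativeness_le_one hr hV
  set S := ∑ i, r i with hSdef
  have hs0 : 0 ≤ s := (abs_nonneg _).trans (hC _ _ (hab t).1)
  have hsη : s ≤ η := hs.trans (mul_le_of_le_one_right hη (by nlinarith))
  have hm0 : ∀ i, 0 ≤ m i := fun i => by
    rw [hm, teMagnitude]; split_ifs; exacts [Real.sqrt_nonneg _, le_rfl]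
  have hη1 : η ≤ 1 / 100 := by linarith
  have hV2 : 0 < V ^ 2 := by positivity
  have hsq : ∀ i, |m i ^ 2 - r i ^ 2| ≤ 3.2 * η * (|r i| + η) := by
    intro i
    obtain ⟨h1, h2, h3, h4⟩ := hab i
    obtain ⟨a', b', h5, h6, h7, h8⟩ := exists_pair_of_informativeness_pos hV i
    have h9 : V ^ 2 - s ≤ |C (a i) (b i)| := by
      refine le_trans ?_ (h4 a' b' h5 h6 h7)
      have t1 := hC a' b' h5
      have t2 := abs_sub_abs_le_abs_sub (r a' * r b') (C a' b')
      rw [abs_sub_comm] at t2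
      linarith
    have hc : 0 < 0.99 * V ^ 2 := by positivity
    have hc' : 0.99 * V ^ 2 ≤ |C (a i) (b i)| := by nlinarith
    have h10 := sq_teMagnitude_sub_le (hr (a i)) (hr (b i)) hc hc' (hC _ _ h2) (hC _ _ h3)
      (hC _ _ h1)
    rw [← hm] at h10
    refine h10.trans ?_
    rw [div_le_iff₀ hc]
    have hri := hr i
    have hri0 := abs_nonneg (r i)
    have h11 : r i ^ 2 ≤ |r i| := by rw [← sq_abs]; nlinarith
    have h12 : 2 * |r i| * s + s ^ 2 + r i ^ 2 * s ≤ s * (3 * |r i| + η) := by nlinarith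
    have h13 : s * (3 * |r i| + η) ≤ η * V ^ 2 * (3 * |r i| + η) :=
      mul_le_mul_of_nonneg_right hs (by positivity)
    have h14 : 0 ≤ η * V ^ 2 * |r i| := by positivity
    have h15 : 0 ≤ η * V ^ 2 * η := by positivity
    nlinarith
  have hmag : ∀ i, |m i - (|r i|)| ≤ 6.4 * η := fun i => by
    refine abs_sub_le_of_sq_sub_le (abs_nonneg _) (hm0 i) hη ?_
    rw [sq_abs]; exact hsq i
  set Z : ι → ℝ := fun i => teSignStat C (m i) i with hZ
  have hstat : ∀ i, |Z i - r i * S| ≤ V * S / 8 := by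
    intro i
    have h1 : Z i - r i * S = (m i ^ 2 - r i ^ 2) +
        (∑ l ∈ Finset.univ.erase i, C l i - r i * ∑ l ∈ Finset.univ.erase i, r l) := by
      have h2 : S = r i + ∑ l ∈ Finset.univ.erase i, r l :=
        (Finset.add_sum_erase Finset.univ r (Finset.mem_univ i)).symm
      have h3 : Finset.univ.filter (fun l => l ≠ i) = Finset.univ.erase i := by
        ext l; simp
      have h4 : Z i = m i ^ 2 + ∑ l ∈ Finset.univ.erase i, C l i := by
        rw [← h3, hZ]; simp only [teSignStat]; congr!
      rw [h4, h2]; ring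
    rw [h1]
    refine (abs_add_le _ _).trans ?_
    have h5 : 3.2 * η * (|r i| + η) ≤ 3.2 * η * (1 + 1 / 100) := by
      gcongr; exact hr i
    have h6 : V * 3 ≤ V * S := mul_le_mul_of_nonneg_left hS hV.le
    linarith [hsq i, hsign i]
  have hVS : 0 < V * S := mul_pos hV (by linarith)
  have hZt : V * S * (7 / 8) ≤ |Z t| := by
    obtain ⟨a', b', -, -, -, h8⟩ := exists_pair_of_informativeness_pos hV t
    have h9 : ∃ i, V ≤ |r i| := by
      by_contra hcon
      push Not at hcon
      rw [abs_mul] at h8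
      have := mul_lt_mul'' (hcon a') (hcon b') (abs_nonneg _) (abs_nonneg _)
      nlinarith
    obtain ⟨i, hi⟩ := h9
    refine le_trans ?_ (hmax i)
    have h10 := abs_sub_abs_le_abs_sub (r i * S) (Z i)
    rw [abs_sub_comm] at h10
    have h11 : V * S ≤ |r i * S| := by
      rw [abs_mul, abs_of_pos (by linarith : 0 < S)]
      exact mul_le_mul_of_nonneg_right hi (by linarith)
    have := hstat i
    change _ ≤ |Z i|
    linarith
  have hrt : 3 / 4 * V ≤ |r t| := by
    have h10 := abs_sub_abs_le_abs_sub (Z t) (r t * S)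
    have := hstat t
    rw [abs_mul, abs_of_pos (by linarith : 0 < S)] at h10
    have h12 : 3 / 4 * V * S ≤ |r t| * S := by linarith
    exact le_of_mul_le_mul_right h12 (by linarith)
  have hsame : 0 < Z t * r t := by
    have h1 : |Z t - r t * S| < |Z t| := by linarith [hstat t]
    have h2 : 0 < Z t * (r t * S) := by
      by_contra hcon
      have : Z t * (r t * S) ≤ 0 := not_lt.1 hcon
      have := sq_lt_sq.2 h1
      nlinarith [sq_nonneg (r t * S)]
    have : 0 < (Z t * r t) * S := by linarith
    exact (mul_pos_iff_of_pos_right (by linarith)).1 this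
  have hrt0 : 0 < |r t| := by linarith [mul_pos (by norm_num : (0 : ℝ) < 3 / 4) hV]
  have hht : |rh t - r t| ≤ 6.4 * η := by
    rw [ht]; exact sign_mul_sub_le hsame (hmag t)
  have hmt : 0 < m t := by
    have := (abs_le.1 (hmag t)).1
    linarith
  have hpos_t : 0 < rh t * r t := by
    rw [ht]
    have : 0 < Real.sign (Z t) * r t := by
      rcases pos_and_pos_or_neg_and_neg_of_mul_pos hsame with ⟨h1, h2⟩ | ⟨h1, h2⟩
      · rw [Real.sign_of_pos h1]; linarith
      · rw [Real.sign_of_neg h1]; linarith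
    calc 0 < m t * (Real.sign (Z t) * r t) := mul_pos hmt this
      _ = _ := by ring
  refine ⟨a, b, hab, fun i => ?_⟩
  rw [← hm]
  have habs : ∀ z, z * r i > 0 → |Real.sign z * m i| = m i := by
    intro z hz
    rcases pos_and_pos_or_neg_and_neg_of_mul_pos hz with ⟨h1, -⟩ | ⟨h1, -⟩
    · rw [Real.sign_of_pos h1, one_mul, abs_of_nonneg (hm0 i)]
    · rw [Real.sign_of_neg h1, neg_one_mul, abs_neg, abs_of_nonneg (hm0 i)]
  rcases eq_or_ne i t with rfl | hit
  · exact ⟨hht.trans (by linarith), fun _ => by rw [ht]; exact habs _ hsame⟩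
  · have hCit := hC i t hit
    rcases lt_or_ge s |r i * r t| with hbig | hsmall
    · have h1 : 0 < C i t * (r i * r t) := by
        by_contra hcon
        have h2 := sq_lt_sq.2 (hCit.trans_lt hbig)
        nlinarith [sq_nonneg (C i t), not_lt.1 hcon]
      have h2 : 0 < rh t * C i t * r i := by
        have h3 : 0 < (rh t * r t) * (C i t * (r i * r t)) := mul_pos hpos_t h1
        have h4 : (rh t * r t) * (C i t * (r i * r t)) = (rh t * C i t * r i) * |r t| ^ 2 := by
          rw [sq_abs]; ring
        rw [h4] at h3
        exact (mul_pos_iff_of_pos_right (by positivity)).1 h3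
      rw [hrh i hit]
      exact ⟨(sign_mul_sub_le h2 (hmag i)).trans (by linarith), fun _ => habs _ h2⟩
    · have h1 : |r i| ≤ 4 / 3 * η := by
        rw [abs_mul] at hsmall
        have h2 : |r i| * (3 / 4 * V) ≤ η * V ^ 2 :=
          (mul_le_mul_of_nonneg_left hrt (abs_nonneg _)).trans (hsmall.trans hs)
        have h3 : |r i| * (3 / 4 * V) ≤ (η * V) * V := by linarith
        have h4 : η * V ≤ η := mul_le_of_le_one_right hη hV1
        nlinarith
      refine ⟨?_, fun h2 => absurd h2 (by linarith)⟩
      have h2 : |rh i| ≤ m i := by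
        rw [hrh i hit, abs_mul, abs_of_nonneg (hm0 i)]
        exact mul_le_of_le_one_left (hm0 i) (abs_sign_le_one _)
      have h3 := (abs_le.1 (hmag i)).2
      linarith [abs_sub (rh i) (r i)]

end TriangularEstimation

end Crowd

namespace Crowd

namespace IsSignFamily

set_option linter.unusedSectionVars false

variable {ι κ Ω : Type*} [Fintype ι] [Fintype κ] [DecidableEq ι] [DecidableEq κ] [MeasurableSpace Ω]
  {μ : Measure Ω} [IsProbabilityMeasure μ] {X : ι × κ → Ω → ℤˣ} {m : ι × κ → ℝ}

theorem measurable_row (hX : IsSignFamily μ X m) (a : ι) : Measurable fun ω j => X (a, j) ω :=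
  measurable_pi_lambda _ fun _ => hX.measurable _

theorem measurable_rows (hX : IsSignFamily μ X m) (a : ι) :
    Measurable fun ω i j => if i = a then 1 else X (i, j) ω := by
  refine measurable_pi_lambda _ fun i => measurable_pi_lambda _ fun j => ?_
  by_cases h : i = a
  · simp [h]
  · simpa [h] using hX.measurable (i, j)

/-- A row of a sign matrix is independent of the other rows. -/
theorem indepFun_row (hX : IsSignFamily μ X m) (a : ι) :
    IndepFun (fun ω j => X (a, j) ω) (fun ω i j => if i = a then 1 else X (i, j) ω) μ := by
  classical
  set S : Finset (ι × κ) := {a} ×ˢ Finset.univ with hS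
  set T : Finset (ι × κ) := (Finset.univ.erase a) ×ˢ Finset.univ with hT
  exact hX.indepFun_restrict S T (by
      rw [Finset.disjoint_left]
      rintro ⟨i, l⟩ h1 h2
      simp [hS, hT] at h1 h2
      exact h2 h1.symm)
    (fun f (j : κ) => f ⟨(a, j), by simp [hS]⟩)
    (fun f (i : ι) (j : κ) => if h : i = a then 1 else f ⟨(i, j), by simp [hT, h]⟩)

variable {r : ι → ℝ} {J : Finset κ}

theorem sum_val_mul_sub {a b : ι} (hJ : 0 < J.card) (ω : Ω) :
    (J.card : ℝ) * |(∑ j ∈ J, val (X (a, j) ω) * val (X (b, j) ω)) / J.card - r a * r b| =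
      |∑ j ∈ J, (val (X (a, j) ω * X (b, j) ω) - r a * r b)| := by
  have hJ' : (0 : ℝ) < J.card := by exact_mod_cast hJ
  rw [← abs_of_pos hJ', ← abs_mul, abs_of_pos hJ']
  congr 1
  rw [Finset.sum_sub_distrib, Finset.sum_const, nsmul_eq_mul, mul_sub]
  simp only [val_mul]
  field_simp

theorem prob_cov_le (hX : IsSignFamily μ X m) (hJ : 0 < J.card)
    (hm : ∀ i, ∀ j ∈ J, m (i, j) = r i) {a b : ι} (hab : a ≠ b) {s : ℝ} (hs : 0 ≤ s) :
    μ.real {ω | s < |(∑ j ∈ J, val (X (a, j) ω) * val (X (b, j) ω)) / J.card - r a * r b|} ≤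
      2 * Real.exp (-(J.card * s ^ 2 / 2)) := by
  have hJ' : (0 : ℝ) < J.card := by exact_mod_cast hJ
  have h1 := (hX.mul_rows hab).hoeffding J (fun _ => 1) (v := J.card) (t := J.card * s)
    (by simp) hJ' (by positivity)
  have h2 : (J.card * s) ^ 2 / (2 * J.card) = (J.card : ℝ) * s ^ 2 / 2 := by field_simp
  rw [h2] at h1
  refine le_trans (measureReal_mono ?_ (measure_ne_top _ _)) h1
  intro ω hω
  simp only [Set.mem_ofPred_eq] at hω ⊢
  have h3 := mul_le_mul_of_nonneg_left hω.le hJ'.le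
  rw [sum_val_mul_sub hJ] at h3
  refine h3.trans (le_of_eq ?_)
  congr 1
  exact Finset.sum_congr rfl fun j hj => by rw [hm a j hj, hm b j hj, one_mul]

theorem neg (hX : IsSignFamily μ X m) :
    IsSignFamily μ (fun p ω => -X p ω) (fun p => -m p) := by
  refine ⟨fun p => ?_, hX.indep.comp (fun _ x => -x) fun _ => Measurable.of_discrete, fun p => ?_⟩
  · exact (Measurable.of_discrete (f := fun x : ℤˣ => -x)).comp (hX.measurable p)
  · have : {ω | -X p ω = 1} = {ω | X p ω = -1} := by
      ext ω
      simp only [Set.mem_ofPred_eq]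
      exact neg_eq_iff_eq_neg
    rw [this, hX.prob_neg]; ring

/-- The accuracy of a covariance close to `±1` is better than that of a general one. -/
theorem prob_cov_le_of_extreme (hX : IsSignFamily μ X m) (hJ : 0 < J.card)
    (hm : ∀ i, ∀ j ∈ J, m (i, j) = r i) {a b : ι} (hab : a ≠ b) (hr : ∀ i, |r i| ≤ 1)
    {l : ℝ} (hl : 0 < l) :
    μ.real {ω | 4 * Real.sqrt ((1 - |r a * r b|) / 2 * l) + 8 * l <
        |(∑ j ∈ J, val (X (a, j) ω) * val (X (b, j) ω)) / J.card - r a * r b|} ≤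
      2 * Real.exp (-(l * J.card)) := by
  have hJ' : (0 : ℝ) < J.card := by exact_mod_cast hJ
  have hle : |r a * r b| ≤ 1 := by
    rw [abs_mul]; exact mul_le_one₀ (hr a) (abs_nonneg _) (hr b)
  have hfam := hX.mul_rows hab
  have hmm : ∀ j ∈ J, m (a, j) * m (b, j) = r a * r b := fun j hj => by rw [hm a j hj, hm b j hj]
  rcases abs_cases (r a * r b) with ⟨h, -⟩ | ⟨h, -⟩
  · rw [h] at hle ⊢
    refine le_trans (measureReal_mono ?_ (measure_ne_top _ _)) (hfam.bernstein J hmm hle hl)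
    intro ω hω
    simp only [Set.mem_ofPred_eq] at hω ⊢
    rw [← sum_val_mul_sub hJ, mul_comm]
    exact mul_le_mul_of_nonneg_left hω.le hJ'.le
  · rw [h] at hle ⊢
    have hfam' : IsSignFamily μ (fun j ω => -(X (a, j) ω * X (b, j) ω))
        (fun j => -(m (a, j) * m (b, j))) := by
      have h0 := hfam.precomp (g := fun p : Unit × κ => p.2) fun p q h => Prod.ext rfl h
      exact h0.neg.precomp (g := fun j : κ => ((), j)) fun _ _ h => (Prod.mk.inj h).2
    refine le_trans (measureReal_mono ?_ (measure_ne_top _ _))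
      (hfam'.bernstein J (fun j hj => by rw [hmm j hj]) hle hl)
    intro ω hω
    simp only [Set.mem_ofPred_eq] at hω ⊢
    have e : |∑ j ∈ J, (val (-(X (a, j) ω * X (b, j) ω)) - -(r a * r b))| =
        |∑ j ∈ J, (val (X (a, j) ω * X (b, j) ω) - r a * r b)| := by
      rw [← abs_neg (∑ j ∈ J, (val (X (a, j) ω * X (b, j) ω) - r a * r b)),
        ← Finset.sum_neg_distrib]
      congr 1
      refine Finset.sum_congr rfl fun j _ => ?_
      simp [val]; ring
    rw [e, ← sum_val_mul_sub hJ, mul_comm]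
    exact mul_le_mul_of_nonneg_left hω.le hJ'.le

theorem prob_signStat_le (hX : IsSignFamily μ X m) (hJ : 0 < J.card)
    (hm : ∀ i, ∀ j ∈ J, m (i, j) = r i) (i : ι) {s : ℝ} (hs : 0 ≤ s) :
    μ.real {ω | s * Real.sqrt (Fintype.card ι) + s * |∑ l ∈ Finset.univ.erase i, r l| <
        |∑ l ∈ Finset.univ.erase i, (∑ j ∈ J, val (X (l, j) ω) * val (X (i, j) ω)) / J.card -
          r i * ∑ l ∈ Finset.univ.erase i, r l|} ≤
      4 * Real.exp (-(J.card * s ^ 2 / 2)) := by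
  have hJ' : (0 : ℝ) < J.card := by exact_mod_cast hJ
  set n : ℝ := (Fintype.card ι : ℝ) with hn
  have hn0 : 0 < n := by
    have : Nonempty ι := ⟨i⟩
    rw [hn]; exact_mod_cast Fintype.card_pos
  set R := ∑ l ∈ Finset.univ.erase i, r l with hR
  set F : (κ → ℤˣ) → (ι → κ → ℤˣ) → ℝ := fun x M =>
    ∑ j ∈ J, ∑ l ∈ Finset.univ.erase i, val (x j) * (val (M l j) - r l) with hF
  have h1 : μ.real {ω | J.card * (s * Real.sqrt n) ≤
      |F (fun j => X (i, j) ω) (fun l j => if l = i then 1 else X (l, j) ω)|} ≤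
      2 * Real.exp (-(J.card * s ^ 2 / 2)) := by
    refine measureReal_le_of_indepFun (hX.measurable_row i) (hX.indepFun_row i).symm
      (fun M x => J.card * (s * Real.sqrt n) ≤ |F x M|) fun x => ?_
    have h2 := hX.hoeffding (Finset.univ.erase i ×ˢ J) (fun p => val (x p.2)) (v := n * J.card)
      (t := J.card * (s * Real.sqrt n)) (by
        simp only [val_sq, Finset.sum_const, Finset.card_product, nsmul_eq_mul, mul_one]
        push_cast
        refine mul_le_mul_of_nonneg_right ?_ hJ'.le
        rw [hn]; exact_mod_cast Finset.card_le_univ _) (by positivity) (by positivity)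
    have h3 : (J.card * (s * Real.sqrt n)) ^ 2 / (2 * (n * J.card)) = J.card * s ^ 2 / 2 := by
      rw [mul_pow, mul_pow, Real.sq_sqrt hn0.le]; field_simp
    rw [h3] at h2
    refine le_trans (measureReal_mono ?_ (measure_ne_top _ _)) h2
    intro ω hω
    simp only [Set.mem_ofPred_eq, hF] at hω ⊢
    refine hω.trans (le_of_eq ?_)
    congr 1
    rw [Finset.sum_product_right]
    refine Finset.sum_congr rfl fun j hj => Finset.sum_congr rfl fun l hl => ?_
    rw [if_neg (Finset.mem_erase.1 hl).1, hm l j hj]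
  have h4 := (hX.precomp (g := fun j : κ => (i, j)) fun _ _ h => (Prod.mk.inj h).2).hoeffding J
    (fun _ => 1) (v := J.card) (t := J.card * s) (by simp) hJ' (by positivity)
  have h5 : (J.card * s) ^ 2 / (2 * J.card) = (J.card : ℝ) * s ^ 2 / 2 := by field_simp
  rw [h5] at h4
  refine le_trans (measureReal_mono (s₂ := {ω | J.card * (s * Real.sqrt n) ≤
      |F (fun j => X (i, j) ω) (fun l j => if l = i then 1 else X (l, j) ω)|} ∪
      {ω | J.card * s ≤ |∑ j ∈ J, 1 * (val (X (i, j) ω) - m (i, j))|}) ?_ (measure_ne_top _ _))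
    ((measureReal_union_le _ _).trans ((add_le_add h1 h4).trans (by linarith)))
  intro ω hω
  by_contra hcon
  simp only [Set.mem_ofPred_eq, Set.mem_union, not_or, not_le, one_mul] at hω hcon
  obtain ⟨c1, c2⟩ := hcon
  set G := ∑ j ∈ J, (val (X (i, j) ω) - m (i, j)) with hG
  set F0 := F (fun j => X (i, j) ω) (fun l j => if l = i then 1 else X (l, j) ω) with hF0
  have key : (J.card : ℝ) * (∑ l ∈ Finset.univ.erase i,
      (∑ j ∈ J, val (X (l, j) ω) * val (X (i, j) ω)) / J.card - r i * R) = F0 + R * G := by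
    have e1 : F0 = ∑ l ∈ Finset.univ.erase i, ∑ j ∈ J,
        (val (X (l, j) ω) * val (X (i, j) ω) - r l * val (X (i, j) ω)) := by
      rw [Finset.sum_comm]
      refine Finset.sum_congr rfl fun j hj => Finset.sum_congr rfl fun l hl => ?_
      simp only [if_neg (Finset.mem_erase.1 hl).1]; ring
    have e2 : G = ∑ j ∈ J, val (X (i, j) ω) - J.card * r i := by
      rw [hG, Finset.sum_sub_distrib, Finset.sum_congr rfl fun j hj => hm i j hj]
      simp
    rw [e1, e2]
    simp only [Finset.sum_sub_distrib, ← Finset.mul_sum, ← Finset.sum_mul, ← Finset.sum_div]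
    rw [← hR]
    field_simp
    ring
  have h6 : J.card * |∑ l ∈ Finset.univ.erase i,
      (∑ j ∈ J, val (X (l, j) ω) * val (X (i, j) ω)) / J.card - r i * R| ≤
      J.card * (s * Real.sqrt n + s * |R|) := by
    rw [← abs_of_pos hJ', ← abs_mul, abs_of_pos hJ', key]
    refine (abs_add_le _ _).trans ?_
    rw [abs_mul]
    have := mul_le_mul_of_nonneg_left c2.le (abs_nonneg R)
    linarith
  exact absurd (le_of_mul_le_mul_left h6 hJ') (not_le.2 hω)

/-- A weighted sum of independent signs rarely takes a given value. -/
theorem prob_row_sum_eq_le (hX : IsSignFamily μ X m) (hJ : 0 < J.card)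
    (hm : ∀ i, ∀ j ∈ J, m (i, j) = r i) {ρ : ℝ} (hρ : 0 < ρ) (hρ' : ρ < 1 / 2)
    (hr : ∀ i, |r i| ≤ 1 - 2 * ρ) (a : ι) (c : κ → ℝ) (hc : ∀ j ∈ J, c j ≠ 0) (v : ℝ) :
    μ.real {ω | ∑ j ∈ J, c j * val (X (a, j) ω) = v} ≤ 2 / Real.sqrt (2 * ρ * J.card) := by
  have hJ' : (0 : ℝ) < J.card := by exact_mod_cast hJ
  have h1 := (hX.precomp (g := fun j : κ => (a, j))
    fun _ _ h => (Prod.mk.inj h).2).prob_sum_eq_sq_mul_le J c hc v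
  set P := μ.real {ω | ∑ j ∈ J, c j * val (X (a, j) ω) = v} with hP
  have h2 : 2 * ρ * J.card ≤ ∑ j ∈ J, (1 - m (a, j) ^ 2) := by
    rw [mul_comm, ← nsmul_eq_mul, ← Finset.sum_const]
    refine Finset.sum_le_sum fun j hj => ?_
    rw [hm a j hj]; exact two_mul_le_one_sub_sq hρ hρ' (hr a)
  have h3 : P ^ 2 * (2 * ρ * J.card) ≤ 4 :=
    (mul_le_mul_of_nonneg_left h2 (sq_nonneg _)).trans h1
  have h4 : 0 < Real.sqrt (2 * ρ * J.card) := Real.sqrt_pos.2 (by positivity)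
  rw [le_div_iff₀ h4]
  refine abs_le_of_sq_le_sq' ?_ (by norm_num) |>.2
  rw [mul_pow, Real.sq_sqrt (by positivity)]
  linarith

/-- Triangular Estimation rarely returns a reliability of absolute value one. -/
theorem prob_teMagnitude_eq_one_le (hX : IsSignFamily μ X m) (hJ : 0 < J.card)
    (hm : ∀ i, ∀ j ∈ J, m (i, j) = r i) {ρ : ℝ} (hρ : 0 < ρ) (hρ' : ρ < 1 / 2)
    (hr : ∀ i, |r i| ≤ 1 - 2 * ρ) {a b i : ι} (hab : a ≠ b) (hai : a ≠ i) (hbi : b ≠ i) :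
    μ.real {ω | teMagnitude (fun a b => (∑ j ∈ J, val (X (a, j) ω) * val (X (b, j) ω)) / J.card)
      a b i = 1} ≤ 8 / Real.sqrt (2 * ρ * J.card) := by
  have hJ' : (0 : ℝ) < J.card := by exact_mod_cast hJ
  set β := 2 / Real.sqrt (2 * ρ * J.card) with hβ
  have hβ0 : 0 ≤ β := by positivity
  set S : Ω → ι → ι → ℝ := fun ω a b => ∑ j ∈ J, val (X (a, j) ω) * val (X (b, j) ω) with hS
  have h1 : ∀ v : ℝ, μ.real {ω | S ω b i = v} ≤ β := by
    intro v
    have h2 := measureReal_le_of_indepFun (hX.measurable_rows b) (hX.indepFun_row b)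
      (fun x M => ∑ j ∈ J, val (M i j) * val (x j) = v) (δ := β) fun M =>
        hX.prob_row_sum_eq_le hJ hm hρ hρ' hr b (fun j => val (M i j))
          (fun j _ h => by have := val_sq (M i j); rw [h] at this; norm_num at this) v
    refine le_trans (measureReal_mono ?_ (measure_ne_top _ _)) h2
    intro ω hω
    simp only [Set.mem_ofPred_eq, hS] at hω ⊢
    rw [← hω]
    refine Finset.sum_congr rfl fun j _ => ?_
    rw [if_neg hbi.symm, mul_comm]
  have h2 : ∀ t : ℝ, |t| = 1 → μ.real {ω | |S ω b i| < J.card ∧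
      S ω a i * S ω b i = t * (J.card * S ω a b)} ≤ β := by
    intro t ht
    have h3 := measureReal_le_of_indepFun (hX.measurable_rows a) (hX.indepFun_row a)
      (fun x M => |∑ j ∈ J, val (M b j) * val (M i j)| < J.card ∧
        ∑ j ∈ J, (val (M i j) * (∑ j ∈ J, val (M b j) * val (M i j)) -
          t * J.card * val (M b j)) * val (x j) = 0) (δ := β) fun M => by
        by_cases hM : |∑ j ∈ J, val (M b j) * val (M i j)| < J.card
        · simp only [hM, true_and]
          refine hX.prob_row_sum_eq_le hJ hm hρ hρ' hr a _ (fun j _ h => ?_) 0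
          have h4 : |val (M i j) * (∑ j ∈ J, val (M b j) * val (M i j))| =
              |t * J.card * val (M b j)| := by rw [sub_eq_zero.1 h]
          rw [abs_mul, abs_mul, abs_mul, abs_val, abs_val, ht, abs_of_pos hJ', one_mul, one_mul,
            mul_one] at h4
          exact hM.ne h4
        · simp [hM, hβ0]
    refine le_trans (measureReal_mono ?_ (measure_ne_top _ _)) h3
    intro ω hω
    simp only [Set.mem_ofPred_eq, if_neg hab.symm, if_neg hai.symm] at hω ⊢
    refine ⟨hω.1, ?_⟩
    have h5 := hω.2
    simp only [sub_mul, Finset.sum_sub_distrib]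
    rw [sub_eq_zero]
    calc _ = S ω a i * S ω b i := by
          simp only [hS]
          rw [Finset.sum_mul]
          exact Finset.sum_congr rfl fun j _ => by ring
      _ = _ := h5
      _ = _ := by
          simp only [hS]
          rw [Finset.mul_sum, Finset.mul_sum]
          exact Finset.sum_congr rfl fun j _ => by ring
  have hsub : {ω | teMagnitude (fun a b => (∑ j ∈ J, val (X (a, j) ω) * val (X (b, j) ω)) / J.card)
      a b i = 1} ⊆ ({ω | S ω b i = J.card} ∪ {ω | S ω b i = -J.card}) ∪
      ({ω | |S ω b i| < J.card ∧ S ω a i * S ω b i = 1 * (J.card * S ω a b)} ∪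
       {ω | |S ω b i| < J.card ∧ S ω a i * S ω b i = -1 * (J.card * S ω a b)}) := by
    intro ω hω
    simp only [Set.mem_ofPred_eq, teMagnitude] at hω
    split_ifs at hω with h0
    · have h3 : |S ω a i / J.card * (S ω b i / J.card) / (S ω a b / J.card)| = 1 := by
        rw [← Real.sq_sqrt (abs_nonneg _)]
        rw [hω]; norm_num
      have hab0 : S ω a b ≠ 0 := by
        intro h; simp only [hS] at h; rw [h] at h0; simp at h0
      have h4 : |S ω a i * S ω b i| = |J.card * S ω a b| := by
        have : S ω a i / J.card * (S ω b i / J.card) / (S ω a b / J.card) =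
            (S ω a i * S ω b i) / (J.card * S ω a b) := by field_simp
        rw [this, abs_div, div_eq_one_iff_eq (by positivity)] at h3
        exact h3
      have h5 : |S ω b i| ≤ J.card := by
        refine (Finset.abs_sum_le_sum_abs _ _).trans ?_
        simp [abs_mul, abs_val]
      rcases h5.lt_or_eq with h6 | h6
      · right
        rcases abs_eq_abs.1 h4 with h | h
        · left; exact ⟨h6, by rw [h, one_mul]⟩
        · right; exact ⟨h6, by rw [h]; ring⟩
      · left
        rcases abs_cases (S ω b i) with ⟨h, -⟩ | ⟨h, -⟩
        · left; show S ω b i = _; rw [← h, h6]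
        · right; show S ω b i = _; linarith
    · norm_num at hω
  refine (measureReal_mono hsub (measure_ne_top _ _)).trans ?_
  refine (measureReal_union_le _ _).trans ((add_le_add (measureReal_union_le _ _)
    (measureReal_union_le _ _)).trans ?_)
  have : 8 / Real.sqrt (2 * ρ * J.card) = 4 * β := by rw [hβ]; ring
  rw [this]
  linarith [h1 J.card, h1 (-J.card), h2 1 (by norm_num), h2 (-1) (by norm_num)]

end IsSignFamily

end Crowd

namespace Crowd

section Weights

theorem abs_log_sub_log_le {u v c : ℝ} (hc : 0 < c) (hu : c ≤ u) (hv : c ≤ v) :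
    |Real.log u - Real.log v| ≤ |u - v| / c := by
  have key : ∀ u v : ℝ, c ≤ u → c ≤ v → Real.log u - Real.log v ≤ |u - v| / c := by
    intro u v hu hv
    have hu0 := hc.trans_le hu
    have hv0 := hc.trans_le hv
    rw [← Real.log_div hu0.ne' hv0.ne']
    refine (Real.log_le_sub_one_of_pos (div_pos hu0 hv0)).trans ?_
    have : u / v - 1 = (u - v) / v := by field_simp
    rw [this]
    exact div_le_div₀ (abs_nonneg _) (le_abs_self _) hc hv
  rw [abs_le]
  have h1 := key u v hu hv
  have h2 := key v u hv hu
  rw [abs_sub_comm] at h2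
  constructor <;> linarith

theorem abs_logit_sub_le {r h ρ ξ : ℝ} (hρ : 0 < ρ) (hr : |r| ≤ 1 - 2 * ρ) (hh : |h - r| ≤ ξ)
    (hξ : ξ ≤ ρ) :
    |Real.log ((1 + h) / (1 - h)) - Real.log ((1 + r) / (1 - r))| ≤ 2 * ξ / ρ := by
  rw [abs_le] at hr
  have hh' := abs_le.1 hh
  have h1 := abs_log_sub_log_le hρ (u := 1 + h) (v := 1 + r) (by linarith) (by linarith)
  have h2 := abs_log_sub_log_le hρ (u := 1 - h) (v := 1 - r) (by linarith) (by linarith)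
  have e1 : 1 + h - (1 + r) = h - r := by ring
  have e2 : |1 - h - (1 - r)| = |h - r| := by rw [← abs_neg]; congr 1; ring
  rw [e1] at h1
  rw [e2] at h2
  have h3 : |h - r| / ρ ≤ ξ / ρ := div_le_div_of_nonneg_right hh hρ.le
  rw [Real.log_div (by linarith) (by linarith), Real.log_div (by linarith) (by linarith)]
  have e3 : Real.log (1 + h) - Real.log (1 - h) - (Real.log (1 + r) - Real.log (1 - r)) =
      (Real.log (1 + h) - Real.log (1 + r)) - (Real.log (1 - h) - Real.log (1 - r)) := by ring
  rw [e3]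
  refine (abs_sub _ _).trans ?_
  have : 2 * ξ / ρ = ξ / ρ + ξ / ρ := by ring
  linarith

theorem logit_ge {R x τ ξ K : ℝ} (hR : 0 ≤ R) (hτ : τ = 1 - R) (hτ0 : 0 < τ) (hx : |x - R| ≤ ξ)
    (hξ : ξ ≤ 1 / 2) (hξτ : ξ ≤ K * τ) (hK : 0 ≤ K) (hx1 : x ≠ 1) :
    Real.log ((1 + R) / (1 - R)) - Real.log (4 * (1 + K)) ≤ Real.log ((1 + x) / (1 - x)) := by
  have hx' := abs_le.1 hx
  have h1 : 0 < |1 - x| := abs_pos.2 (sub_ne_zero.2 hx1.symm)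
  have h2 : |1 - x| ≤ τ * (1 + K) := by
    rw [abs_le]; constructor <;> nlinarith
  rw [← Real.log_abs ((1 + x) / (1 - x)), abs_div, abs_of_pos (by linarith : 0 < 1 + x),
    ← Real.log_div (by rw [← hτ]; positivity) (by positivity)]
  refine Real.log_le_log (by rw [← hτ]; positivity) ?_
  rw [← hτ, div_div, div_le_div_iff₀ (by positivity) h1]
  have h3 : 0 < 1 + x := by linarith
  have h4 : 1 + R ≤ 2 * (1 + x) := by linarith
  calc (1 + R) * |1 - x| ≤ (2 * (1 + x)) * (τ * (1 + K)) :=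
        mul_le_mul h4 h2 h1.le (by positivity)
    _ ≤ (1 + x) * (τ * (4 * (1 + K))) := by
        have : 0 ≤ (1 + x) * (τ * (1 + K)) := by positivity
        linarith

theorem logit_le {R x τ ξ K : ℝ} (hR : 0 ≤ R) (hτ : τ = 1 - R) (hτ0 : 0 < τ) (hx : |x - R| ≤ ξ)
    (hξ : ξ ≤ 1 / 2) (hK : 0 ≤ K) (hx1 : τ / 2 ≤ |1 - x|) :
    Real.log ((1 + x) / (1 - x)) ≤ Real.log ((1 + R) / (1 - R)) + Real.log (4 * (1 + K)) := by
  have hx' := abs_le.1 hx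
  have h1 : 0 < |1 - x| := by linarith
  rw [← Real.log_abs ((1 + x) / (1 - x)), abs_div, abs_of_pos (by linarith : 0 < 1 + x),
    ← Real.log_mul (by rw [← hτ]; positivity) (by positivity)]
  have h3 : 0 < 1 + x := by linarith
  refine Real.log_le_log (by positivity) ?_
  rw [← hτ, div_mul_eq_mul_div, div_le_div_iff₀ h1 hτ0]
  have h4 : 1 + x ≤ 2 * (1 + R) := by linarith
  calc (1 + x) * τ ≤ (2 * (1 + R)) * (2 * |1 - x|) :=
        mul_le_mul h4 (by linarith) hτ0.le (by positivity)
    _ ≤ (1 + R) * (4 * (1 + K)) * |1 - x| := by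
        have : 0 ≤ (1 + R) * K * |1 - x| := by positivity
        linarith

theorem logit_sign_mul {σ x : ℝ} (hσ : σ = 1 ∨ σ = -1) :
    Real.log ((1 + σ * x) / (1 - σ * x)) = σ * Real.log ((1 + x) / (1 - x)) := by
  rcases hσ with rfl | rfl
  · simp
  · have : (1 + -1 * x) / (1 - -1 * x) = ((1 + x) / (1 - x))⁻¹ := by rw [inv_div]; ring_nf
    rw [this, Real.log_inv]; ring

variable {ι : Type*} [Fintype ι]

/-- The vote with the estimated weights is close to that with the true weights, unless a worker of
the set `D` is wrong. -/
theorem vote_of_logit_bounds {r h σ : ι → ℝ} {D : Set ι} {δ : ℝ}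
    (hσ : ∀ i, σ i = 1 ∨ σ i = -1) (hσr : ∀ i, σ i * r i = |r i|)
    (hlow : ∀ i, npWeights (fun i => |r i|) i - δ ≤ npWeights (fun i => σ i * h i) i)
    (hupp : ∀ i ∉ D, npWeights (fun i => σ i * h i) i ≤ npWeights (fun i => |r i|) i + δ)
    {x : ι → ℤˣ} (hx : ∑ i, npWeights h i * val (x i) ≤ 0) :
    (∃ i ∈ D, val (x i) ≠ σ i) ∨ ∑ i, npWeights r i * val (x i) ≤ Fintype.card ι * δ := by
  by_cases hD : ∃ i ∈ D, val (x i) ≠ σ i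
  · exact Or.inl hD
  right
  push Not at hD
  have h1 : ∀ i, npWeights r i * val (x i) ≤ npWeights h i * val (x i) + δ := by
    intro i
    have hl := hlow i
    have hu := hupp i
    have e1 : npWeights (fun i => |r i|) i = σ i * npWeights r i := by
      simp only [npWeights]; rw [← hσr, logit_sign_mul (hσ i)]
    have e2 : npWeights (fun i => σ i * h i) i = σ i * npWeights h i := by
      simp only [npWeights]; rw [logit_sign_mul (hσ i)]
    rw [e1, e2] at hl hu
    have hσ2 : σ i = val (x i) ∨ (σ i = -val (x i) ∧ i ∉ D) := by
      by_cases hi : i ∈ D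
      · exact Or.inl (hD i hi).symm
      · rcases hσ i with h | h <;> rcases val_eq_or (x i) with h' | h' <;> simp [h, h', hi]
    rcases hσ2 with h | ⟨h, hi⟩
    · rw [h] at hl; linarith
    · have := hu hi
      rw [h] at this; linarith
  calc _ ≤ ∑ i, (npWeights h i * val (x i) + δ) := Finset.sum_le_sum fun i _ => h1 i
    _ = ∑ i, npWeights h i * val (x i) + Fintype.card ι * δ := by
      rw [Finset.sum_add_distrib]; simp
    _ ≤ _ := by linarith

/-- If all pairs of co-workers of a worker are unreliable, the worker dominates the vote. -/
theorem card_mul_renyi_le_of_dominant [Nonempty ι] {r : ι → ℝ} {ρ Φ : ℝ} (hρ : 0 < ρ)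
    (hρ' : ρ < 1 / 2) (hr : ∀ i, |r i| ≤ 1 - 2 * ρ) (hΦ : 1 ≤ Φ) {i : ι}
    (hτ : 1 - |r i| ≤ 2 * Φ * ρ)
    (hi : ∀ a b, a ≠ b → a ≠ i → b ≠ i → |r a * r b| ≤ 1 - 1 / Φ ^ 2) :
    Fintype.card ι * renyi r ≤ -Real.log (1 - |r i|) + Fintype.card ι * Real.log Φ := by
  classical
  have hΦ0 : 0 < Φ := by linarith
  set T := -Real.log (1 - |r i|) with hT
  have hτ0 : 0 < 1 - |r i| := by linarith [hr i]
  have hT0 : 0 ≤ T := by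
    rw [hT]; have := Real.log_nonpos hτ0.le (by linarith [abs_nonneg (r i)]); linarith
  have hlΦ : 0 ≤ Real.log Φ := Real.log_nonneg hΦ
  have hsq : ∀ b, -Real.log (1 - r b ^ 2) ≤ T + Real.log Φ := by
    intro b
    have h1 := two_mul_le_one_sub_sq hρ hρ' (hr b)
    have h2 : (1 - |r i|) / Φ ≤ 1 - r b ^ 2 := by
      rw [div_le_iff₀ hΦ0]; nlinarith
    have h3 := Real.log_le_log (by positivity) h2
    rw [Real.log_div hτ0.ne' hΦ0.ne'] at h3
    linarith
  have hself : -Real.log (1 - r i ^ 2) ≤ T := by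
    rw [hT]
    refine neg_le_neg (Real.log_le_log hτ0 ?_)
    rw [← sq_abs]; nlinarith [abs_nonneg (r i), hr i]
  obtain ⟨a, ha⟩ : ∃ a, ∀ b, b ≠ i → b ≠ a → r b ^ 2 ≤ 1 - 1 / Φ ^ 2 := by
    rcases (Finset.univ.erase i).eq_empty_or_nonempty with h | h
    · refine ⟨i, fun b hb => ?_⟩
      have : b ∈ Finset.univ.erase i := by simp [hb]
      rw [h] at this; simp at this
    · obtain ⟨a, ha, hmax⟩ := Finset.exists_max_image (Finset.univ.erase i) (fun b => |r b|) h
      refine ⟨a, fun b hb hba => (le_trans ?_ (hi a b hba.symm (Finset.mem_erase.1 ha).1 hb))⟩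
      rw [abs_mul, ← sq_abs, sq]
      exact mul_le_mul_of_nonneg_right (hmax b (by simp [hb])) (abs_nonneg _)
  have h1 : ∑ b, -Real.log (1 - r b ^ 2) ≤ ∑ b, (2 * Real.log Φ + ((if b = i then T else 0) +
      (if b = a then T else 0))) := by
    refine Finset.sum_le_sum fun b _ => ?_
    by_cases hb : b = i
    · rw [if_pos hb, hb]; split_ifs <;> linarith
    · by_cases hb' : b = a
      · rw [if_neg hb, if_pos hb']; linarith [hsq b]
      · rw [if_neg hb, if_neg hb']
        have h2 := ha b hb hb'
        have h3 := Real.log_le_log (by positivity) (by linarith : 1 / Φ ^ 2 ≤ 1 - r b ^ 2)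
        rw [one_div, Real.log_inv, Real.log_pow] at h3
        push_cast at h3
        linarith
  simp only [Finset.sum_add_distrib, Finset.sum_const, Finset.card_univ, nsmul_eq_mul,
    Finset.sum_ite_eq', Finset.mem_univ, if_true, Finset.sum_neg_distrib] at h1
  rw [card_mul_renyi]
  linarith

/-- A magnitude estimated from a reliable pair of co-workers is relatively accurate. -/
theorem half_le_abs_one_sub_teMagnitude {ι : Type*} {C : ι → ι → ℝ} {r : ι → ℝ} {a b i : ι} {e : ℝ}
    (hr : ∀ i, |r i| ≤ 1) (hC : 0.9 ≤ |C a b|) (hai : |C a i - r a * r i| ≤ e)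
    (hbi : |C b i - r b * r i| ≤ e) (hab : |C a b - r a * r b| ≤ e) (hri : 1 / 2 ≤ |r i|)
    (he : 20 * e ≤ 1 - |r i|) :
    (1 - |r i|) / 2 ≤ |1 - teMagnitude C a b i| := by
  have h1 := sq_teMagnitude_sub_le (hr a) (hr b) (by norm_num : (0 : ℝ) < 0.9) hC hai hbi hab
  set M := teMagnitude C a b i with hM
  have hM0 : 0 ≤ M := by
    rw [hM, teMagnitude]; split_ifs; exacts [Real.sqrt_nonneg _, le_rfl]
  have he0 : 0 ≤ e := (abs_nonneg _).trans hab
  have hri1 := hr i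
  rw [← sq_abs (r i)] at h1
  set R := |r i| with hR
  have h2 : (2 * R * e + e ^ 2 + R ^ 2 * e) / 0.9 ≤ 4 * e := by
    have t1 : R * e ≤ e := mul_le_of_le_one_left he0 hri1
    have t2 : R ^ 2 * e ≤ e := mul_le_of_le_one_left he0 (by nlinarith)
    have t3 : e ^ 2 ≤ e / 40 := by nlinarith
    rw [div_le_iff₀ (by norm_num)]
    linarith
  have h3 := (abs_le.1 (h1.trans h2)).2
  have h4 : M - R ≤ 8 * e := by
    by_contra hcon
    have : 8 * e < M - R := not_le.1 hcon
    nlinarith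
  rw [le_abs]
  left; linarith

end Weights

end Crowd

namespace Crowd

variable {ι : Type*} [Fintype ι] [DecidableEq ι]

/-- Uniform accuracy, at scale `s`, of the covariances that Triangular Estimation uses. -/
structure CovAccurate (C : ι → ι → ℝ) (r : ι → ℝ) (s : ℝ) : Prop where
  pair : ∀ a b, a ≠ b → |C a b - r a * r b| ≤ s
  extreme : ∀ a b, a ≠ b → |C a b - r a * r b| ≤
    4 * Real.sqrt ((1 - |r a * r b|) / 2 * (s ^ 2 / 2)) + 8 * (s ^ 2 / 2)
  stat : ∀ i, |∑ l ∈ Finset.univ.erase i, C l i - r i * ∑ l ∈ Finset.univ.erase i, r l| ≤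
    s * Real.sqrt (Fintype.card ι) + s * |∑ l ∈ Finset.univ.erase i, r l|

theorem IsSignFamily.prob_not_covAccurate_le {Ω : Type*} [MeasurableSpace Ω] {μ : Measure Ω}
    [IsProbabilityMeasure μ] {d : ℕ} {X : ι × Fin d → Ω → ℤˣ} {m : ι × Fin d → ℝ} {r : ι → ℝ}
    {J : Finset (Fin d)} (hX : IsSignFamily μ X m) (hJ : 0 < J.card)
    (hm : ∀ i, ∀ j ∈ J, m (i, j) = r i) (hr : ∀ i, |r i| ≤ 1) {s l : ℝ} (hs : 0 < s)
    (hl : J.card * s ^ 2 = 4 * l) :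
    μ.real {ω | ¬ CovAccurate (workerCov J fun i j => X (i, j) ω) r s} ≤
      8 * (Fintype.card ι : ℝ) ^ 2 * Real.exp (-(2 * l)) := by
  have hs2 : 0 < s ^ 2 / 2 := by positivity
  have e1 : (J.card : ℝ) * s ^ 2 / 2 = 2 * l := by linarith
  have e2 : s ^ 2 / 2 * (J.card : ℝ) = 2 * l := by linarith
  set p := Real.exp (-(2 * l)) with hp
  have hp0 : 0 < p := Real.exp_pos _
  set C : Ω → ι → ι → ℝ := fun ω => workerCov J fun i j => X (i, j) ω with hC
  set A : ι × ι → Set Ω := fun q => {ω | q.1 ≠ q.2 ∧ s < |C ω q.1 q.2 - r q.1 * r q.2|} with hA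
  set B : ι × ι → Set Ω := fun q => {ω | q.1 ≠ q.2 ∧
    4 * Real.sqrt ((1 - |r q.1 * r q.2|) / 2 * (s ^ 2 / 2)) + 8 * (s ^ 2 / 2) <
      |C ω q.1 q.2 - r q.1 * r q.2|} with hB
  set G : ι → Set Ω := fun i => {ω | s * Real.sqrt (Fintype.card ι) +
    s * |∑ l ∈ Finset.univ.erase i, r l| <
      |∑ l ∈ Finset.univ.erase i, C ω l i - r i * ∑ l ∈ Finset.univ.erase i, r l|} with hG
  have hsub : {ω | ¬ CovAccurate (C ω) r s} ⊆ ((⋃ q, A q) ∪ ⋃ q, B q) ∪ ⋃ i, G i := by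
    intro ω hω
    by_contra hcon
    simp only [Set.mem_union, Set.mem_iUnion, not_or, not_exists] at hcon
    obtain ⟨⟨h1, h2⟩, h3⟩ := hcon
    refine hω ⟨fun a b hab => ?_, fun a b hab => ?_, fun i => not_lt.1 (h3 i)⟩
    · exact not_lt.1 fun h => h1 (a, b) ⟨hab, h⟩
    · exact not_lt.1 fun h => h2 (a, b) ⟨hab, h⟩
  have hAp : ∀ q, μ.real (A q) ≤ 2 * p := by
    rintro ⟨a, b⟩
    by_cases hab : a = b
    · have : A (a, b) = ∅ := by ext ω; simp [hA, hab]
      rw [this, measureReal_empty]; positivity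
    · have := hX.prob_cov_le hJ hm hab hs.le
      rw [e1] at this
      exact (measureReal_mono (fun ω hω => hω.2) (measure_ne_top _ _)).trans this
  have hBp : ∀ q, μ.real (B q) ≤ 2 * p := by
    rintro ⟨a, b⟩
    by_cases hab : a = b
    · have : B (a, b) = ∅ := by ext ω; simp [hB, hab]
      rw [this, measureReal_empty]; positivity
    · have := hX.prob_cov_le_of_extreme hJ hm hab hr hs2
      rw [e2] at this
      exact (measureReal_mono (fun ω hω => hω.2) (measure_ne_top _ _)).trans this
  have hGp : ∀ i, μ.real (G i) ≤ 4 * p := by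
    intro i
    have := hX.prob_signStat_le hJ hm i hs.le
    rw [e1] at this
    exact this
  set n : ℝ := (Fintype.card ι : ℝ) with hn
  have hAu : μ.real (⋃ q, A q) ≤ n ^ 2 * (2 * p) := by
    refine (measureReal_iUnion_fintype_le _).trans ((Finset.sum_le_sum fun q _ => hAp q).trans ?_)
    simp [Fintype.card_prod, sq, hn]
  have hBu : μ.real (⋃ q, B q) ≤ n ^ 2 * (2 * p) := by
    refine (measureReal_iUnion_fintype_le _).trans ((Finset.sum_le_sum fun q _ => hBp q).trans ?_)
    simp [Fintype.card_prod, sq, hn]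
  have hGu : μ.real (⋃ i, G i) ≤ n ^ 2 * (4 * p) := by
    refine (measureReal_iUnion_fintype_le _).trans ((Finset.sum_le_sum fun q _ => hGp q).trans ?_)
    simp only [Finset.sum_const, Finset.card_univ, nsmul_eq_mul]
    refine mul_le_mul_of_nonneg_right ?_ (by positivity)
    rcases Nat.eq_zero_or_pos (Fintype.card ι) with h | h
    · rw [hn, h]; simp
    · have : (1 : ℝ) ≤ n := by rw [hn]; exact_mod_cast h
      rw [← hn]; nlinarith
  refine (measureReal_mono hsub (measure_ne_top _ _)).trans ((measureReal_union_le _ _).trans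
    ((add_le_add ((measureReal_union_le _ _).trans (add_le_add hAu hBu)) hGu).trans (le_of_eq ?_)))
  ring

/-- The conditions under which Triangular Estimation at scale `s` is accurate enough for voting. -/
structure WellEstimated (r : ι → ℝ) (ρ L s : ℝ) : Prop where
  ρ_pos : 0 < ρ
  ρ_lt : ρ < 1 / 2
  abs_le : ∀ i, |r i| ≤ 1 - 2 * ρ
  pos : 0 < informativeness r
  three_le : 3 ≤ ∑ i, r i
  one_le : 1 ≤ L
  s_pos : 0 < s
  s_le : 185 * L * s ≤ informativeness r ^ 2 * (renyi r * ρ)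
  s_le' : 30 * L * Real.sqrt (Fintype.card ι) * s ≤ informativeness r * ∑ i, r i

namespace WellEstimated

variable {r : ι → ℝ} {ρ L s : ℝ}

set_option linter.unusedSectionVars false

theorem nonempty (h : WellEstimated r ρ L s) : Nonempty ι := by
  by_contra hcon
  rw [not_nonempty_iff] at hcon
  have := h.three_le
  simp at this
  linarith

theorem abs_le_one (h : WellEstimated r ρ L s) (i : ι) : |r i| ≤ 1 := by
  linarith [h.abs_le i, h.ρ_pos]

theorem le_one (h : WellEstimated r ρ L s) : informativeness r ≤ 1 :=
  informativeness_le_one h.abs_le_one h.pos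

theorem renyi_mul_le (h : WellEstimated r ρ L s) : renyi r * ρ ≤ informativeness r :=
  have := h.nonempty
  renyi_mul_le_informativeness h.ρ_pos h.ρ_lt h.abs_le h.pos h.three_le

theorem renyi_mul_pos (h : WellEstimated r ρ L s) : 0 < renyi r * ρ := by
  have h1 := h.s_le
  have h2 : 0 < 185 * L * s := by have := h.one_le; have := h.s_pos; positivity
  exact (mul_pos_iff_of_pos_left (pow_pos h.pos 2)).1 (h2.trans_le h1)

theorem renyi_pos (h : WellEstimated r ρ L s) : 0 < renyi r :=
  (mul_pos_iff_of_pos_right h.ρ_pos).1 h.renyi_mul_pos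

theorem accurate (h : WellEstimated r ρ L s) {C : ι → ι → ℝ} (hC : CovAccurate C r s) {rh : ι → ℝ}
    (hrh : IsTEEstimate C rh) :
    ∃ a b : ι → ι, (∀ i, a i ≠ b i ∧ a i ≠ i ∧ b i ≠ i ∧
        ∀ a' b', a' ≠ b' → a' ≠ i → b' ≠ i → |C a' b'| ≤ |C (a i) (b i)|) ∧
      ∀ i, |rh i - r i| ≤ 11 * (renyi r * ρ / (185 * L)) ∧
        (2 * (renyi r * ρ / (185 * L)) < |r i| → |rh i| = teMagnitude C (a i) (b i) i) := by
  have hL := h.one_le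
  have hV := h.pos
  have hV1 := h.le_one
  have hΦρ := h.renyi_mul_le
  have hΦρ0 := h.renyi_mul_pos
  have hs0 := h.s_pos
  have hS := h.three_le
  have h1 := h.s_le
  have h2 := h.s_le'
  set V := informativeness r with hVd
  set S := ∑ i, r i with hSd
  set F := renyi r * ρ with hF
  have hη : F / (185 * L) ≤ F / 185 := by
    apply div_le_div_of_nonneg_left hΦρ0.le (by norm_num); linarith
  have hstat : ∀ i, |∑ l ∈ Finset.univ.erase i, C l i -
      r i * ∑ l ∈ Finset.univ.erase i, r l| ≤ V * S / 10 := by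
    intro i
    refine (hC.stat i).trans ?_
    have e1 : ∑ l ∈ Finset.univ.erase i, r l = S - r i := by
      rw [hSd, ← Finset.add_sum_erase _ _ (Finset.mem_univ i)]; ring
    have e2 : |∑ l ∈ Finset.univ.erase i, r l| ≤ 4 / 3 * S := by
      rw [e1]
      have := h.abs_le_one i
      rw [_root_.abs_le] at this ⊢
      constructor <;> linarith
    have e3 : 30 * (s * Real.sqrt (Fintype.card ι)) ≤ V * S := by
      refine le_trans ?_ h2
      have : 0 ≤ s * Real.sqrt (Fintype.card ι) := by positivity
      nlinarith
    have e4 : 185 * s ≤ V := by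
      have t1 : 185 * s ≤ 185 * L * s := by nlinarith
      have t2 : V ^ 2 * F ≤ V * 1 := by nlinarith
      linarith
    have e5 : s * |∑ l ∈ Finset.univ.erase i, r l| ≤ V / 185 * (4 / 3 * S) :=
      mul_le_mul (by linarith) e2 (abs_nonneg _) (by positivity)
    have : 0 < V * S := by positivity
    linarith
  refine hrh.accurate (s := s) (σ := V * S / 10) h.abs_le_one hV hC.pair ?_ (by positivity)
    (by linarith) hS hstat le_rfl
  rw [div_mul_eq_mul_div, le_div_iff₀ (by positivity)]
  linarith

theorem npWeights_abs_sub_le (h : WellEstimated r ρ L s) (hΦ : renyi r ≤ 6 * L) {C : ι → ι → ℝ}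
    (hC : CovAccurate C r s) {rh : ι → ℝ} (hrh : IsTEEstimate C rh) (i : ι) :
    |npWeights rh i - npWeights r i| ≤ renyi r / (8 * L) := by
  obtain ⟨_, _, -, hacc⟩ := h.accurate hC hrh
  have hL := h.one_le
  have hρ := h.ρ_pos
  have hΦ0 := h.renyi_pos
  have h1 : 11 * (renyi r * ρ / (185 * L)) ≤ ρ := by
    rw [← mul_div_assoc, div_le_iff₀ (by positivity)]
    nlinarith
  refine (abs_logit_sub_le hρ (h.abs_le i) (hacc i).1 h1).trans ?_
  have : 2 * (11 * (renyi r * ρ / (185 * L))) / ρ = 22 / 185 * (renyi r / L) := by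
    field_simp; norm_num
  rw [this]
  have : renyi r / (8 * L) = 1 / 8 * (renyi r / L) := by field_simp
  rw [this]
  exact mul_le_mul_of_nonneg_right (by norm_num) (by positivity)

theorem vote_le (h : WellEstimated r ρ L s) (hΦ : renyi r ≤ 6 * L) {C : ι → ι → ℝ}
    (hC : CovAccurate C r s) {rh : ι → ℝ} (hrh : IsTEEstimate C rh) {x : ι → ℤˣ}
    (hx : ∑ i, npWeights rh i * val (x i) ≤ 0) :
    ∑ i, npWeights r i * val (x i) ≤ Fintype.card ι * (renyi r / (8 * L)) := by
  have h1 : ∀ i, npWeights r i * val (x i) ≤ npWeights rh i * val (x i) + renyi r / (8 * L) := by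
    intro i
    have h2 := h.npWeights_abs_sub_le hΦ hC hrh i
    rw [_root_.abs_le] at h2
    rcases val_eq_or (x i) with h' | h' <;> rw [h'] <;> linarith
  calc _ ≤ ∑ i, (npWeights rh i * val (x i) + renyi r / (8 * L)) :=
        Finset.sum_le_sum fun i _ => h1 i
    _ = ∑ i, npWeights rh i * val (x i) + Fintype.card ι * (renyi r / (8 * L)) := by
      rw [Finset.sum_add_distrib]; simp
    _ ≤ _ := by linarith

theorem renyi_pow_mul_le (h : WellEstimated r ρ L s) : renyi r ^ 3 * ρ ≤ 3 / 8 := by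
  have := h.nonempty
  have h1 := two_mul_le_exp_neg_renyi h.ρ_pos h.ρ_lt h.abs_le
  have hΦ := h.renyi_pos
  have h2 := Real.pow_div_factorial_le_exp (2 * renyi r) (by positivity) 3
  have h3 : Real.exp (-(2 * renyi r)) * Real.exp (2 * renyi r) = 1 := by
    rw [← Real.exp_add]; simp
  have h4 : (3 : ℕ).factorial = 6 := rfl
  rw [h4] at h2
  have h5 : 2 * ρ * ((2 * renyi r) ^ 3 / (6 : ℕ)) ≤ 1 := by
    rw [← h3]
    exact mul_le_mul h1 h2 (by positivity) (Real.exp_pos _).le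
  push_cast at h5
  linarith

/-- The workers who may be so reliable that their estimated weight is not controlled from above. -/
def dominant (r : ι → ℝ) (ρ L : ℝ) : Set ι :=
  {i | 1 - |r i| < 22 * (renyi r * ρ / (185 * L)) ∧
    ∀ a b, a ≠ b → a ≠ i → b ≠ i → |r a * r b| ≤ 1 - 1 / renyi r ^ 2}

/-- The sign of a reliability, with value `1` at `0`. -/
def relSign (r : ι → ℝ) (i : ι) : ℝ := if 0 ≤ r i then 1 else -1

theorem relSign_eq_or (r : ι → ℝ) (i : ι) : relSign r i = 1 ∨ relSign r i = -1 := by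
  unfold relSign; split_ifs <;> simp

theorem relSign_mul (r : ι → ℝ) (i : ι) : relSign r i * r i = |r i| := by
  unfold relSign
  split_ifs with h
  · rw [one_mul, abs_of_nonneg h]
  · rw [abs_of_neg (not_le.1 h)]; ring

theorem half_le_abs_one_sub (h : WellEstimated r ρ L s) (hΦ : 6 * L ≤ renyi r) {C : ι → ι → ℝ}
    (hC : CovAccurate C r s) {a b i : ι} (hab : a ≠ b) (hai : a ≠ i) (hbi : b ≠ i)
    (hmax : ∀ a' b', a' ≠ b' → a' ≠ i → b' ≠ i → |C a' b'| ≤ |C a b|)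
    (hi : 1 - |r i| < 22 * (renyi r * ρ / (185 * L))) (hdom : i ∉ dominant r ρ L) :
    (1 - |r i|) / 2 ≤ |1 - teMagnitude C a b i| := by
  have hL := h.one_le
  have hρ := h.ρ_pos
  have hΦ0 := h.renyi_pos
  have hV := h.pos
  have hV1 := h.le_one
  have hpow := h.renyi_pow_mul_le
  have hs := h.s_le
  have hs0 := h.s_pos
  have hri := h.abs_le i
  set Φ := renyi r with hΦd
  have hΦ6 : 6 ≤ Φ := by linarith
  simp only [dominant, Set.mem_ofPred_eq, not_and, not_forall] at hdom
  obtain ⟨a', b', hab', hai', hbi', hpair⟩ := hdom hi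
  rw [not_le, ← hΦd] at hpair
  set θ := 1 / Φ ^ 2 with hθ
  have hθ0 : 0 < θ := by positivity
  have hθ1 : θ ≤ 1 / 36 := by
    rw [hθ]; apply div_le_div_of_nonneg_left <;> nlinarith
  have hθΦ : θ * Φ ^ 2 = 1 := by rw [hθ]; field_simp
  have hFθ : Φ * ρ ≤ 3 / 8 * θ := by
    have : Φ * ρ = Φ ^ 3 * ρ * θ := by rw [hθ]; field_simp
    rw [this]; exact mul_le_mul_of_nonneg_right hpow hθ0.le
  have hsF : 185 * s ≤ Φ * ρ := by
    have t1 : 185 * s ≤ 185 * L * s := by nlinarith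
    have t2 : informativeness r ^ 2 * (Φ * ρ) ≤ Φ * ρ :=
      mul_le_of_le_one_left (by positivity) (by nlinarith)
    linarith
  have hηF : Φ * ρ / (185 * L) ≤ Φ * ρ / 185 :=
    div_le_div_of_nonneg_left (by positivity) (by norm_num) (by linarith)
  have hpr : ∀ a b, |r a * r b| ≤ |r a| ∧ |r a * r b| ≤ |r b| := fun a b => by
    rw [abs_mul]
    exact ⟨mul_le_of_le_one_right (abs_nonneg _) (h.abs_le_one b),
      mul_le_of_le_one_left (abs_nonneg _) (h.abs_le_one a)⟩
  have c1 := hC.pair a' b' hab'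
  have c2 := hC.pair a b hab
  have c3 := hmax a' b' hab' hai' hbi'
  have c4 := abs_sub_abs_le_abs_sub (r a' * r b') (C a' b')
  rw [abs_sub_comm] at c4
  have c5 := abs_sub_abs_le_abs_sub (C a b) (r a * r b)
  have hCab : 1 - θ - s ≤ |C a b| := by linarith
  have hrab : 1 - 1.1 * θ ≤ |r a * r b| := by linarith
  have hra : 1 - 1.1 * θ ≤ |r a| := hrab.trans (hpr a b).1
  have hrb : 1 - 1.1 * θ ≤ |r b| := hrab.trans (hpr a b).2
  have hri' : 1 - 0.12 * θ ≤ |r i| := by linarith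
  have hrai : 1 - 2 * θ ≤ |r a * r i| := by
    rw [abs_mul]; nlinarith
  have hrbi : 1 - 2 * θ ≤ |r b * r i| := by
    rw [abs_mul]; nlinarith
  have hcov : ∀ c e, c ≠ e → 1 - 2 * θ ≤ |r c * r e| → |C c e - r c * r e| ≤ ρ / 10 := by
    intro c e hce hre
    refine (hC.extreme c e hce).trans ?_
    have t1 : Real.sqrt ((1 - |r c * r e|) / 2 * (s ^ 2 / 2)) ≤ ρ / 100 := by
      apply Real.sqrt_le_iff.2 ⟨by positivity, ?_⟩
      calc (1 - |r c * r e|) / 2 * (s ^ 2 / 2) ≤ θ * (s ^ 2 / 2) :=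
            mul_le_mul_of_nonneg_right (by linarith) (by positivity)
        _ ≤ θ * ((Φ * ρ / 185) ^ 2 / 2) := by
            have : s ≤ Φ * ρ / 185 := by linarith
            gcongr
        _ = (θ * Φ ^ 2) * (ρ ^ 2 / (185 ^ 2 * 2)) := by ring
        _ = ρ ^ 2 / (185 ^ 2 * 2) := by rw [hθΦ, one_mul]
        _ ≤ (ρ / 100) ^ 2 := by
            rw [div_pow]
            apply div_le_div_of_nonneg_left (by positivity) <;> norm_num
    have t2 : 8 * (s ^ 2 / 2) ≤ ρ / 100 := by
      have t3 : Φ ^ 2 * ρ ≤ 1 := by nlinarith [mul_pos (pow_pos hΦ0 2) hρ]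
      have t4 : s ^ 2 ≤ (Φ * ρ / 185) ^ 2 := by
        have : s ≤ Φ * ρ / 185 := by linarith
        gcongr
      have t5 : (Φ * ρ / 185) ^ 2 = Φ ^ 2 * ρ * ρ / 185 ^ 2 := by ring
      have t6 : Φ ^ 2 * ρ * ρ ≤ 1 * ρ := mul_le_mul_of_nonneg_right t3 hρ.le
      rw [t5] at t4
      linarith
    linarith
  exact half_le_abs_one_sub_teMagnitude h.abs_le_one (by linarith) (hcov _ _ hai hrai)
    (hcov _ _ hbi hrbi) (hcov _ _ hab (by linarith)) (by linarith) (by linarith)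

theorem vote_or_dominant_wrong (h : WellEstimated r ρ L s) (hΦ : 6 * L ≤ renyi r)
    {C : ι → ι → ℝ} (hC : CovAccurate C r s)
    (htie : ∀ a b i, a ≠ b → a ≠ i → b ≠ i → teMagnitude C a b i ≠ 1)
    {rh : ι → ℝ} (hrh : IsTEEstimate C rh) {x : ι → ℤˣ}
    (hx : ∑ i, npWeights rh i * val (x i) ≤ 0) :
    (∃ i ∈ dominant r ρ L, val (x i) ≠ relSign r i) ∨
      ∑ i, npWeights r i * val (x i) ≤ Fintype.card ι * Real.log (4 * (1 + renyi r)) := by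
  obtain ⟨a, b, hab, hacc⟩ := h.accurate hC hrh
  have hL := h.one_le
  have hρ := h.ρ_pos
  have hΦ0 := h.renyi_pos
  have hpow := h.renyi_pow_mul_le
  have hΦ6 : 6 ≤ renyi r := by linarith
  have hηF : renyi r * ρ / (185 * L) ≤ renyi r * ρ / 185 :=
    div_le_div_of_nonneg_left (by positivity) (by norm_num) (by linarith)
  have hF : renyi r * ρ ≤ 1 / 36 := by
    have : 36 * (renyi r * ρ) ≤ renyi r ^ 2 * (renyi r * ρ) :=
      mul_le_mul_of_nonneg_right (by nlinarith) (by positivity)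
    nlinarith
  have hF0 : 0 < renyi r * ρ := h.renyi_mul_pos
  set η := renyi r * ρ / (185 * L) with hη
  have hη0 : 0 < η := by positivity
  have hclose : ∀ i, |relSign r i * rh i - (|r i|)| ≤ 11 * η := by
    intro i
    have : relSign r i * rh i - |r i| = relSign r i * (rh i - r i) := by
      rw [mul_sub, relSign_mul]
    rw [this, abs_mul]
    rcases relSign_eq_or r i with h' | h' <;> rw [h'] <;> simpa using (hacc i).1
  have habs : ∀ i, 1 - |r i| < 22 * η → relSign r i * rh i = teMagnitude C (a i) (b i) i := by
    intro i hi
    rw [← (hacc i).2 (by linarith)]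
    have h1 := (_root_.abs_le.1 (hclose i)).1
    have h2 : 0 < relSign r i * rh i := by linarith
    rw [← abs_of_pos h2, abs_mul]
    rcases relSign_eq_or r i with h' | h' <;> rw [h'] <;> simp
  have hτ : ∀ i, 2 * ρ ≤ 1 - |r i| := fun i => by linarith [h.abs_le i]
  refine vote_of_logit_bounds (h := rh) (relSign_eq_or r) (relSign_mul r) (fun i => ?_)
    (fun i hi => ?_) hx
  · refine logit_ge (abs_nonneg _) rfl (by linarith [hτ i]) (hclose i) (by linarith)
      (K := renyi r) ?_ hΦ0.le ?_
    · have := mul_le_mul_of_nonneg_left (hτ i) hΦ0.le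
      linarith
    · intro h1
      beta_reduce at h1
      rcases lt_or_ge (1 - |r i|) (22 * η) with h2 | h2
      · rw [habs i h2] at h1
        obtain ⟨t1, t2, t3, -⟩ := hab i
        exact htie _ _ _ t1 t2 t3 h1
      · have := (_root_.abs_le.1 (hclose i)).2
        rw [h1] at this; linarith
  · refine logit_le (abs_nonneg _) rfl (by linarith [hτ i]) (hclose i) (by linarith) hΦ0.le ?_
    beta_reduce
    rcases lt_or_ge (1 - |r i|) (22 * η) with h2 | h2
    · obtain ⟨t1, t2, t3, t4⟩ := hab i
      rw [habs i h2]
      exact h.half_le_abs_one_sub hΦ hC t1 t2 t3 t4 h2 hi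
    · have := (_root_.abs_le.1 (hclose i)).2
      rw [le_abs]; left; linarith

end WellEstimated

end Crowd

namespace Crowd

namespace WellEstimated

variable {ι Ω : Type*} [Fintype ι] [DecidableEq ι] [MeasurableSpace Ω] {μ : Measure Ω}
  [IsProbabilityMeasure μ] {r : ι → ℝ} {ρ L s ε : ℝ}

theorem prob_vote_le (h : WellEstimated r ρ L s) {Z : ι → Ω → ℤˣ} (hZ : IsSignFamily μ Z r)
    (δ : ℝ) :
    μ.real {ω | ∑ i, npWeights r i * val (Z i ω) ≤ Fintype.card ι * δ} ≤
      Real.exp (Fintype.card ι * δ / 2 - Fintype.card ι * renyi r) := by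
  have := h.nonempty
  have h1 := hZ.vote_error_le Finset.univ (fun i _ => by linarith [h.abs_le i, h.ρ_pos])
    (Fintype.card ι * δ)
  rw [card_mul_renyi]
  refine h1.trans (le_of_eq ?_)
  congr 1; ring

theorem prob_dominant_wrong_le (h : WellEstimated r ρ L s) (hΦ : 6 * L ≤ renyi r)
    {Z : ι → Ω → ℤˣ} (hZ : IsSignFamily μ Z r) :
    μ.real {ω | ∃ i ∈ dominant r ρ L, val (Z i ω) ≠ relSign r i} ≤
      Fintype.card ι * Real.exp (Fintype.card ι * Real.log (renyi r) -
        Fintype.card ι * renyi r) := by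
  have := h.nonempty
  have hL := h.one_le
  have hρ := h.ρ_pos
  have hΦ0 := h.renyi_pos
  set p := Real.exp (Fintype.card ι * Real.log (renyi r) - Fintype.card ι * renyi r) with hp
  have hi : ∀ i, μ.real {ω | i ∈ dominant r ρ L ∧ val (Z i ω) ≠ relSign r i} ≤ p := by
    intro i
    by_cases hdom : i ∈ dominant r ρ L
    · simp only [hdom, true_and]
      have hτ0 : 0 < 1 - |r i| := by linarith [h.abs_le i]
      have h1 : μ.real {ω | val (Z i ω) ≠ relSign r i} ≤ 1 - |r i| := by
        have h2 : μ.real {ω | val (Z i ω) ≠ relSign r i} = (1 - |r i|) / 2 := by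
          by_cases hr : 0 ≤ r i
          · rw [abs_of_nonneg hr, ← hZ.prob_neg]
            congr 1; ext ω
            rcases Int.units_eq_one_or (Z i ω) with h' | h' <;>
              (simp [h', relSign, hr, val_one, val_neg_one]; try norm_num)
          · rw [abs_of_neg (not_le.1 hr), sub_neg_eq_add, ← hZ.prob]
            congr 1; ext ω
            rcases Int.units_eq_one_or (Z i ω) with h' | h' <;>
              (simp [h', relSign, hr, val_one, val_neg_one]; try norm_num)
        rw [h2]; linarith
      refine h1.trans ?_
      rw [← Real.exp_log hτ0, hp]
      apply Real.exp_le_exp.2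
      have h3 : 1 - |r i| ≤ 2 * renyi r * ρ := by
        have h4 : 22 * (renyi r * ρ / (185 * L)) ≤ 2 * (renyi r * ρ) := by
          rw [← mul_div_assoc, div_le_iff₀ (by positivity)]
          have : renyi r * ρ ≤ renyi r * ρ * L := le_mul_of_one_le_right (by positivity) hL
          nlinarith [h.renyi_mul_pos]
        linarith [hdom.1]
      have := card_mul_renyi_le_of_dominant hρ h.ρ_lt h.abs_le (by linarith : 1 ≤ renyi r) h3
        hdom.2
      linarith
    · simp [hdom]; positivity
  have hsub : {ω | ∃ i ∈ dominant r ρ L, val (Z i ω) ≠ relSign r i} ⊆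
      ⋃ i, {ω | i ∈ dominant r ρ L ∧ val (Z i ω) ≠ relSign r i} := by
    rintro ω ⟨i, h1, h2⟩
    exact Set.mem_iUnion.2 ⟨i, h1, h2⟩
  refine (measureReal_mono hsub (measure_ne_top _ _)).trans
    ((measureReal_iUnion_fintype_le _).trans ((Finset.sum_le_sum fun i _ => hi i).trans ?_))
  simp

/-- A magnitude estimate of exactly one has negligible probability when the workers are very
reliable. -/
theorem prob_tie_le (h : WellEstimated r ρ L s) (hΦ : 6 * L ≤ renyi r)
    (hn : Real.exp L = Fintype.card ι) {d : ℕ} {X : ι × Fin d → Ω → ℤˣ} {m : ι × Fin d → ℝ}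
    {J : Finset (Fin d)} (hX : IsSignFamily μ X m) (hJ : 0 < J.card)
    (hm : ∀ i, ∀ j ∈ J, m (i, j) = r i) {l : ℝ} (hl : J.card * s ^ 2 = 4 * l) (hl1 : 1 ≤ l) :
    μ.real {ω | ¬ ∀ a b i, a ≠ b → a ≠ i → b ≠ i →
      teMagnitude (workerCov J fun i j => X (i, j) ω) a b i ≠ 1} ≤
      1 / (Fintype.card ι : ℝ) ^ 2 := by
  have := h.nonempty
  have hL := h.one_le
  have hρ := h.ρ_pos
  have hΦ0 := h.renyi_pos
  have hs0 := h.s_pos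
  have hV := h.pos
  set n : ℝ := (Fintype.card ι : ℝ) with hnd
  set Φ := renyi r with hΦd
  have hn0 : 0 < n := by rw [← hn]; exact Real.exp_pos _
  have hJ' : (0 : ℝ) < J.card := by exact_mod_cast hJ
  have hsF : 185 * s ≤ Φ * ρ := by
    have t1 : 185 * s ≤ 185 * L * s := by nlinarith
    have t2 : informativeness r ^ 2 * (Φ * ρ) ≤ Φ * ρ :=
      mul_le_of_le_one_left (by positivity) (by nlinarith [h.le_one])
    linarith [h.s_le]
  have hexp := two_mul_le_exp_neg_renyi hρ h.ρ_lt h.abs_le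
  rw [← hΦd] at hexp
  have hbig : 64 * n ^ 10 ≤ 2 * ρ * J.card := by
    have e1 : (J.card : ℝ) * (Φ * ρ) ^ 2 ≥ 185 ^ 2 * 4 := by
      have t1 : (185 * s) ^ 2 ≤ (Φ * ρ) ^ 2 := pow_le_pow_left₀ (by positivity) hsF 2
      have t2 : (J.card : ℝ) * (185 * s) ^ 2 ≤ J.card * (Φ * ρ) ^ 2 :=
        mul_le_mul_of_nonneg_left t1 hJ'.le
      have t3 : (J.card : ℝ) * (185 * s) ^ 2 = 185 ^ 2 * (4 * l) := by rw [← hl]; ring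
      linarith
    have e2 : 2 * ρ * Real.exp (2 * Φ) ≤ 1 := by
      have := mul_le_mul_of_nonneg_right hexp (Real.exp_pos (2 * Φ)).le
      rwa [← Real.exp_add, neg_add_cancel, Real.exp_zero] at this
    have e3 : n ^ 10 * (Φ ^ 2 / 18) ≤ Real.exp (2 * Φ) := by
      have t1 : n ^ 10 ≤ Real.exp (5 / 3 * Φ) := by
        rw [← hn, ← Real.exp_nat_mul]
        apply Real.exp_le_exp.2; push_cast; linarith
      have t2 := Real.pow_div_factorial_le_exp (Φ / 3) (by positivity) 2
      have t3 : (2 : ℕ).factorial = 2 := rfl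
      rw [t3] at t2
      push_cast at t2
      have t4 : Real.exp (2 * Φ) = Real.exp (5 / 3 * Φ) * Real.exp (Φ / 3) := by
        rw [← Real.exp_add]; congr 1; ring
      rw [t4]
      refine mul_le_mul t1 (le_trans (le_of_eq ?_) t2) (by positivity) (Real.exp_pos _).le
      ring
    have e4 : n ^ 10 * (Φ ^ 2 / 18) * (2 * ρ) ≤ 1 := by
      have := mul_le_mul_of_nonneg_right e3 (by positivity : 0 ≤ 2 * ρ)
      linarith
    have e5 : n ^ 10 * (Φ ^ 2 / 18) * (2 * ρ) * (185 ^ 2 * 4) ≤ J.card * (Φ * ρ) ^ 2 := by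
      refine le_trans ?_ e1
      exact mul_le_of_le_one_left (by norm_num) e4
    have e6 : (Φ ^ 2 * ρ / 2) * (64 * n ^ 10) ≤ (Φ ^ 2 * ρ / 2) * (2 * ρ * J.card) := by
      have t0 : 0 ≤ n ^ 10 * Φ ^ 2 * ρ := by positivity
      nlinarith
    exact le_of_mul_le_mul_left e6 (by positivity)
  have hsq : 8 * n ^ 5 ≤ Real.sqrt (2 * ρ * J.card) := by
    apply Real.le_sqrt_of_sq_le
    refine le_trans (le_of_eq ?_) hbig; ring
  have hq : 8 / Real.sqrt (2 * ρ * J.card) ≤ 1 / n ^ 5 := by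
    rw [div_le_div_iff₀ (by have : 0 < n ^ 5 := by positivity
                            linarith) (by positivity)]
    linarith
  set T : ι × ι × ι → Set Ω := fun q => {ω | (q.1 ≠ q.2.1 ∧ q.1 ≠ q.2.2 ∧ q.2.1 ≠ q.2.2) ∧
    teMagnitude (workerCov J fun i j => X (i, j) ω) q.1 q.2.1 q.2.2 = 1} with hT
  have hTp : ∀ q, μ.real (T q) ≤ 1 / n ^ 5 := by
    rintro ⟨a, b, i⟩
    by_cases hq' : a ≠ b ∧ a ≠ i ∧ b ≠ i
    · have h1 := hX.prob_teMagnitude_eq_one_le hJ hm hρ h.ρ_lt h.abs_le hq'.1 hq'.2.1 hq'.2.2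
      exact (measureReal_mono (fun ω hω => hω.2) (measure_ne_top _ _)).trans (h1.trans hq)
    · have : T (a, b, i) = ∅ := by
        ext ω
        simp only [hT, Set.mem_ofPred_eq, Set.mem_empty_iff_false, iff_false]
        exact fun h => hq' h.1
      rw [this, measureReal_empty]; positivity
  have hsub : {ω | ¬ ∀ a b i, a ≠ b → a ≠ i → b ≠ i →
      teMagnitude (workerCov J fun i j => X (i, j) ω) a b i ≠ 1} ⊆ ⋃ q, T q := by
    intro ω hω
    simp only [Set.mem_ofPred_eq, not_forall, not_not] at hω
    obtain ⟨a, b, i, h1, h2, h3, h4⟩ := hω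
    exact Set.mem_iUnion.2 ⟨(a, b, i), ⟨h1, h2, h3⟩, h4⟩
  refine (measureReal_mono hsub (measure_ne_top _ _)).trans
    ((measureReal_iUnion_fintype_le _).trans ((Finset.sum_le_sum fun i _ => hTp i).trans ?_))
  simp only [Finset.sum_const, Finset.card_univ, Fintype.card_prod, nsmul_eq_mul]
  push_cast
  rw [← hnd]
  apply le_of_eq
  field_simp

theorem exp_vote_le_of_small (h : WellEstimated r ρ L s) (hε : 1 ≤ 16 * L * ε) :
    Real.exp (Fintype.card ι * (renyi r / (8 * L)) / 2 - Fintype.card ι * renyi r) ≤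
      Real.exp (-(1 - ε) * (Fintype.card ι * renyi r)) := by
  apply Real.exp_le_exp.2
  have hL := h.one_le
  have hH : 0 ≤ Fintype.card ι * renyi r := mul_nonneg (Nat.cast_nonneg _) h.renyi_pos.le
  have : Fintype.card ι * (renyi r / (8 * L)) / 2 = Fintype.card ι * renyi r * (1 / (16 * L)) := by
    field_simp; ring
  rw [this]
  have h1 : 1 / (16 * L) ≤ ε := by
    rw [div_le_iff₀ (by positivity)]; linarith
  nlinarith

theorem exp_vote_le_of_large (h : WellEstimated r ρ L s) (hΦ : 6 * L ≤ renyi r) (hε : 0 < ε)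
    (hεL : 2 * Real.log (16 / ε) / ε ≤ L) :
    (Fintype.card ι + 1) * Real.exp (Fintype.card ι * Real.log (4 * (1 + renyi r)) -
      Fintype.card ι * renyi r) ≤ Real.exp (-(1 - ε) * (Fintype.card ι * renyi r)) := by
  have hL := h.one_le
  have hΦ0 := h.renyi_pos
  set n : ℝ := (Fintype.card ι : ℝ) with hn
  have hn0 : 0 ≤ n := Nat.cast_nonneg _
  set Φ := renyi r with hΦd
  have h1 : n + 1 ≤ Real.exp n := Real.add_one_le_exp n
  have h2 : 1 + Real.log (4 * (1 + Φ)) ≤ ε * Φ := by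
    have t1 : Real.log (4 * (1 + Φ)) ≤ Real.log (16 / ε) + (ε * Φ / 2 - 1) := by
      have t2 : Real.log (4 * (1 + Φ)) ≤ Real.log (16 / ε * (ε * Φ / 2)) := by
        apply Real.log_le_log (by positivity)
        have : 16 / ε * (ε * Φ / 2) = 8 * Φ := by field_simp; norm_num
        rw [this]; linarith
      rw [Real.log_mul (x := 16 / ε) (by positivity) (by positivity)] at t2
      linarith [Real.log_le_sub_one_of_pos (by positivity : 0 < ε * Φ / 2)]
    rw [div_le_iff₀ hε] at hεL
    nlinarith
  calc (n + 1) * Real.exp (n * Real.log (4 * (1 + Φ)) - n * Φ)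
      ≤ Real.exp n * Real.exp (n * Real.log (4 * (1 + Φ)) - n * Φ) :=
        mul_le_mul_of_nonneg_right h1 (Real.exp_pos _).le
    _ = Real.exp (n * (1 + Real.log (4 * (1 + Φ))) - n * Φ) := by
        rw [← Real.exp_add]; congr 1; ring
    _ ≤ _ := by
        apply Real.exp_le_exp.2
        have := mul_le_mul_of_nonneg_left h2 hn0
        linarith

/-- The votes that may be misjudged with the estimated weights form a set of small probability,
outside an event of small probability for the estimation. -/
theorem exists_misjudged (h : WellEstimated r ρ L s) (hn : Real.exp L = Fintype.card ι)
    (hε : 0 < ε) (hε1 : 1 ≤ 16 * L * ε) (hε2 : 2 * Real.log (16 / ε) / ε ≤ L)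
    {d : ℕ} {X : ι × Fin d → Ω → ℤˣ} {m : ι × Fin d → ℝ}
    {J : Finset (Fin d)} (hX : IsSignFamily μ X m) (hJ : 0 < J.card)
    (hm : ∀ i, ∀ j ∈ J, m (i, j) = r i)
    (hl : J.card * s ^ 2 = 4 * Real.log (8 * (Fintype.card ι : ℝ) ^ 2 * d)) :
    ∃ Bad : Set (ι → ℤˣ), (∀ Z : ι → Ω → ℤˣ, IsSignFamily μ Z r →
        μ.real {ω | (fun i => Z i ω) ∈ Bad} ≤
          Real.exp (-(1 - ε) * (Fintype.card ι * renyi r))) ∧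
      μ.real {ω | ¬ ∀ rh, IsTEEstimate (workerCov J fun i j => X (i, j) ω) rh →
        ∀ x : ι → ℤˣ, ∑ i, npWeights rh i * val (x i) ≤ 0 → x ∈ Bad} ≤
        2 / (Fintype.card ι : ℝ) ^ 2 := by
  have hL := h.one_le
  set n : ℝ := (Fintype.card ι : ℝ) with hnd
  have hn1 : 2 ≤ n := by rw [← hn]; linarith [Real.add_one_le_exp L]
  have hd1 : (1 : ℝ) ≤ d := by
    have h1 : J.card ≤ d := by simpa using Finset.card_le_univ J
    exact_mod_cast hJ.trans_le h1
  have hbig : Real.exp 1 ≤ 8 * n ^ 2 * d := by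
    have := Real.exp_one_lt_d9
    nlinarith
  have hpos : 0 < 8 * n ^ 2 * (d : ℝ) := by positivity
  have hl1 : 1 ≤ Real.log (8 * n ^ 2 * d) := by
    rw [Real.le_log_iff_exp_le hpos]; exact hbig
  have hcov := hX.prob_not_covAccurate_le hJ hm h.abs_le_one h.s_pos hl
  have hcov' : μ.real {ω | ¬ CovAccurate (workerCov J fun i j => X (i, j) ω) r s} ≤
      1 / n ^ 2 := by
    refine hcov.trans ?_
    have e1 : Real.exp (-(2 * Real.log (8 * n ^ 2 * d))) = 1 / (8 * n ^ 2 * d) ^ 2 := by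
      rw [one_div, ← Real.exp_log (by positivity : 0 < (8 * n ^ 2 * (d : ℝ)) ^ 2), ← Real.exp_neg,
        Real.log_pow]
      push_cast; rfl
    rw [e1, mul_one_div, div_le_div_iff₀ (by positivity) (by positivity)]
    have e2 : 1 ≤ (d : ℝ) ^ 2 := by nlinarith
    have e3 : 0 < n ^ 4 := by positivity
    nlinarith
  rcases le_total (renyi r) (6 * L) with hΦ | hΦ
  · refine ⟨{x | ∑ i, npWeights r i * val (x i) ≤ Fintype.card ι * (renyi r / (8 * L))},
      fun Z hZ => ?_, ?_⟩
    · exact (h.prob_vote_le hZ _).trans (h.exp_vote_le_of_small hε1)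
    · refine le_trans (measureReal_mono ?_ (measure_ne_top _ _)) (hcov'.trans
        (div_le_div_of_nonneg_right (by norm_num) (by positivity)))
      intro ω hω
      simp only [Set.mem_ofPred_eq] at hω ⊢
      exact fun hC => hω fun rh hrh x hx => h.vote_le hΦ hC hrh hx
  · refine ⟨{x | (∃ i ∈ dominant r ρ L, val (x i) ≠ relSign r i) ∨
      ∑ i, npWeights r i * val (x i) ≤ Fintype.card ι * Real.log (4 * (1 + renyi r))},
      fun Z hZ => ?_, ?_⟩
    · refine le_trans ?_ (h.exp_vote_le_of_large hΦ hε hε2)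
      have hΦ0 := h.renyi_pos
      have h1 := h.prob_vote_le hZ (Real.log (4 * (1 + renyi r)))
      have h2 := h.prob_dominant_wrong_le hΦ hZ
      have hlog : Real.log (renyi r) ≤ Real.log (4 * (1 + renyi r)) :=
        Real.log_le_log hΦ0 (by linarith)
      have hlog0 : 0 ≤ Real.log (4 * (1 + renyi r)) := Real.log_nonneg (by linarith)
      rw [← hnd] at h1 h2 ⊢
      have e1 : Real.exp (n * Real.log (renyi r) - n * renyi r) ≤
          Real.exp (n * Real.log (4 * (1 + renyi r)) - n * renyi r) :=
        Real.exp_le_exp.2 (by nlinarith)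
      have e2 : Real.exp (n * Real.log (4 * (1 + renyi r)) / 2 - n * renyi r) ≤
          Real.exp (n * Real.log (4 * (1 + renyi r)) - n * renyi r) :=
        Real.exp_le_exp.2 (by nlinarith)
      set q := Real.exp (n * Real.log (4 * (1 + renyi r)) - n * renyi r)
      have hset : {ω | (fun i => Z i ω) ∈ {x : ι → ℤˣ |
          (∃ i ∈ dominant r ρ L, val (x i) ≠ relSign r i) ∨
          ∑ i, npWeights r i * val (x i) ≤ n * Real.log (4 * (1 + renyi r))}} =
          {ω | ∃ i ∈ dominant r ρ L, val (Z i ω) ≠ relSign r i} ∪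
          {ω | ∑ i, npWeights r i * val (Z i ω) ≤ n * Real.log (4 * (1 + renyi r))} := rfl
      rw [hset]
      refine (measureReal_union_le _ _).trans ((add_le_add h2 h1).trans ?_)
      nlinarith
    · have htie := h.prob_tie_le hΦ hn hX hJ hm hl hl1
      rw [← hnd] at htie
      have e : 2 / n ^ 2 = 1 / n ^ 2 + 1 / n ^ 2 := by ring
      rw [e]
      refine le_trans (measureReal_mono ?_ (measure_ne_top _ _))
        ((measureReal_union_le _ _).trans (add_le_add hcov' htie))
      intro ω hω
      by_contra hcon
      simp only [Set.mem_union, Set.mem_ofPred_eq, not_or, not_not] at hω hcon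
      obtain ⟨hC, ht⟩ := hcon
      exact hω fun rh hrh x hx => h.vote_or_dominant_wrong hΦ hC ht hrh hx

end WellEstimated

end Crowd

namespace Crowd

theorem exp_neg_renyi_div_le {p q H ε n : ℝ} (hε : 0 < ε) (hε1 : ε ≤ 1) (hn : 10 ≤ ε * n)
    (hH : 2 ≤ n * H) (hp : p ≤ Real.exp (-(1 - ε / 2) * H)) (hq : 1 - 5 / n ^ 2 ≤ q) :
    p / q ≤ Real.exp (-(1 - ε) * H) := by
  have hn0 : 10 ≤ n := by nlinarith
  have hn0' : 0 < n := by linarith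
  have hq' : Real.exp (-(ε / 2 * H)) ≤ q := by
    refine le_trans ?_ hq
    have h1 : ε / n ≤ ε / 2 * H := by
      rw [div_le_iff₀ hn0']; nlinarith
    have h2 : Real.exp (-(ε / 2 * H)) ≤ 1 / (1 + ε / n) := by
      rw [Real.exp_neg, ← one_div]
      apply one_div_le_one_div_of_le (by positivity)
      linarith [Real.add_one_le_exp (ε / 2 * H)]
    refine h2.trans ?_
    rw [div_le_iff₀ (by positivity)]
    have h3 : 10 / n ^ 2 ≤ ε / n := by
      rw [div_le_div_iff₀ (by positivity) hn0']; nlinarith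
    have h4 : ε / n ≤ 1 := by
      rw [div_le_one hn0']; linarith
    have h5 : 5 / n ^ 2 = 10 / n ^ 2 / 2 := by ring
    have h6 : 0 ≤ 10 / n ^ 2 := by positivity
    nlinarith
  have hpos := Real.exp_pos (-(ε / 2 * H))
  rw [div_le_iff₀ (hpos.trans_le hq')]
  refine hp.trans ?_
  have e : Real.exp (-(1 - ε / 2) * H) = Real.exp (-(1 - ε) * H) * Real.exp (-(ε / 2 * H)) := by
    rw [← Real.exp_add]; congr 1; ring
  rw [e]
  exact mul_le_mul_of_nonneg_left hq' (Real.exp_pos _).le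

/-- The hypotheses on the number of tasks make Triangular Estimation accurate. -/
theorem wellEstimated_of_card {ι : Type*} [Fintype ι] {r : ι → ℝ} {ρ L l s d : ℝ}
    (hρ : 0 < ρ) (hρ' : ρ < 1 / 2) (hr : ∀ i, |r i| ≤ 1 - 2 * ρ) (hV : 0 < informativeness r)
    (hS : 3 ≤ ∑ i, r i) (hL : 1 ≤ L) (hl : 0 < l) (hd0 : 0 < d) (hs : s = Real.sqrt (8 * l / d))
    (hd : 30 * 2 ^ 8 * L ^ 2 * l / informativeness r ^ 2 *
          max (36 / (renyi r ^ 2 * ρ ^ 2 * informativeness r ^ 2))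
            (1 / ((Fintype.card ι : ℝ) * avgRel r ^ 2)) ≤ d) :
    WellEstimated r ρ L s := by
  have hne : Nonempty ι := by
    by_contra hcon
    rw [not_nonempty_iff] at hcon
    simp at hS
    linarith
  set V := informativeness r with hVd
  set S := ∑ i, r i with hSd
  set n : ℝ := (Fintype.card ι : ℝ) with hn
  have hn0 : 0 < n := by rw [hn]; exact_mod_cast Fintype.card_pos
  have hΦ : 0 < renyi r := by
    have h1 := sq_sum_le_card_mul_renyi (r := r) fun i => by linarith [hr i]
    rw [← hSd, ← hn] at h1
    by_contra hcon
    have h2 : n * renyi r ≤ 0 := mul_nonpos_of_nonneg_of_nonpos hn0.le (not_lt.1 hcon)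
    have h3 : 2 * n * (n * renyi r) ≤ 0 := mul_nonpos_of_nonneg_of_nonpos (by positivity) h2
    nlinarith
  set Φ := renyi r with hΦd
  have hss : s ^ 2 = 8 * l / d := by rw [hs]; exact Real.sq_sqrt (by positivity)
  have hs0 : 0 < s := by rw [hs]; exact Real.sqrt_pos.2 (by positivity)
  have hpre : 0 ≤ 30 * 2 ^ 8 * L ^ 2 * l / V ^ 2 := by positivity
  have hd1 := (mul_le_mul_of_nonneg_left (le_max_left _ _) hpre).trans hd
  have hd2 := (mul_le_mul_of_nonneg_left (le_max_right _ _) hpre).trans hd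
  refine ⟨hρ, hρ', hr, hV, hS, hL, hs0, ?_, ?_⟩
  · refine abs_le_of_sq_le_sq' ?_ (by positivity) |>.2
    have e1 : 30 * 2 ^ 8 * L ^ 2 * l / V ^ 2 * (36 / (Φ ^ 2 * ρ ^ 2 * V ^ 2)) =
        276480 * (L ^ 2 * l) / (V ^ 2 * (Φ * ρ)) ^ 2 := by field_simp; norm_num
    rw [e1, div_le_iff₀ (by positivity)] at hd1
    have e2 : (185 * L * s) ^ 2 = 273800 * (L ^ 2 * l) / d := by
      rw [mul_pow, hss]; ring
    rw [e2, div_le_iff₀ hd0]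
    have : 0 ≤ L ^ 2 * l := by positivity
    linarith
  · refine abs_le_of_sq_le_sq' ?_ (by positivity) |>.2
    have e1 : 30 * 2 ^ 8 * L ^ 2 * l / V ^ 2 * (1 / (n * avgRel r ^ 2)) =
        7680 * (L ^ 2 * l * n) / (V * S) ^ 2 := by
      rw [avgRel, ← hSd, ← hn]; field_simp; norm_num
    rw [e1, div_le_iff₀ (by positivity)] at hd2
    have e2 : (30 * L * Real.sqrt n * s) ^ 2 = 7200 * (L ^ 2 * l * n) / d := by
      rw [mul_pow, mul_pow, Real.sq_sqrt hn0.le, hss]; ring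
    rw [e2, div_le_iff₀ hd0]
    have : 0 ≤ L ^ 2 * l * n := by positivity
    linarith

/-- The hypotheses on the number of workers give a large eigengap. -/
theorem le_card_mul_eigengap {ι : Type*} [Fintype ι] {d : ℕ} {k : Fin d → Fin 2} {m : ℝ}
    (hm : 0 < m) (hk : ∀ a, ((Finset.univ.filter fun j => k j = a).card : ℝ) = m)
    (hd : (d : ℝ) = 2 * m) {r : Fin 2 → ι → ℝ} (hr : ∀ a i, |r a i| ≤ 1)
    (hn3 : 3 ≤ Fintype.card ι)
    (hlt : ∑ i, r 1 i ^ 2 < ∑ i, r 0 i ^ 2) (hne : ∑ i, r 0 i * r 1 i ≠ 0) {K q M : ℝ}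
    (hK : Real.exp K ≤ Real.log d) (hq : 0 < q) (hq1 : q ≤ 1)
    (h : (gam r ^ 2 + 1) / (gam r - 1) ^ 2 * (Real.log d / eigengap k r) *
      max (48 * Real.log (Fintype.card ι) / q) M ≤ Fintype.card ι) :
    48 * K * Real.log d * ((gam r ^ 2 + 1) / (gam r - 1) ^ 2) ≤
      Fintype.card ι * eigengap k r := by
  have hn0 : 0 < Fintype.card ι := by omega
  have hn0' : (3 : ℝ) ≤ Fintype.card ι := by exact_mod_cast hn3
  have hP2 : (∑ i, r 0 i * r 1 i) ^ 2 ≤ (∑ i, r 0 i ^ 2) * ∑ i, r 1 i ^ 2 :=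
    Finset.sum_mul_sq_le_sq_mul_sq _ _ _
  obtain ⟨u₀, u₁, Ap, Am, δ, hu, hu0, hδ, hδ0, hδsq, hγ, e0, e1, htr, hAm, hAlt⟩ :=
    exists_gram_eigenpair hlt hne hP2 (Finset.sum_nonneg fun i _ => sq_nonneg (r 1 i))
  have hgap := card_mul_eigengap hm hk hd hn0 r hu0 e0 e1 htr hAm hAlt
  have hγ' : 1 < gam r := hγ
  set n : ℝ := (Fintype.card ι : ℝ) with hn
  set Γ := (gam r ^ 2 + 1) / (gam r - 1) ^ 2 with hΓ
  have hΓ1 : 1 ≤ Γ := by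
    rw [hΓ, one_le_div (by have : 0 < gam r - 1 := by linarith
                           positivity)]
    nlinarith
  have hn' : 0 < n := by linarith
  have hΔ : 0 < eigengap k r := by
    have : 0 < n * eigengap k r := by rw [hgap]; linarith
    exact (mul_pos_iff_of_pos_left hn').1 this
  set Δ := eigengap k r with hΔd
  have hlogd : 0 < Real.log d := (Real.exp_pos K).trans_le hK
  have hsq : ∀ a, ∑ i, r a i ^ 2 ≤ n := fun a => by
    refine (Finset.sum_le_sum (g := fun _ => (1 : ℝ)) fun i _ => ?_).trans (by simp [hn])
    rw [← sq_abs]; exact pow_le_one₀ (abs_nonneg _) (hr a i)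
  have hgap2 : n * Δ ≤ 2 * n := by
    rw [hgap]; linarith [hsq 0, hsq 1]
  have hlogn : 1 ≤ Real.log n := by
    rw [Real.le_log_iff_exp_le hn']
    have := Real.exp_one_lt_d9
    linarith
  have h1 : Γ * (Real.log d / Δ) * (48 * Real.log n) ≤ n := by
    refine le_trans (mul_le_mul_of_nonneg_left ?_ (by positivity)) h
    refine le_trans ?_ (le_max_left _ _)
    rw [le_div_iff₀ hq]
    exact mul_le_of_le_one_right (by positivity) hq1
  have h2 : 48 * Real.log n * Real.log d * Γ ≤ n * Δ := by
    have e : Γ * (Real.log d / Δ) * (48 * Real.log n) = 48 * Real.log n * Real.log d * Γ / Δ := by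
      ring
    rw [e, div_le_iff₀ hΔ] at h1
    exact h1
  have h3 : K ≤ Real.log n := by
    rw [Real.le_log_iff_exp_le hn']
    have t1 : Real.log d ≤ Real.log n * Real.log d * Γ := by
      have := mul_le_mul hlogn hΓ1 zero_le_one (by linarith)
      nlinarith
    have : 48 * Real.log d ≤ 2 * n := by linarith
    linarith
  refine le_trans ?_ h2
  gcongr

variable {Ω : Type*} [MeasurableSpace Ω] {μ : Measure Ω} {n₁ n₂ d : ℕ}

theorem IsTwoTypeModel.isSignFamily {ι : Type*} {k : Fin d → Fin 2} {r : Fin 2 → ι → ℝ}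
    {y : Fin d → Ω → ℤˣ} {Y : ι → Fin d → Ω → ℤˣ} {U : Fin d → Ω → ℤˣ}
    (h : IsTwoTypeModel μ k r y Y U) :
    IsSignFamily μ (fun (p : ι × Fin d) ω => Y p.1 p.2 ω * y p.2 ω) fun p => r (k p.2) p.1 := by
  refine ⟨fun p => ?_, ?_, fun p => ?_⟩
  · exact (Measurable.of_discrete (f := fun q : ℤˣ × ℤˣ => q.1 * q.2)).comp
      ((h.measurable_Y p.1 p.2).prodMk (h.measurable_y p.2))
  · exact h.indep.precomp (g := fun p : ι × Fin d => Sum.inl (Sum.inr p))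
      (Sum.inl_injective.comp Sum.inr_injective)
  · rw [← h.prob_Y p.1 p.2]
    congr 1; ext ω
    simp only [Set.mem_ofPred_eq]
    rcases Int.units_eq_one_or (Y p.1 p.2 ω) with h1 | h1 <;>
      rcases Int.units_eq_one_or (y p.2 ω) with h2 | h2 <;> simp [h1, h2]

theorem workerCov_signs {ι : Type*} (J : Finset (Fin d)) (B : ι → Fin d → ℤˣ) (y : Fin d → ℤˣ) :
    workerCov J (fun i j => B i j * y j) = workerCov J B := by
  funext a b
  simp only [workerCov, val_mul]
  congr 1
  refine Finset.sum_congr rfl fun j _ => ?_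
  linear_combination val (B a j) * val (B b j) * val_mul_self (y j)

theorem clusterBy_eq_of_separates [Nonempty (Fin n₁)] {k : Fin d → Fin 2} {m : ℝ} (hm : 0 < m)
    (hk : ∀ a, ((Finset.univ.filter fun j => k j = a).card : ℝ) = m) (hd : (d : ℝ) = 2 * m)
    {B : Fin n₁ → Fin d → ℤˣ} {y : Fin d → ℤˣ} {v : Fin d → ℝ}
    (hv : IsPrincipalEigenvector (taskSimilarity B) v) (c : Fin d → ℤˣ)
    (hsep : ∀ p, IsPrincipal (respVec fun i j => B i j * y j) Finset.univ p →
      ∃ (a : Fin 2 → ℝ) (e : ℝ), 0 < e ∧ 4 * e < a 0 - a 1 ∧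
        ∀ j, |(|inner ℝ (respVec (fun i j => B i j * y j) j) p|) - a (k j)| ≤ e) :
    clusterBy v c = k := by
  obtain ⟨p, hp, b, hb, hvp⟩ := hv.exists_isPrincipal
  obtain ⟨a, e, -, hae, hj⟩ := hsep p hp.signs
  refine clusterBy_eq hm hk hd (a := fun l => b * a l) (e := b * e) (by nlinarith) (fun j => ?_) c
  have h1 := hj j
  rw [abs_inner_respVec_signs] at h1
  rw [hvp, ← mul_sub, abs_mul, abs_of_pos hb]
  exact mul_le_mul_of_nonneg_left h1 hb.le

theorem vote_ne_imp {ι : Type*} [Fintype ι] {w : ι → ℝ} {B : ι → Fin d → ℤˣ} {j : Fin d} {s : ℤˣ}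
    (h : vote w B j ≠ val s) : ∑ i, w i * val (B i j * s) ≤ 0 := by
  by_contra hcon
  apply h
  have h1 : 0 < (∑ i, w i * val (B i j)) * val s := by
    rw [Finset.sum_mul]
    simpa only [val_mul, mul_assoc] using not_le.1 hcon
  rw [vote]
  rcases val_eq_or s with hs | hs <;> rw [hs] at h1 ⊢
  · exact Real.sign_of_pos (by linarith)
  · exact Real.sign_of_neg (by linarith)

end Crowd

namespace Crowd

/-- The data from which the types and the reliabilities are estimated. -/
def data {Ω : Type*} {n₁ n₂ d : ℕ} (Y : Fin n₁ ⊕ Fin n₂ → Fin d → Ω → ℤˣ) (U : Fin d → Ω → ℤˣ)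
    (ω : Ω) : (Fin n₁ ⊕ Fin n₂ → Fin d → ℤˣ) × (Fin d → ℤˣ) :=
  (fun i j => Y i j ω, fun j => U j ω)

theorem IsTwoTypeModel.measurable_data {Ω : Type*} [MeasurableSpace Ω] {μ : Measure Ω}
    {n₁ n₂ d : ℕ} {k : Fin d → Fin 2} {r : Fin 2 → Fin n₁ ⊕ Fin n₂ → ℝ}
    {y : Fin d → Ω → ℤˣ} {Y : Fin n₁ ⊕ Fin n₂ → Fin d → Ω → ℤˣ} {U : Fin d → Ω → ℤˣ}
    (h : IsTwoTypeModel μ k r y Y U) : Measurable (data Y U) :=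
  (measurable_pi_lambda _ fun i => measurable_pi_lambda _ fun j => h.measurable_Y i j).prodMk
    (measurable_pi_lambda _ fun j => h.measurable_U j)

/-- A property of the estimates is described by a measurable set, and defines an event. -/
theorem IsTwoTypeModel.exists_measurableSet {Ω : Type*} [MeasurableSpace Ω] {μ : Measure Ω}
    {n₁ n₂ d : ℕ} {k : Fin d → Fin 2} {r : Fin 2 → Fin n₁ ⊕ Fin n₂ → ℝ}
    {y : Fin d → Ω → ℤˣ} {Y : Fin n₁ ⊕ Fin n₂ → Fin d → Ω → ℤˣ} {U : Fin d → Ω → ℤˣ}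
    (h : IsTwoTypeModel μ k r y Y U) (evec : (Fin n₁ → Fin d → ℤˣ) → Fin d → ℝ)
    (te : Finset (Fin d) → (Fin n₂ → Fin d → ℤˣ) → Fin n₂ → ℝ)
    (P : (Fin d → Fin 2) → (Fin 2 → Fin n₂ → ℝ) → Prop) :
    ∃ S : Set ((Fin d → Fin 2) × (Fin 2 → Fin n₂ → ℝ)), MeasurableSet S ∧
      {ω | (typeEst evec Y U ω, relEst evec te Y U ω) ∈ S} =
        {ω | P (typeEst evec Y U ω) (relEst evec te Y U ω)} ∧
      MeasurableSet {ω | P (typeEst evec Y U ω) (relEst evec te Y U ω)} := by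
  set F : (Fin n₁ ⊕ Fin n₂ → Fin d → ℤˣ) × (Fin d → ℤˣ) →
      (Fin d → Fin 2) × (Fin 2 → Fin n₂ → ℝ) := fun x =>
    (typeEst evec (fun i j x => x.1 i j) (fun j x => x.2 j) x,
      relEst evec te (fun i j x => x.1 i j) (fun j x => x.2 j) x) with hF
  have hFω : ∀ ω, (typeEst evec Y U ω, relEst evec te Y U ω) = F (data Y U ω) := fun ω => rfl
  refine ⟨{q | P q.1 q.2} ∩ Set.range F, ?_, ?_, ?_⟩
  · exact ((Set.finite_range F).subset Set.inter_subset_right).measurableSet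
  · ext ω
    simp only [Set.mem_ofPred_eq, Set.mem_inter_iff, and_iff_left_iff_imp]
    exact fun _ => ⟨data Y U ω, (hFω ω).symm⟩
  · exact measurableSet_of_finite_range h.measurable_data {x | P (F x).1 (F x).2}

end Crowd

end

theorem theorem3 (ε : ℝ) (hε : 0 < ε) :
    ∃ N : ℕ, ∀ (n₁ n₂ d : ℕ)
      (Ω : Type*) [MeasurableSpace Ω] (μ : Measure Ω) [IsProbabilityMeasure μ]
      (k : Fin d → Fin 2) (r : Fin 2 → Fin n₁ ⊕ Fin n₂ → ℝ) (ρ : Fin 2 → ℝ)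
      (y : Fin d → Ω → ℤˣ) (Y : Fin n₁ ⊕ Fin n₂ → Fin d → Ω → ℤˣ) (U : Fin d → Ω → ℤˣ)
      (evec : (Fin n₁ → Fin d → ℤˣ) → Fin d → ℝ)
      (te : Finset (Fin d) → (Fin n₂ → Fin d → ℤˣ) → Fin n₂ → ℝ)
      (r₁ : Fin 2 → Fin n₁ → ℝ) (r₂ : Fin 2 → Fin n₂ → ℝ),
      -- reliabilities of the first and of the second group of workers
      (r₁ = fun l i => r l (Sum.inl i)) → (r₂ = fun l i => r l (Sum.inr i)) →
      -- the model
      Crowd.IsTwoTypeModel μ k r y Y U →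
      -- equally many tasks of each type, more tasks than workers, and at least three workers
      2 * (Crowd.cluster k 0).card = d → 2 * (Crowd.cluster k 1).card = d →
      n₁ + n₂ < d → 3 ≤ n₁ →
      (∀ l, 0 < ρ l ∧ ρ l < 1 / 2) →
      (∀ l i, ρ l ≤ (1 + r l i) / 2 ∧ (1 + r l i) / 2 ≤ 1 - ρ l) →
      -- the first type is easier for the first group, and `ω` is defined
      ∑ i, r₁ 1 i ^ 2 < ∑ i, r₁ 0 i ^ 2 → ∑ i, r₁ 0 i * r₁ 1 i ≠ 0 →
      -- identifiability for the second group
      (∀ l, 0 < Crowd.informativeness (r₂ l)) → (∀ l, 3 / (n₂ : ℝ) ≤ Crowd.avgRel (r₂ l)) →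
      -- the algorithm: principal eigenvectors and Triangular Estimation
      (∀ B, Crowd.IsPrincipalEigenvector (Crowd.taskSimilarity B) (evec B)) →
      (∀ J B, Crowd.IsTEEstimate (Crowd.workerCov J B) (te J B)) →
      -- enough workers to cluster the tasks
      (∀ l, (Crowd.gam r₁ ^ 2 + 1) / (Crowd.gam r₁ - 1) ^ 2 *
          (Real.log d / Crowd.eigengap k r₁) *
          max (48 * Real.log n₁ / (Crowd.informativeness (r₂ l) ^ 2 * Crowd.renyi (r₂ l) * ρ l))
            (3 * Crowd.avgRel (r₂ l)) ≤ (n₁ : ℝ)) →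
      -- enough tasks for Triangular Estimation
      (∀ l, 30 * 2 ^ 8 * Real.log n₂ ^ 2 * Real.log (8 * (n₂ : ℝ) ^ 2 * d) /
          Crowd.informativeness (r₂ l) ^ 2 *
          max (36 / (Crowd.renyi (r₂ l) ^ 2 * ρ l ^ 2 * Crowd.informativeness (r₂ l) ^ 2))
            (1 / ((n₂ : ℝ) * Crowd.avgRel (r₂ l) ^ 2)) ≤ (d : ℝ)) →
      -- the limit
      N ≤ n₂ →
      -- an event of high probability, determined by the outcome of the clustering and of
      -- the estimation of the reliabilities
      ∃ S : Set ((Fin d → Fin 2) × (Fin 2 → Fin n₂ → ℝ)), ∃ E : Set Ω, MeasurableSet S ∧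
        E = {ω | (Crowd.typeEst evec Y U ω, Crowd.relEst evec te Y U ω) ∈ S} ∧
        1 - ε ≤ μ.real E ∧
        ∀ j,
          (μ[|E ∩ {ω | Crowd.typeEst evec Y U ω j = k j}]).real
              {ω | Crowd.labelEst evec te Y U j ω ≠ Crowd.val (y j ω)} ≤
            Real.exp (-(1 - ε) * n₂ * Crowd.renyi (r₂ (k j))) ∧
          (μ[|E ∩ {ω | Crowd.typeEst evec Y U ω j ≠ k j}]).real
              {ω | Crowd.labelEst evec te Y U j ω ≠ Crowd.val (y j ω)} ≤
            Real.exp (-(1 - ε) * n₂ *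
              Crowd.wmvExponent (Crowd.npWeights (r₂ (Crowd.otherType (k j)))) (r₂ (k j))) := by
  obtain ⟨e', he', he1, hee⟩ : ∃ e', 0 < e' ∧ e' ≤ 1 ∧ e' ≤ ε :=
    ⟨min ε 1, lt_min hε one_pos, min_le_right _ _, min_le_left _ _⟩
  obtain ⟨M, hM1, hM2, hM3⟩ : ∃ M : ℝ, 10 / e' ≤ M ∧ Real.exp 250000 ≤ M ∧
      2 * Real.log (16 / (e' / 2)) / (e' / 2) ≤ M :=
    ⟨max (10 / e') (max (Real.exp 250000) (2 * Real.log (16 / (e' / 2)) / (e' / 2))),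
      le_max_left _ _, (le_max_left _ _).trans (le_max_right _ _),
      (le_max_right _ _).trans (le_max_right _ _)⟩
  refine ⟨⌈Real.exp M⌉₊, ?_⟩
  intro n₁ n₂ d Ω _ μ _ k r ρ y Y U evec te r₁ r₂ hr₁ hr₂ hmod hk0 hk1 hnd hn₁ hρ hrρ hlt hne hV
    havg hevec hte hworkers htasks hN
  have hn₂M : Real.exp M ≤ n₂ := (Nat.le_ceil _).trans (by exact_mod_cast hN)
  have hn₂0 : (0 : ℝ) < n₂ := (Real.exp_pos M).trans_le hn₂M
  have hL : M ≤ Real.log n₂ := (Real.le_log_iff_exp_le hn₂0).2 hn₂M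
  have h10 : 10 ≤ 10 / e' := by rw [le_div_iff₀ he']; linarith
  have hL1 : 1 ≤ Real.log n₂ := by linarith
  have hLe : 10 ≤ e' * Real.log n₂ := by
    have := hM1.trans hL
    rw [div_le_iff₀ he'] at this
    linarith
  have hLn : Real.log n₂ ≤ n₂ := (Real.log_le_sub_one_of_pos hn₂0).trans (by linarith)
  have hn₂d : (n₂ : ℝ) ≤ d := by exact_mod_cast (by omega : n₂ ≤ d)
  have hn₁d : n₁ ≤ d := by omega
  have hd0 : (0 : ℝ) < d := hn₂0.trans_le hn₂d
  have hlogd : Real.exp 250000 ≤ Real.log d :=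
    (hM2.trans hL).trans (Real.log_le_log hn₂0 hn₂d)
  set m : ℝ := (d : ℝ) / 2 with hm
  have hm0 : 0 < m := by positivity
  have hdm : (d : ℝ) = 2 * m := by rw [hm]; ring
  have hk : ∀ a, ((Crowd.cluster k a).card : ℝ) = m := by
    intro a
    have h0 : 2 * ((Crowd.cluster k 0).card : ℝ) = d := by exact_mod_cast hk0
    have h1 : 2 * ((Crowd.cluster k 1).card : ℝ) = d := by exact_mod_cast hk1
    fin_cases a
    · change ((Crowd.cluster k 0).card : ℝ) = m; linarith
    · change ((Crowd.cluster k 1).card : ℝ) = m; linarith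
  have hkpos : ∀ a, 0 < (Crowd.cluster k a).card := fun a => by
    have : (0 : ℝ) < (Crowd.cluster k a).card := by rw [hk]; exact hm0
    exact_mod_cast this
  have habs : ∀ l i, |r l i| ≤ 1 - 2 * ρ l := fun l i => by
    rw [abs_le]; constructor <;> linarith [hrρ l i]
  have hS : ∀ l, 3 ≤ ∑ i, r₂ l i := fun l => by
    have := havg l
    rw [Crowd.avgRel, Fintype.card_fin, div_le_div_iff_of_pos_right hn₂0] at this
    exact this
  have hne₁ : Nonempty (Fin n₁) := ⟨⟨0, by omega⟩⟩
  set lg := Real.log (8 * (n₂ : ℝ) ^ 2 * d) with hlg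
  have hlg0 : 0 < lg := by
    apply Real.log_pos
    have h1 : (1 : ℝ) ≤ n₂ := by linarith
    nlinarith
  set s := Real.sqrt (8 * lg / d) with hs
  have hwell : ∀ l, Crowd.WellEstimated (r₂ l) (ρ l) (Real.log n₂) s := fun l => by
    refine Crowd.wellEstimated_of_card (hρ l).1 (hρ l).2 (fun i => ?_) (hV l) (hS l) hL1 hlg0 hd0
      hs ?_
    · rw [hr₂]; exact habs l _
    · rw [Fintype.card_fin]; exact htasks l
  have hX := hmod.isSignFamily
  have hX₁ : Crowd.IsSignFamily μ
      (fun (p : Fin n₁ × Fin d) ω => Y (Sum.inl p.1) p.2 ω * y p.2 ω) fun p => r₁ (k p.2) p.1 := by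
    rw [hr₁]
    exact hX.precomp (g := fun p : Fin n₁ × Fin d => (Sum.inl p.1, p.2)) fun p q h => by
      simp only [Prod.mk.injEq, Sum.inl.injEq] at h
      exact Prod.ext h.1 h.2
  have hX₂ : Crowd.IsSignFamily μ
      (fun (p : Fin n₂ × Fin d) ω => Y (Sum.inr p.1) p.2 ω * y p.2 ω) fun p => r₂ (k p.2) p.1 := by
    rw [hr₂]
    exact hX.precomp (g := fun p : Fin n₂ × Fin d => (Sum.inr p.1, p.2)) fun p q h => by
      simp only [Prod.mk.injEq, Sum.inr.injEq] at h
      exact Prod.ext h.1 h.2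
  have hgap := Crowd.le_card_mul_eigengap hm0 hk hdm (r := r₁) (K := 250000)
    (fun a i => by rw [hr₁]; linarith [habs a (Sum.inl i), (hρ a).1]) (by simpa using hn₁)
    hlt hne hlogd (q := Crowd.informativeness (r₂ 0) ^ 2 * Crowd.renyi (r₂ 0) * ρ 0)
    (by have := (hwell 0).renyi_mul_pos
        have := hV 0
        rw [mul_assoc]; positivity)
    (by have h1 := (hwell 0).renyi_mul_le
        have h2 := (hwell 0).le_one
        have h3 := (hwell 0).renyi_mul_pos
        have h4 := hV 0
        rw [mul_assoc]
        exact mul_le_one₀ (by nlinarith) h3.le (by linarith))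
    (by rw [Fintype.card_fin]; exact hworkers 0)
  have hcluster := hX₁.prob_not_separates_le hm0 hk hdm (by simpa using hn₁d)
    (fun a i => by rw [hr₁]; linarith [habs a (Sum.inl i), (hρ a).1]) hlt hne
    (by linarith [Real.add_one_le_exp (250000 : ℝ)]) (by norm_num at hgap ⊢; exact hgap)
  have hJs : m * (8 * lg / d) = 4 * lg := by rw [hdm]; field_simp; norm_num
  choose Bad hBad hEst using fun l => (hwell l).exists_misjudged (ε := e' / 2)
    (J := Crowd.cluster k l) (by rw [Real.exp_log hn₂0, Fintype.card_fin]) (by positivity)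
    (by linarith) (hM3.trans hL) hX₂ (hkpos l)
    (fun i j hj => by rw [(Finset.mem_filter.1 hj).2])
    (by rw [Fintype.card_fin, hk, hs, Real.sq_sqrt (by positivity)]; exact hJs)
  obtain ⟨S, hSm, hSE, hEm⟩ := hmod.exists_measurableSet evec te fun κ rh => κ = k ∧
    ∀ l, ∀ x : Fin n₂ → ℤˣ, ∑ i, Crowd.npWeights (rh l) i * Crowd.val (x i) ≤ 0 → x ∈ Bad l
  refine ⟨S, _, hSm, hSE.symm, ?_⟩
  set E : Set Ω := {ω | Crowd.typeEst evec Y U ω = k ∧ ∀ l, ∀ x : Fin n₂ → ℤˣ,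
    ∑ i, Crowd.npWeights (Crowd.relEst evec te Y U ω l) i * Crowd.val (x i) ≤ 0 → x ∈ Bad l}
    with hE
  have hprob : 1 - 5 / (n₂ : ℝ) ^ 2 ≤ μ.real E := by
    have hsub : Eᶜ ⊆ {ω | ¬ ∀ p, Crowd.IsPrincipal
        (Crowd.respVec fun i j => Y (Sum.inl i) j ω * y j ω) Finset.univ p →
        ∃ (a : Fin 2 → ℝ) (e : ℝ), 0 < e ∧ 4 * e < a 0 - a 1 ∧ ∀ j,
          |(|inner ℝ (Crowd.respVec (fun i j => Y (Sum.inl i) j ω * y j ω) j) p|) - a (k j)| ≤ e} ∪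
        ⋃ l, {ω | ¬ ∀ rh, Crowd.IsTEEstimate (Crowd.workerCov (Crowd.cluster k l)
          fun i j => Y (Sum.inr i) j ω * y j ω) rh → ∀ x : Fin n₂ → ℤˣ,
            ∑ i, Crowd.npWeights rh i * Crowd.val (x i) ≤ 0 → x ∈ Bad l} := by
      intro ω hω
      by_contra hcon
      simp only [Set.mem_union, Set.mem_iUnion, not_or, not_exists] at hcon
      obtain ⟨h1, h2⟩ := hcon
      have hty : Crowd.typeEst evec Y U ω = k :=
        Crowd.clusterBy_eq_of_separates (y := fun j => y j ω) hm0 hk hdm (hevec _) _ (not_not.1 h1)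
      refine hω ⟨hty, fun l x hx => not_not.1 (h2 l) _ ?_ x hx⟩
      rw [Crowd.workerCov_signs (y := fun j => y j ω)]
      simp only [Crowd.relEst, hty]
      exact hte _ _
    have hEc : μ.real Eᶜ ≤ 5 / (n₂ : ℝ) ^ 2 := by
      refine (measureReal_mono hsub (measure_ne_top _ _)).trans ((measureReal_union_le _ _).trans
        ((add_le_add hcluster ((measureReal_iUnion_fintype_le _).trans
          (Finset.sum_le_sum fun l _ => hEst l))).trans ?_))
      have h1 : 1 / (d : ℝ) ^ 2 ≤ 1 / (n₂ : ℝ) ^ 2 :=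
        one_div_le_one_div_of_le (by positivity) (by gcongr)
      simp only [Fintype.card_fin, Fin.sum_univ_two]
      have h2 : 5 / (n₂ : ℝ) ^ 2 = 1 / (n₂ : ℝ) ^ 2 + (2 / (n₂ : ℝ) ^ 2 + 2 / (n₂ : ℝ) ^ 2) := by
        ring
      linarith
    rw [probReal_compl_eq_one_sub hEm] at hEc
    linarith
  have hn₂e : 10 ≤ e' * n₂ := hLe.trans (by gcongr)
  refine ⟨?_, fun j => ⟨?_, ?_⟩⟩
  · refine le_trans ?_ hprob
    have : 5 / (n₂ : ℝ) ^ 2 ≤ e' := by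
      have h1 : 10 ≤ (n₂ : ℝ) := h10.trans (hM1.trans (hL.trans hLn))
      rw [div_le_iff₀ (by positivity), sq, ← mul_assoc]
      exact le_trans (by norm_num) (mul_le_mul hn₂e h1 (by norm_num) (by positivity))
    linarith
  · have hEj : E ∩ {ω | Crowd.typeEst evec Y U ω j = k j} = E :=
      Set.inter_eq_left.2 fun ω hω => by
        show Crowd.typeEst evec Y U ω j = k j
        rw [hω.1]
    set H := (n₂ : ℝ) * Crowd.renyi (r₂ (k j)) with hH
    have hH0 : 0 ≤ H := mul_nonneg hn₂0.le (hwell _).renyi_pos.le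
    have hnH : 2 ≤ (n₂ : ℝ) * H := by
      have := (hwell (k j)).nonempty
      have h1 := Crowd.sq_sum_le_card_mul_renyi (r := r₂ (k j)) fun i => by
        linarith [(hwell (k j)).abs_le i, (hρ (k j)).1]
      rw [Fintype.card_fin] at h1
      have h2 := pow_le_pow_left₀ zero_le_three (hS (k j)) 2
      linarith
    have herr : μ.real (E ∩ {ω | Crowd.labelEst evec te Y U j ω ≠ Crowd.val (y j ω)}) ≤
        Real.exp (-(1 - e' / 2) * H) := by
      have h1 := hBad (k j) (fun i ω => Y (Sum.inr i) j ω * y j ω)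
        (hX₂.precomp (g := fun i : Fin n₂ => (i, j)) fun _ _ h => (Prod.mk.inj h).1)
      rw [Fintype.card_fin] at h1
      refine le_trans (measureReal_mono ?_ (measure_ne_top _ _)) h1
      rintro ω ⟨hω, h2⟩
      have h3 := Crowd.vote_ne_imp h2
      rw [hω.1] at h3
      exact hω.2 _ _ h3
    rw [hEj, measureReal_def, ProbabilityTheory.cond_apply hEm, ENNReal.toReal_mul,
      ENNReal.toReal_inv, ← measureReal_def, ← measureReal_def, inv_mul_eq_div]
    refine (Crowd.exp_neg_renyi_div_le he' he1 hn₂e hnH herr hprob).trans ?_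
    apply Real.exp_le_exp.2
    rw [mul_assoc, ← hH]
    exact mul_le_mul_of_nonneg_right (by linarith) hH0
  · have hEj : E ∩ {ω | Crowd.typeEst evec Y U ω j ≠ k j} = ∅ := by
      ext ω
      simp only [Set.mem_inter_iff, Set.mem_ofPred_eq, Set.mem_empty_iff_false, iff_false, not_and,
        not_not]
      intro hω
      rw [hω.1]
    rw [hEj, ProbabilityTheory.cond_empty]
    simp only [measureReal_zero_apply]
    exact (Real.exp_pos _).le
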